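/- For a finite simple graph $G$, consider $1$-page drawings of $G$: the vertices are placed on a line in some order and every edge is drawn as an arc on one fixed side of the line, so that two edges $ab$ and $cd$ cross exactly when their endpoints alternate along the line. Let $\mathrm{cr}_1(G)$ be the minimum number of crossings (crossing pairs of edges), and let $\mathrm{cre}_1(G)$ be the minimum number of edges that are involved in at least one crossing, each minimum taken over all $1$-page drawings of $G$. The cyclomatic number of a graph is the difference between its number of edges and the number of edges of a maximal spanning forest; $G$ is a $k$-almost-tree if every biconnected component of $G$ has cyclomatic number at most $k$. Running times refer to a word RAM with words of $w$ bits, for every $w \ge c\log_2(n+m+2)$ with a constant $c$ that depends only on the algorithm; the input is the number $n$ of vertices, the number $m$ of edges, and an arbitrary list of the edges of $G$ (the parameter $k$ is not part of the input). The constants in the $O$-bounds are absolute. **Theorem.** If $G$ is a graph with $n$ vertices and cyclomatic number $k$, then $\mathrm{cr}_1(G)$ and $\mathrm{cre}_1(G)$ can each be computed in $O((5k)!+n)$ time. If $G$ is a $k$-almost-tree with $n\ge 1$ vertices, then $\mathrm{cr}_1(G)$ and $\mathrm{cre}_1(G)$ can each be computed in $O((5k)!\,n)$ time. -/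

import Mathlib

/-! ### Word RAM programs and their running time -/

namespace WordRAM

/-- The arithmetic operations of the machine; comparisons return `1` (true) or `0` (false). -/
inductive Op where
  | add | sub | mul | lt | eq

/-- The result of an operation on `w`-bit words: subtraction is truncated at `0`, overflow is
reduced modulo `2 ^ w`. -/
def Op.apply (w : ℕ) : Op → ℕ → ℕ → ℕ
  | .add, a, b => (a + b) % 2 ^ w
  | .sub, a, b => a - b
  | .mul, a, b => (a * b) % 2 ^ w
  | .lt, a, b => (if a < b then 1 else 0) % 2 ^ w
  | .eq, a, b => (if a = b then 1 else 0) % 2 ^ w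

/-- Expressions: constants, registers, array reads (random access), and operations. -/
inductive Expr where
  | const (c : ℕ)
  | reg (x : ℕ)
  | load (a : ℕ) (i : Expr)
  | op (o : Op) (e₁ e₂ : Expr)

/-- Programs of the machine, in structured form: each construct takes a bounded number of machine
instructions, and each array is a separate bank of randomly accessible memory. Being a finite object, a program mentions only
finitely many registers and arrays. -/
inductive Prog where
  | skip
  | assign (x : ℕ) (e : Expr)
  | store (a : ℕ) (i e : Expr)
  | seq (p q : Prog)
  | branch (b : Expr) (p q : Prog)
  | loop (b : Expr) (p : Prog)

/-- A memory state: the contents of the registers and of the arrays. -/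
@[ext]
structure State where
  reg : ℕ → ℕ
  arr : ℕ → ℕ → ℕ

/-- Set register `x` to `v`. -/
def State.setReg (s : State) (x v : ℕ) : State :=
  { s with reg := Function.update s.reg x v }

/-- Set cell `i` of array `a` to `v`. -/
def State.setArr (s : State) (a i v : ℕ) : State :=
  { s with arr := Function.update s.arr a (Function.update (s.arr a) i v) }

/-- The value of an expression on the machine with `w`-bit words. -/
def Expr.eval (w : ℕ) (s : State) : Expr → ℕ
  | .const c => c % 2 ^ w
  | .reg x => s.reg x
  | .load a i => s.arr a (i.eval w s)
  | .op o e₁ e₂ => o.apply w (e₁.eval w s) (e₂.eval w s)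

/-- The time to evaluate an expression: one step for each constant, register access, array read
and operation in it. -/
def Expr.cost : Expr → ℕ
  | .const _ => 1
  | .reg _ => 1
  | .load _ i => i.cost + 1
  | .op _ e₁ e₂ => e₁.cost + e₂.cost + 1

/-- `Run w p s t s'`: on the machine with `w`-bit words, the program `p`, started in state `s`,
halts after exactly `t` steps in state `s'`. -/
inductive Run (w : ℕ) : Prog → State → ℕ → State → Prop where
  | skip (s : State) : Run w .skip s 1 s
  | assign (x : ℕ) (e : Expr) (s : State) :
      Run w (.assign x e) s (e.cost + 1) (s.setReg x (e.eval w s))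
  | store (a : ℕ) (i e : Expr) (s : State) :
      Run w (.store a i e) s (i.cost + e.cost + 1) (s.setArr a (i.eval w s) (e.eval w s))
  | seq {p q : Prog} {s₁ s₂ s₃ : State} {t₁ t₂ : ℕ} :
      Run w p s₁ t₁ s₂ → Run w q s₂ t₂ s₃ → Run w (.seq p q) s₁ (t₁ + t₂) s₃
  | branch_true {b : Expr} {p q : Prog} {s s' : State} {t : ℕ} :
      b.eval w s ≠ 0 → Run w p s t s' → Run w (.branch b p q) s (b.cost + 1 + t) s'
  | branch_false {b : Expr} {p q : Prog} {s s' : State} {t : ℕ} :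
      b.eval w s = 0 → Run w q s t s' → Run w (.branch b p q) s (b.cost + 1 + t) s'
  | loop_false {b : Expr} {p : Prog} {s : State} :
      b.eval w s = 0 → Run w (.loop b p) s (b.cost + 1) s
  | loop_true {b : Expr} {p : Prog} {s₁ s₂ s₃ : State} {t₁ t₂ : ℕ} :
      b.eval w s₁ ≠ 0 → Run w p s₁ t₁ s₂ → Run w (.loop b p) s₂ t₂ s₃ →
      Run w (.loop b p) s₁ (b.cost + 1 + t₁ + t₂) s₃

end WordRAM

/-! ### Graphs as inputs -/

namespace OnePage

/-- `es` lists every edge of `G` exactly once (in any order, with its endpoints in either order). -/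
def IsEdgeList {n : ℕ} (G : SimpleGraph (Fin n)) (es : List (Fin n × Fin n)) : Prop :=
  (es.map fun e => s(e.1, e.2)).Nodup ∧
    ∀ u v : Fin n, s(u, v) ∈ es.map (fun e => s(e.1, e.2)) ↔ G.Adj u v

/-- The initial memory for a graph with vertices `0, …, n - 1` given by an edge list: register `0`
holds the number of vertices, register `1` the number of edges, and the `i`-th cells of the arrays
`0` and `1` hold the two endpoints of the `i`-th edge. Everything else is `0`. -/
def inputState (n : ℕ) (es : List (Fin n × Fin n)) : WordRAM.State where
  reg x := if x = 0 then n else if x = 1 then es.length else 0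
  arr a i :=
    if a = 0 then (es[i]?.map fun e => (e.1 : ℕ)).getD 0
    else if a = 1 then (es[i]?.map fun e => (e.2 : ℕ)).getD 0
    else 0

/-- Given any edge list of `G`, the program `P` halts within `T` steps with `r` in register `0`, on
every machine whose word length `w` is at least `c * log₂ (n + m + 2)`, where `n` and `m` are the
numbers of vertices and edges of `G`. -/
def ComputesWithin (P : WordRAM.Prog) (c : ℕ) {n : ℕ} (G : SimpleGraph (Fin n)) (r T : ℕ) : Prop :=
  ∀ es : List (Fin n × Fin n), IsEdgeList G es →
    ∀ w : ℕ, (n + es.length + 2) ^ c ≤ 2 ^ w →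
      ∃ t ≤ T, ∃ s : WordRAM.State, WordRAM.Run w P (inputState n es) t s ∧ s.reg 0 = r

/-! ### One-page drawings -/

/-- Place the vertices on a line in the order given by `σ` and draw the edges as arcs on one side
of the line. `CrossesFrom σ e f` says that the arcs of `e` and `f` cross and `e` starts to the
left of `f`: the endpoints appear in the order `a, c, b, d` with `e = ab`, `f = cd`. -/
def CrossesFrom {n : ℕ} (σ : Fin n ≃ Fin n) (e f : Sym2 (Fin n)) : Prop :=
  ∃ a b c d : Fin n, e = s(a, b) ∧ f = s(c, d) ∧ σ a < σ c ∧ σ c < σ b ∧ σ b < σ d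

/-- The number of crossings of the drawing given by `σ`. Each crossing pair of edges is counted
once, with the edge that starts further left in the first place. -/
noncomputable def crossings {n : ℕ} (G : SimpleGraph (Fin n)) (σ : Fin n ≃ Fin n) : ℕ :=
  {x : Sym2 (Fin n) × Sym2 (Fin n) |
    x.1 ∈ G.edgeSet ∧ x.2 ∈ G.edgeSet ∧ CrossesFrom σ x.1 x.2}.ncard

/-- The number of edges that take part in at least one crossing of the drawing given by `σ`. -/
noncomputable def crossedEdges {n : ℕ} (G : SimpleGraph (Fin n)) (σ : Fin n ≃ Fin n) : ℕ :=
  {e : Sym2 (Fin n) |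
    e ∈ G.edgeSet ∧ ∃ f ∈ G.edgeSet, CrossesFrom σ e f ∨ CrossesFrom σ f e}.ncard

/-- The 1-page crossing number. -/
noncomputable def pageCrossingNumber {n : ℕ} (G : SimpleGraph (Fin n)) : ℕ :=
  ⨅ σ : Fin n ≃ Fin n, crossings G σ

/-- The minimum number of crossed edges in a 1-page drawing. -/
noncomputable def pageCrossedNumber {n : ℕ} (G : SimpleGraph (Fin n)) : ℕ :=
  ⨅ σ : Fin n ≃ Fin n, crossedEdges G σ

/-! ### Cyclomatic number and almost-trees -/

/-- `F` is a maximal spanning forest of `G`. -/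
def IsMaximalForest {V : Type*} (G F : SimpleGraph V) : Prop :=
  Maximal (fun H : SimpleGraph V => H ≤ G ∧ H.IsAcyclic) F

/-- The cyclomatic number of a finite graph: the difference between its number of edges and that of
a maximal spanning forest. (All maximal spanning forests have the same number of edges.) -/
noncomputable def cyclomaticNumber {V : Type*} (G : SimpleGraph V) : ℕ :=
  sInf {k | ∃ F : SimpleGraph V, IsMaximalForest G F ∧ G.edgeSet.ncard = F.edgeSet.ncard + k}

/-- A subgraph that is connected and stays connected when any one vertex is deleted. (Single
vertices and single edges are included.) -/
def IsBiconnected {V : Type*} {G : SimpleGraph V} (H : G.Subgraph) : Prop :=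
  H.Connected ∧ ∀ v ∈ H.verts, (H.deleteVerts {v}).Preconnected

/-- A biconnected component is a maximal biconnected subgraph. -/
def IsBiconnectedComponent {V : Type*} {G : SimpleGraph V} (H : G.Subgraph) : Prop :=
  Maximal (fun K : G.Subgraph => IsBiconnected K) H

/-- A `k`-almost-tree: every biconnected component has cyclomatic number at most `k`. -/
def IsAlmostTree {V : Type*} (k : ℕ) (G : SimpleGraph V) : Prop :=
  ∀ H : G.Subgraph, IsBiconnectedComponent H → cyclomaticNumber H.coe ≤ k

end OnePage

/-! ### A program logic with running times for the word RAM -/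

namespace WordRAM

-- Both quantities are sums over blocks. Two graphs with at most one common vertex `v` can be drawn
-- without crossings between them: rotate the line of the second drawing until `v` comes first,
-- which preserves alternation, and insert it directly after `v` in the first drawing (`opt_union`).
-- It is therefore enough to solve each biconnected component by brute force, once it has been made
-- small.
--
-- Blocks are made small by contracting edges between two vertices of degree at most two, which
-- changes neither optimum (`opt_redirect`). If such an edge `zu` is contracted, new crossings of
-- the other edge at `z` are charged to `zu`, which has become an uncrossed loop. Conversely, `z`
-- can be put back immediately beside `u`, on the side from which its other edge does not cross the
-- other edge at `u`.
--
-- A depth-first search gives a forest in which every edge joins an ancestor to a descendant, and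
-- low points give the blocks. In a block with `K ≥ 1` edges outside the forest, the handshake lemma
-- leaves at most `2 * K - 2` vertices of degree at least three besides the root of the block.
-- Contraction of forest edges leaves only these, their children, the top vertex and the root, so
-- there are at most `5 * K - 3` vertices and `6 * K` edges (`BlockForest.size`). Trying all orders
-- with a quadratic evaluation of each costs `(5 * K - 3)! * O(K ^ 2) = O((5 * K)!)`. A block with
-- `K = 0` is a single edge.
--
-- Deleting the edges outside the forest disconnects nothing, so their number is at most the
-- cyclomatic number. This is applied to the whole graph (`BlockForest.sum_back_le`) and to a
-- biconnected component that contains a given block (`BlockForest.card_back_le`). The first time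
-- bound then follows from superadditivity, `∑ (5 * K i)! ≤ (5 * ∑ K i)!` over the positive `K i`;
-- the second is a sum of `n` bounded terms.
--
-- The algorithm is an explicit program. Its correctness is proved with unbounded numbers and
-- carries over to `w`-bit words, since all intermediate results stay below `2 ^ w` when `(n + m +
-- 2) ^ 4 ≤ 2 ^ w`.

infixl:65 " +ₑ " => Expr.op Op.add
infixl:65 " -ₑ " => Expr.op Op.sub
infixl:70 " *ₑ " => Expr.op Op.mul
infix:50 " <ₑ " => Expr.op Op.lt
infix:50 " =ₑ " => Expr.op Op.eq
infix:45 " ≔ " => Prog.assign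
infixr:40 " ;; " => Prog.seq

/-- The value of an expression on a machine with unbounded words. -/
def Expr.val (s : State) : Expr → ℕ
  | .const c => c
  | .reg x => s.reg x
  | .load a i => s.arr a (i.val s)
  | .op .add e₁ e₂ => e₁.val s + e₂.val s
  | .op .sub e₁ e₂ => e₁.val s - e₂.val s
  | .op .mul e₁ e₂ => e₁.val s * e₂.val s
  | .op .lt e₁ e₂ => if e₁.val s < e₂.val s then 1 else 0
  | .op .eq e₁ e₂ => if e₁.val s = e₂.val s then 1 else 0

/-- No intermediate result in the evaluation of the expression reaches `B`. -/
def Expr.ok (B : ℕ) (s : State) : Expr → Prop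
  | .const c => c < B
  | .reg _ => True
  | .load _ i => i.ok B s
  | .op .add e₁ e₂ => e₁.ok B s ∧ e₂.ok B s ∧ e₁.val s + e₂.val s < B
  | .op .sub e₁ e₂ => e₁.ok B s ∧ e₂.ok B s
  | .op .mul e₁ e₂ => e₁.ok B s ∧ e₂.ok B s ∧ e₁.val s * e₂.val s < B
  | .op .lt e₁ e₂ => e₁.ok B s ∧ e₂.ok B s
  | .op .eq e₁ e₂ => e₁.ok B s ∧ e₂.ok B s

/-- Below `B` no reduction modulo `2 ^ w` takes effect, and subtraction is truncated in both
semantics; `1 < B` is what the results of comparisons need. -/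
theorem Expr.eval_eq_val {w B : ℕ} (hB : B ≤ 2 ^ w) (h1 : 1 < B) {s : State} (e : Expr)
    (h : e.ok B s) : e.eval w s = e.val s := by
  induction e with
  | const c => exact Nat.mod_eq_of_lt (lt_of_lt_of_le h hB)
  | reg x => rfl
  | load a i ih => simp only [Expr.eval, Expr.val, ih h]
  | op o a b iha ihb =>
    have h1' : 1 % 2 ^ w = 1 := Nat.mod_eq_of_lt (lt_of_lt_of_le h1 hB)
    cases o <;> simp only [Expr.ok] at h
    · simp only [Expr.eval, Op.apply, Expr.val, iha h.1, ihb h.2.1]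
      exact Nat.mod_eq_of_lt (lt_of_lt_of_le h.2.2 hB)
    · simp only [Expr.eval, Op.apply, Expr.val, iha h.1, ihb h.2]
    · simp only [Expr.eval, Op.apply, Expr.val, iha h.1, ihb h.2.1]
      exact Nat.mod_eq_of_lt (lt_of_lt_of_le h.2.2 hB)
    · simp only [Expr.eval, Op.apply, Expr.val, iha h.1, ihb h.2]
      split_ifs <;> simp [h1']
    · simp only [Expr.eval, Op.apply, Expr.val, iha h.1, ihb h.2]
      split_ifs <;> simp [h1']

theorem State.setReg_reg (s : State) (x v y : ℕ) :
    (s.setReg x v).reg y = if y = x then v else s.reg y := by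
  simp [State.setReg, Function.update_apply]

theorem State.setReg_arr (s : State) (x v : ℕ) : (s.setReg x v).arr = s.arr := rfl

theorem State.setArr_reg (s : State) (a i v : ℕ) : (s.setArr a i v).reg = s.reg := rfl

theorem State.setArr_arr (s : State) (a i v b : ℕ) :
    (s.setArr a i v).arr b = if b = a then Function.update (s.arr a) i v else s.arr b := by
  simp [State.setArr, Function.update_apply]

/-- The registers that a program assigns. -/
def Prog.regs : Prog → List ℕ
  | .skip => []
  | .assign x _ => [x]
  | .store _ _ _ => []
  | .seq p q => p.regs ++ q.regs
  | .branch _ p q => p.regs ++ q.regs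
  | .loop _ p => p.regs

/-- The arrays that a program writes to. -/
def Prog.arrs : Prog → List ℕ
  | .skip => []
  | .assign _ _ => []
  | .store a _ _ => [a]
  | .seq p q => p.arrs ++ q.arrs
  | .branch _ p q => p.arrs ++ q.arrs
  | .loop _ p => p.arrs

/-- The two states agree on everything that `p` does not write to. -/
def Frame (p : Prog) (s s' : State) : Prop :=
  (∀ x, x ∉ p.regs → s'.reg x = s.reg x) ∧ ∀ a, a ∉ p.arrs → s'.arr a = s.arr a

theorem Frame.refl (p : Prog) (s : State) : Frame p s s := ⟨fun _ _ => rfl, fun _ _ => rfl⟩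

theorem Frame.trans {p : Prog} {s₁ s₂ s₃ : State} (h : Frame p s₁ s₂) (h' : Frame p s₂ s₃) :
    Frame p s₁ s₃ :=
  ⟨fun x hx => (h'.1 x hx).trans (h.1 x hx), fun x hx => (h'.2 x hx).trans (h.2 x hx)⟩

/-- For concrete programs membership in the two lists is decidable. A loop invariant therefore only
has to mention what the loop changes; the rest is recovered from the frame. -/
theorem Run.frame {w : ℕ} {p : Prog} {s s' : State} {t : ℕ} (h : Run w p s t s') :
    Frame p s s' := by
  induction h with
  | skip s => exact Frame.refl _ _
  | assign x e s =>
    refine ⟨fun y hy => ?_, fun _ _ => rfl⟩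
    simp only [Prog.regs, List.mem_singleton] at hy
    simp [State.setReg_reg, hy]
  | store a i e s =>
    refine ⟨fun _ _ => rfl, fun b hb => ?_⟩
    simp only [Prog.arrs, List.mem_singleton] at hb
    simp [State.setArr_arr, hb]
  | seq _ _ ih₁ ih₂ =>
    simp only [Frame, Prog.regs, Prog.arrs, List.mem_append, not_or] at *
    exact ⟨fun x hx => (ih₂.1 x hx.2).trans (ih₁.1 x hx.1),
      fun x hx => (ih₂.2 x hx.2).trans (ih₁.2 x hx.1)⟩
  | branch_true _ _ ih =>
    simp only [Frame, Prog.regs, Prog.arrs, List.mem_append, not_or] at *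
    exact ⟨fun x hx => ih.1 x hx.1, fun x hx => ih.2 x hx.1⟩
  | branch_false _ _ ih =>
    simp only [Frame, Prog.regs, Prog.arrs, List.mem_append, not_or] at *
    exact ⟨fun x hx => ih.1 x hx.2, fun x hx => ih.2 x hx.2⟩
  | loop_false _ => exact Frame.refl _ _
  | loop_true _ _ _ ih₁ ih₂ => exact Frame.trans (p := Prog.loop _ _) ih₁ ih₂

/-- `p`, started in `s`, halts with a running time and a final state that satisfy `Q`. -/
def Ends (w : ℕ) (p : Prog) (s : State) (Q : ℕ → State → Prop) : Prop :=
  ∃ t s', Run w p s t s' ∧ Q t s'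

theorem Ends.mono {w : ℕ} {p : Prog} {s : State} {Q Q' : ℕ → State → Prop}
    (h : Ends w p s Q) (hQ : ∀ t s', Frame p s s' → Q t s' → Q' t s') : Ends w p s Q' := by
  obtain ⟨t, s', hr, hq⟩ := h
  exact ⟨t, s', hr, hQ t s' hr.frame hq⟩

theorem Ends.seq {w : ℕ} {p q : Prog} {s : State} {Q Q' : ℕ → State → Prop}
    (h : Ends w p s Q')
    (hq : ∀ t s', Frame p s s' → Q' t s' → Ends w q s' (fun t' => Q (t + t'))) :
    Ends w (p ;; q) s Q := by
  obtain ⟨t, s', hr, h'⟩ := h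
  obtain ⟨t', s'', hr', h''⟩ := hq t s' hr.frame h'
  exact ⟨_, _, Run.seq hr hr', h''⟩

/-- A weakest precondition for programs whose loops are treated as black boxes. -/
def wp (w B : ℕ) : Prog → (ℕ → State → Prop) → State → Prop
  | .skip, Q, s => Q 1 s
  | .assign x e, Q, s => e.ok B s ∧ Q (e.cost + 1) (s.setReg x (e.val s))
  | .store a i e, Q, s =>
    i.ok B s ∧ e.ok B s ∧ Q (i.cost + e.cost + 1) (s.setArr a (i.val s) (e.val s))
  | .seq p q, Q, s => wp w B p (fun t s' => wp w B q (fun t' => Q (t + t')) s') s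
  | .branch b p q, Q, s => b.ok B s ∧
      (b.val s ≠ 0 → wp w B p (fun t => Q (b.cost + 1 + t)) s) ∧
      (b.val s = 0 → wp w B q (fun t => Q (b.cost + 1 + t)) s)
  | .loop b p, Q, s => Ends w (.loop b p) s Q

/-- Straight-line code is handled by simplifying `wp`, while each loop leaves an `Ends` obligation
for the loop rules below. -/
theorem Ends.of_wp {w B : ℕ} (hB : B ≤ 2 ^ w) (h1 : 1 < B) {p : Prog} {s : State}
    {Q : ℕ → State → Prop} (h : wp w B p Q s) : Ends w p s Q := by
  induction p generalizing s Q with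
  | skip => exact ⟨_, _, Run.skip s, h⟩
  | assign x e =>
    refine ⟨_, _, Run.assign x e s, ?_⟩
    rw [e.eval_eq_val hB h1 h.1]; exact h.2
  | store a i e =>
    refine ⟨_, _, Run.store a i e s, ?_⟩
    rw [e.eval_eq_val hB h1 h.2.1, i.eval_eq_val hB h1 h.1]; exact h.2.2
  | seq p q ihp ihq => exact Ends.seq (ihp h) fun t s' _ h' => ihq h'
  | branch b p q ihp ihq =>
    obtain ⟨hb, h₁, h₂⟩ := h
    rw [← b.eval_eq_val hB h1 hb] at h₁ h₂
    by_cases hc : b.eval w s = 0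
    · obtain ⟨t, s', hr, hq⟩ := ihq (h₂ hc)
      exact ⟨_, _, Run.branch_false hc hr, hq⟩
    · obtain ⟨t, s', hr, hq⟩ := ihp (h₁ hc)
      exact ⟨_, _, Run.branch_true hc hr, hq⟩
  | loop b p _ => exact h

/-- Loops that make one pass for each index in an interval. -/
theorem Ends.for_of_ends {w B : ℕ} (hB : B ≤ 2 ^ w) (h1 : 1 < B) {b : Expr} {p : Prog} {s₀ : State}
    (Inv : ℕ → State → Prop) (T : ℕ → ℕ) {i N : ℕ} (hi : i ≤ N) (h0 : Inv i s₀)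
    (step : ∀ j s, i ≤ j → j < N → Frame p s₀ s → Inv j s → b.ok B s ∧ b.val s ≠ 0 ∧
      Ends w p s (fun t s' => t ≤ T j ∧ Inv (j + 1) s'))
    (hexit : ∀ s, Frame p s₀ s → Inv N s → b.ok B s ∧ b.val s = 0) :
    Ends w (.loop b p) s₀ (fun t s' =>
      t ≤ ∑ j ∈ Finset.Ico i N, (T j + (b.cost + 1)) + (b.cost + 1) ∧ Inv N s') := by
  suffices H : ∀ k j s, j + k = N → i ≤ j → Frame p s₀ s → Inv j s →
      Ends w (.loop b p) s (fun t s' =>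
        t ≤ ∑ j ∈ Finset.Ico j N, (T j + (b.cost + 1)) + (b.cost + 1) ∧ Inv N s') from
    H (N - i) i s₀ (by omega) le_rfl (Frame.refl _ _) h0
  intro k
  induction k with
  | zero =>
    intro j s hj _ hf hI
    obtain rfl : j = N := by omega
    obtain ⟨hok, hv⟩ := hexit s hf hI
    exact ⟨_, _, Run.loop_false (by rw [b.eval_eq_val hB h1 hok]; exact hv), by simp, hI⟩
  | succ k ih =>
    intro j s hj hij hf hI
    obtain ⟨hok, hv, hw⟩ := step j s hij (by omega) hf hI
    obtain ⟨t, s', hr, ht, hI'⟩ := hw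
    obtain ⟨t', s'', hr', ht', hI''⟩ :=
      ih (j + 1) s' (by omega) (by omega) (hf.trans hr.frame) hI'
    refine ⟨_, _, Run.loop_true (by rw [b.eval_eq_val hB h1 hok]; exact hv) hr hr', ?_, hI''⟩
    rw [Finset.sum_eq_sum_Ico_succ_bot (by omega)]
    omega

theorem Ends.for {w B : ℕ} (hB : B ≤ 2 ^ w) (h1 : 1 < B) {b : Expr} {p : Prog} {s₀ : State}
    (Inv : ℕ → State → Prop) (T : ℕ → ℕ) {i N : ℕ} (hi : i ≤ N) (h0 : Inv i s₀)
    (step : ∀ j s, i ≤ j → j < N → Frame p s₀ s → Inv j s → b.ok B s ∧ b.val s ≠ 0 ∧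
      wp w B p (fun t s' => t ≤ T j ∧ Inv (j + 1) s') s)
    (hexit : ∀ s, Frame p s₀ s → Inv N s → b.ok B s ∧ b.val s = 0) :
    Ends w (.loop b p) s₀ (fun t s' =>
      t ≤ ∑ j ∈ Finset.Ico i N, (T j + (b.cost + 1)) + (b.cost + 1) ∧ Inv N s') := by
  refine Ends.for_of_ends hB h1 Inv T hi h0 (fun j s hj hj' hf hI => ?_) hexit
  obtain ⟨h2, h3, h4⟩ := step j s hj hj' hf hI
  exact ⟨h2, h3, Ends.of_wp hB h1 h4⟩

theorem Ends.for_const {w B : ℕ} (hB : B ≤ 2 ^ w) (h1 : 1 < B) {b : Expr} {p : Prog} {s₀ : State}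
    (Inv : ℕ → State → Prop) (T : ℕ) {i N : ℕ} (hi : i ≤ N) (h0 : Inv i s₀)
    (step : ∀ j s, i ≤ j → j < N → Frame p s₀ s → Inv j s → b.ok B s ∧ b.val s ≠ 0 ∧
      wp w B p (fun t s' => t ≤ T ∧ Inv (j + 1) s') s)
    (hexit : ∀ s, Frame p s₀ s → Inv N s → b.ok B s ∧ b.val s = 0) :
    Ends w (.loop b p) s₀ (fun t s' =>
      t ≤ (N - i) * (T + (b.cost + 1)) + (b.cost + 1) ∧ Inv N s') := by
  simpa using Ends.for hB h1 Inv (fun _ => T) hi h0 step hexit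

/-- Loops with a decreasing measure. -/
theorem Ends.while {w B : ℕ} (hB : B ≤ 2 ^ w) (h1 : 1 < B) {b : Expr} {p : Prog} {s₀ : State}
    (Inv : ℕ → State → Prop) (Q : State → Prop) (T : ℕ) {μ₀ : ℕ} (h0 : Inv μ₀ s₀)
    (step : ∀ μ s, Frame p s₀ s → Inv μ s → b.ok B s ∧
      (b.val s ≠ 0 → wp w B p (fun t s' => t ≤ T ∧ ∃ μ' < μ, Inv μ' s') s) ∧
      (b.val s = 0 → Q s)) :
    Ends w (.loop b p) s₀ (fun t s' => t ≤ μ₀ * (T + (b.cost + 1)) + (b.cost + 1) ∧ Q s') := by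
  suffices H : ∀ μ s, Frame p s₀ s → Inv μ s →
      Ends w (.loop b p) s (fun t s' =>
        t ≤ μ * (T + (b.cost + 1)) + (b.cost + 1) ∧ Q s') from H μ₀ s₀ (Frame.refl _ _) h0
  intro μ
  induction μ using Nat.strong_induction_on with
  | _ μ ih =>
    intro s hf hI
    obtain ⟨hok, hv, hq⟩ := step μ s hf hI
    by_cases hc : b.val s = 0
    · exact ⟨_, _, Run.loop_false (by rw [b.eval_eq_val hB h1 hok]; exact hc), by simp, hq hc⟩
    · obtain ⟨t, s', hr, ht, μ', hμ, hI'⟩ := Ends.of_wp hB h1 (hv hc)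
      obtain ⟨t', s'', hr', ht', hQ⟩ := ih μ' hμ s' (hf.trans hr.frame) hI'
      refine ⟨_, _, Run.loop_true (by rw [b.eval_eq_val hB h1 hok]; exact hc) hr hr', ?_, hQ⟩
      have : (μ' + 1) * (T + (b.cost + 1)) ≤ μ * (T + (b.cost + 1)) :=
        Nat.mul_le_mul_right _ hμ
      rw [add_mul] at this
      omega

attribute [irreducible] Ends

end WordRAM

/-! ### Adjacency rows and depth-first search -/

namespace OnePage

open Finset

/-- The rows of the table `adj`, of width `W`, list the pairs in `R`; they have `k` entries. -/
structure IsTable (n W : ℕ) (R : ℕ → ℕ → Prop) (ptr adj : ℕ → ℕ) (k : ℕ) : Prop where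
  total : ∑ v ∈ range (n + 1), ptr v = k
  mem_iff : ∀ v ≤ n, ∀ u, R v u ↔ ∃ q < ptr v, adj (v * W + q) = u

theorem IsTable.congr {n W : ℕ} {R R' : ℕ → ℕ → Prop} {ptr adj : ℕ → ℕ} {k : ℕ}
    (h : IsTable n W R ptr adj k) (hR : ∀ v ≤ n, ∀ u, R v u ↔ R' v u) :
    IsTable n W R' ptr adj k :=
  ⟨h.total, fun v hv u => by rw [← hR v hv u]; exact h.mem_iff v hv u⟩

theorem IsTable.ptr_le {n W : ℕ} {R : ℕ → ℕ → Prop} {ptr adj : ℕ → ℕ} {k : ℕ}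
    (h : IsTable n W R ptr adj k) {v : ℕ} (hv : v ≤ n) : ptr v ≤ k := by
  rw [← h.total]
  exact single_le_sum (f := ptr) (fun _ _ => Nat.zero_le _) (mem_range.2 (by omega))

theorem row_inj {W v v' q q' : ℕ} (hq : q < W) (hq' : q' < W) (h : v * W + q = v' * W + q') :
    v = v' ∧ q = q' := by
  have h1 : (v * W + q) / W = v := by
    rw [Nat.add_comm, Nat.add_mul_div_right _ _ (by omega), Nat.div_eq_of_lt hq, zero_add]
  have h2 : (v' * W + q') / W = v' := by
    rw [Nat.add_comm, Nat.add_mul_div_right _ _ (by omega), Nat.div_eq_of_lt hq', zero_add]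
  have : v = v' := by rw [← h1, ← h2, h]
  subst this
  exact ⟨rfl, by omega⟩

theorem sum_range_update {N x y : ℕ} (f : ℕ → ℕ) (hx : x < N) :
    ∑ v ∈ range N, Function.update f x y v + f x = ∑ v ∈ range N, f v + y := by
  have hx' : x ∈ range N := mem_range.2 hx
  rw [sum_update_of_mem hx', ← add_sum_erase _ _ hx', sdiff_singleton_eq_erase]
  ring

/-- A row cannot run into the next one, because its length is at most the total number `k < W` of
entries. -/
theorem IsTable.insert {n W : ℕ} {R : ℕ → ℕ → Prop} {ptr adj : ℕ → ℕ} {k x y : ℕ}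
    (h : IsTable n W R ptr adj k) (hk : k < W) (hx : x ≤ n) :
    IsTable n W (fun v u => R v u ∨ (v = x ∧ u = y)) (Function.update ptr x (ptr x + 1))
      (Function.update adj (x * W + ptr x) y) (k + 1) := by
  constructor
  · have := sum_range_update (y := ptr x + 1) ptr (show x < n + 1 by omega)
    have := h.total
    omega
  · intro v hv u
    have hpx := h.ptr_le hx
    have hpv := h.ptr_le hv
    rw [h.mem_iff v hv u]
    constructor
    · rintro (⟨q, hq, rfl⟩ | ⟨rfl, rfl⟩)
      · refine ⟨q, ?_, ?_⟩
        · rw [Function.update_apply]; split_ifs with hvx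
          · subst hvx; omega
          · exact hq
        · rw [Function.update_of_ne]
          intro he
          obtain ⟨rfl, rfl⟩ := row_inj (by omega) (by omega) he
          omega
      · exact ⟨ptr v, by simp, by simp⟩
    · rintro ⟨q, hq, rfl⟩
      rw [Function.update_apply] at hq
      by_cases he : v * W + q = x * W + ptr x
      · have : q < W := by
          split_ifs at hq <;> omega
        obtain ⟨rfl, rfl⟩ := row_inj this (by omega) he
        simp
      · rw [Function.update_of_ne he]
        left
        refine ⟨q, ?_, rfl⟩
        split_ifs at hq with hvx
        · subst hvx
          have : q ≠ ptr v := fun h => he (by rw [h])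
          omega
        · exact hq

/-- The invariant of depth-first search from the vertex `0`; preorder number `i` is given to the
vertex `org i`, and its parent has the number `P i`. -/
structure DfsInv (n W : ℕ) (R : ℕ → ℕ → Prop) (ptr adj num org P : ℕ → ℕ) (cur cnt μ : ℕ) :
    Prop where
  cur_le : cur ≤ cnt
  org_zero : org 0 = 0
  org_spec : ∀ i, 1 ≤ i → i ≤ cnt → 1 ≤ org i ∧ org i ≤ n ∧ num (org i) = i
  num_spec : ∀ v, 1 ≤ v → v ≤ n → num v ≠ 0 → num v ≤ cnt ∧ org (num v) = v
  parent_zero : P 0 = 0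
  parent_lt : ∀ i, 1 ≤ i → i ≤ cnt → P i < i
  parent_rel : ∀ i, 1 ≤ i → i ≤ cnt → R (org (P i)) (org i)
  -- Rows are consumed from the end, and what has been cut off is already numbered.
  rows : ∀ v ≤ n, ∀ u, R v u → num u ≠ 0 ∨ ∃ q < ptr v, adj (v * W + q) = u
  valid : ∀ v ≤ n, ∀ q < ptr v, R v (adj (v * W + q))
  -- No stack is stored: it is the chain of iterated parents of `cur`.
  finished : ∀ i ≤ cnt, (∀ k, P^[k] cur ≠ i) → ∀ u, R (org i) u → num u ≠ 0
  comparable : ∀ i j, 1 ≤ i → i < j → j ≤ cnt → R (org i) (org j) → ∃ k, P^[k] j = i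
  -- Reading an entry gains `2`, which outweighs the loss of `1` when the depth grows; backtracking
  -- lowers the depth.
  measure : ∃ d, μ = 2 * (∑ v ∈ range (n + 1), ptr v) + d ∧ P^[d] cur = 0

namespace DfsInv

variable {n W : ℕ} {R : ℕ → ℕ → Prop} {ptr adj num org P : ℕ → ℕ} {cur cnt μ : ℕ}

theorem cnt_le (h : DfsInv n W R ptr adj num org P cur cnt μ) : cnt ≤ n := by
  have : (Icc 1 cnt).card ≤ (Icc 1 n).card := by
    apply card_le_card_of_injOn org
    · intro i hi
      simp only [coe_Icc, Set.mem_Icc] at hi ⊢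
      have := h.org_spec i hi.1 hi.2
      omega
    · intro i hi j hj hij
      simp only [coe_Icc, Set.mem_Icc] at hi hj
      rw [← (h.org_spec i hi.1 hi.2).2.2, hij, (h.org_spec j hj.1 hj.2).2.2]
  simpa using this

theorem org_le (h : DfsInv n W R ptr adj num org P cur cnt μ) {i : ℕ} (hi : i ≤ cnt) :
    org i ≤ n := by
  rcases Nat.eq_zero_or_pos i with rfl | h0
  · rw [h.org_zero]; omega
  · exact (h.org_spec i h0 hi).2.1

/-- With an exhausted row, `rows` says that all neighbours are numbered, which is what `finished`
demands of a vertex that leaves the stack. -/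
theorem pop (h : DfsInv n W R ptr adj num org P cur cnt μ) (h0 : ptr (org cur) = 0)
    (hc : cur ≠ 0) : ∃ μ' < μ, DfsInv n W R ptr adj num org P (P cur) cnt μ' := by
  obtain ⟨d, hd, hd'⟩ := h.measure
  cases d with
  | zero => exact absurd hd' hc
  | succ d =>
    refine ⟨μ - 1, by omega, { h with cur_le := ?_, finished := ?_, measure := ⟨d, by omega, hd'⟩ }⟩
    · have := h.parent_lt cur (by omega) h.cur_le
      have := h.cur_le
      omega
    · intro i hi hk u hu
      by_cases hic : i = cur
      · subst hic
        rcases h.rows _ (h.org_le hi) u hu with h' | ⟨q, hq, _⟩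
        · exact h'
        · omega
      · refine h.finished i hi (fun k => ?_) u hu
        cases k with
        | zero => exact fun h' => hic h'.symm
        | succ k => exact hk k

theorem skip (h : DfsInv n W R ptr adj num org P cur cnt μ) (h0 : ptr (org cur) ≠ 0)
    (hu : num (adj (org cur * W + (ptr (org cur) - 1))) ≠ 0) :
    ∃ μ' < μ, DfsInv n W R (Function.update ptr (org cur) (ptr (org cur) - 1)) adj num org P
      cur cnt μ' := by
  obtain ⟨d, hd, hd'⟩ := h.measure
  have hs := sum_range_update (y := ptr (org cur) - 1) ptr
    (show org cur < n + 1 by have := h.org_le h.cur_le; omega)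
  refine ⟨μ - 2, by omega, { h with rows := ?_, valid := ?_, measure := ⟨d, ?_, hd'⟩ }⟩
  · intro v hv u huv
    rcases h.rows v hv u huv with h' | ⟨q, hq, rfl⟩
    · exact Or.inl h'
    · rw [Function.update_apply]
      split_ifs with hvc
      · subst hvc
        rcases Nat.lt_or_ge q (ptr (org cur) - 1) with hlt | hge
        · exact Or.inr ⟨q, hlt, rfl⟩
        · left
          have : q = ptr (org cur) - 1 := by omega
          rw [this]; exact hu
      · exact Or.inr ⟨q, hq, rfl⟩
  · intro v hv q hq
    apply h.valid v hv q
    rw [Function.update_apply] at hq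
    split_ifs at hq with hvc
    · subst hvc; omega
    · exact hq
  · omega

/-- Chains of parents that start at most at `c` stay there, so giving a parent to a new number does
not disturb the old chains. -/
theorem iterate_update {f : ℕ → ℕ} {c x y : ℕ} (hf0 : f 0 = 0)
    (hf : ∀ i, 1 ≤ i → i ≤ c → f i < i) (hx : c < x) {i : ℕ} (hi : i ≤ c) (k : ℕ) :
    (Function.update f x y)^[k] i = f^[k] i ∧ f^[k] i ≤ c := by
  induction k generalizing i with
  | zero => exact ⟨rfl, hi⟩
  | succ k ih =>
    have hfi : f i ≤ c := by
      rcases Nat.eq_zero_or_pos i with rfl | h0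
      · omega
      · have := hf i h0 hi; omega
    simp only [Function.iterate_succ, Function.comp_apply]
    rw [Function.update_of_ne (by omega)]
    exact ih hfi

/-- There are no cross edges because of `finished`: an earlier vertex adjacent to the still
unnumbered `u` must be on the stack, and hence becomes an ancestor of `u`. -/
theorem push (h : DfsInv n W R ptr adj num org P cur cnt μ)
    (hR : ∀ v u, R v u → 1 ≤ u ∧ u ≤ n)
    (h0 : ptr (org cur) ≠ 0) {u : ℕ} (hu' : u = adj (org cur * W + (ptr (org cur) - 1)))
    (hu : num u = 0) :
    ∃ μ' < μ, DfsInv n W R (Function.update ptr (org cur) (ptr (org cur) - 1)) adj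
      (Function.update num u (cnt + 1)) (Function.update org (cnt + 1) u)
      (Function.update P (cnt + 1) cur) (cnt + 1) (cnt + 1) μ' := by
  obtain ⟨d, hd, hd'⟩ := h.measure
  have hoc := h.org_le h.cur_le
  have hcur := h.cur_le
  have hs := sum_range_update (y := ptr (org cur) - 1) ptr (show org cur < n + 1 by omega)
  have hRu : R (org cur) u := by
    rw [hu']; exact h.valid _ hoc _ (by omega)
  have hur := hR _ _ hRu
  have hne : ∀ i, i ≤ cnt → org i ≠ u := by
    rintro i hi rfl
    rcases Nat.eq_zero_or_pos i with rfl | hi0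
    · rw [h.org_zero] at hur; omega
    · have := (h.org_spec i hi0 hi).2.2
      omega
  have horg : ∀ i, i ≤ cnt → Function.update org (cnt + 1) u i = org i := fun i hi =>
    Function.update_of_ne (by omega) _ _
  have hP : ∀ i, i ≤ cnt → Function.update P (cnt + 1) cur i = P i := fun i hi =>
    Function.update_of_ne (by omega) _ _
  have hnum : ∀ v, num v ≠ 0 → Function.update num u (cnt + 1) v ≠ 0 := by
    intro v hv
    rw [Function.update_apply]
    split_ifs
    · omega
    · exact hv
  have hit := fun i (hi : i ≤ cnt) k =>
    iterate_update (y := cur) h.parent_zero h.parent_lt (Nat.lt_succ_self cnt) hi k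
  refine ⟨μ - 1, by omega, ⟨le_rfl, ?_, ?_, ?_, ?_, ?_, ?_, ?_, ?_, ?_, ?_, ?_⟩⟩
  · rw [horg 0 (by omega)]; exact h.org_zero
  · intro i hi hi'
    by_cases hic : i = cnt + 1
    · subst hic; simp [hur]
    · have hi'' : i ≤ cnt := by omega
      rw [horg i hi'', Function.update_of_ne (hne i hi'')]
      exact h.org_spec i hi hi''
  · intro v hv hv' hnv
    by_cases hvu : v = u
    · subst hvu; simp
    · rw [Function.update_of_ne hvu] at hnv ⊢
      have := h.num_spec v hv hv' hnv
      rw [horg _ this.1]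
      exact ⟨by omega, this.2⟩
  · rw [hP 0 (by omega)]; exact h.parent_zero
  · intro i hi hi'
    by_cases hic : i = cnt + 1
    · subst hic; simp; omega
    · rw [hP i (by omega)]; exact h.parent_lt i hi (by omega)
  · intro i hi hi'
    by_cases hic : i = cnt + 1
    · subst hic
      simp only [Function.update_self]
      rw [horg cur hcur]; exact hRu
    · have := h.parent_lt i hi (by omega)
      rw [hP i (by omega), horg _ (by omega), horg _ (by omega)]
      exact h.parent_rel i hi (by omega)
  · intro v hv u₁ huv
    rcases h.rows v hv u₁ huv with h' | ⟨q, hq, rfl⟩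
    · exact Or.inl (hnum _ h')
    · rw [Function.update_apply]
      split_ifs with hvc
      · omega
      · by_cases hvo : v = org cur
        · subst hvo
          rw [Function.update_self]
          rcases Nat.lt_or_ge q (ptr (org cur) - 1) with hlt | hge
          · exact Or.inr ⟨q, hlt, rfl⟩
          · have : q = ptr (org cur) - 1 := by omega
            subst this
            exact absurd hu'.symm hvc
        · rw [Function.update_of_ne hvo]
          exact Or.inr ⟨q, hq, rfl⟩
  · intro v hv q hq
    apply h.valid v hv q
    rw [Function.update_apply] at hq
    split_ifs at hq with hvc
    · subst hvc; omega
    · exact hq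
  · intro i hi hk u₁ hu₁
    have hic : i ≠ cnt + 1 := fun h' => hk 0 h'.symm
    rw [horg i (by omega)] at hu₁
    apply hnum
    refine h.finished i (by omega) (fun k hk' => hk (k + 1) ?_) u₁ hu₁
    simp only [Function.iterate_succ, Function.comp_apply, Function.update_self]
    rw [(hit cur hcur k).1]; exact hk'
  · intro i j hi hij hj hr
    by_cases hjc : j = cnt + 1
    · subst hjc
      rw [horg i (by omega), Function.update_self] at hr
      by_contra hcon
      refine h.finished i (by omega) (fun k hk => hcon ⟨k + 1, ?_⟩) u hr hu
      simp only [Function.iterate_succ, Function.comp_apply, Function.update_self]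
      rw [(hit cur hcur k).1]; exact hk
    · rw [horg i (by omega), horg j (by omega)] at hr
      obtain ⟨k, hk⟩ := h.comparable i j hi hij (by omega) hr
      exact ⟨k, by rw [(hit j (by omega) k).1]; exact hk⟩
  · refine ⟨d + 1, by omega, ?_⟩
    simp only [Function.iterate_succ, Function.comp_apply, Function.update_self]
    rw [(hit cur hcur d).1]; exact hd'

end DfsInv

end OnePage

/-! ### Programs for the adjacency rows and the search -/

namespace OnePage

open Finset WordRAM WordRAM.Expr

/-- The adjacency relation read from the arrays `a`, `b` of the endpoints of the edges, with the
vertices shifted by one, and an additional vertex `0` with edges to all of them. -/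
def Rel (n m : ℕ) (a b : ℕ → ℕ) (v u : ℕ) : Prop :=
  (∃ i < m, (v = a i + 1 ∧ u = b i + 1) ∨ (v = b i + 1 ∧ u = a i + 1)) ∨ (v = 0 ∧ 1 ≤ u ∧ u ≤ n)

/-- Memory layout of all programs: arrays `2` and `3` hold the lengths and entries of the adjacency
rows, `4` the preorder numbers, `5` their inverse, `6` the parents, `8` the low points, `10` the
classes, `11` the class degrees, `12` the indices, `13` the number of indices per class, `14` and
`15` the indices of the ends of the edges, `16` and `17` the entries and lengths of the edge lists
of the classes, `18` the digits of the current permutation, `19` its positions, `20` and `21` the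
upper and lower ends of the edges. The row width in register `2` is the total number `2 * m + n` of
entries. The table spans quadratically many cells, but memory starts at zero and only linearly many
cells are touched. -/
def edgeRowsProg : Prog :=
  2 ≔ reg 1 +ₑ reg 1 +ₑ reg 0 ;;
  3 ≔ const 0 ;;
  .loop (reg 3 <ₑ reg 1)
    (4 ≔ load 0 (reg 3) +ₑ const 1 ;;
     5 ≔ load 1 (reg 3) +ₑ const 1 ;;
     .store 3 (reg 4 *ₑ reg 2 +ₑ load 2 (reg 4)) (reg 5) ;;
     .store 2 (reg 4) (load 2 (reg 4) +ₑ const 1) ;;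
     .store 3 (reg 5 *ₑ reg 2 +ₑ load 2 (reg 5)) (reg 4) ;;
     .store 2 (reg 5) (load 2 (reg 5) +ₑ const 1) ;;
     3 ≔ reg 3 +ₑ const 1)

def rootRowProg : Prog :=
  3 ≔ const 0 ;;
  .loop (reg 3 <ₑ reg 0)
    (3 ≔ reg 3 +ₑ const 1 ;;
     .store 3 (load 2 (const 0)) (reg 3) ;;
     .store 2 (const 0) (load 2 (const 0) +ₑ const 1))

/-- Addresses are quadratic in `n + m`, well below the fourth power. -/
theorem addr_lt {n m x W q B : ℕ} (hB : (n + m + 2) ^ 4 ≤ B) (hx : x ≤ n) (hW : W ≤ 2 * m + n)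
    (hq : q ≤ W) : x * W + q < B := by
  have h1 : x * W ≤ n * (2 * m + n) := Nat.mul_le_mul hx hW
  nlinarith [Nat.zero_le (n*m), Nat.zero_le (n^2), Nat.zero_le (m^2), Nat.zero_le (n^3),
    Nat.zero_le (n^2*m), Nat.zero_le (n*m^2), Nat.zero_le (m^3), Nat.zero_le (n^4),
    Nat.zero_le (n^3*m), Nat.zero_le (n^2*m^2), Nat.zero_le (n*m^3), Nat.zero_le (m^4)]

theorem small_lt {n m B : ℕ} (hB : (n + m + 2) ^ 4 ≤ B) : 4 * (n + m) + 4 < B := by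
  nlinarith [Nat.zero_le (n*m), Nat.zero_le (n^2), Nat.zero_le (m^2), Nat.zero_le (n^3),
    Nat.zero_le (n^2*m), Nat.zero_le (n*m^2), Nat.zero_le (m^3), Nat.zero_le (n^4),
    Nat.zero_le (n^3*m), Nat.zero_le (n^2*m^2), Nat.zero_le (n*m^3), Nat.zero_le (m^4)]

theorem edgeRowsProg_spec {w B n m : ℕ} (hB : B ≤ 2 ^ w) (hX : (n + m + 2) ^ 4 ≤ B) {s : State}
    (hn : s.reg 0 = n) (hm : s.reg 1 = m) (ha : ∀ i < m, s.arr 0 i < n)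
    (hb : ∀ i < m, s.arr 1 i < n) (hz : ∀ v, s.arr 2 v = 0) :
    Ends w edgeRowsProg s (fun t s' => t ≤ 100 * (n + m + 1) ∧ s'.reg 2 = 2 * m + n ∧
      IsTable n (2 * m + n) (fun v u => ∃ i < m, (v = s.arr 0 i + 1 ∧ u = s.arr 1 i + 1) ∨
      (v = s.arr 1 i + 1 ∧ u = s.arr 0 i + 1)) (s'.arr 2) (s'.arr 3) (2 * m)) := by
  have hS := small_lt hX
  have h1 : 1 < B := by omega
  have h0 : 0 < B := by omega
  apply Ends.of_wp hB h1
  simp [edgeRowsProg, wp, Expr.ok, Expr.val, Expr.cost, h0, hn, hm]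
  refine ⟨by omega, ?_⟩
  apply Ends.mono (Ends.for_const hB h1 (fun i s' => s'.reg 3 = i ∧
    IsTable n (2 * m + n) (fun v u => ∃ i' < i, (v = s.arr 0 i' + 1 ∧ u = s.arr 1 i' + 1) ∨
      (v = s.arr 1 i' + 1 ∧ u = s.arr 0 i' + 1)) (s'.arr 2) (s'.arr 3) (2 * i)) 60
      (Nat.zero_le m) ?_ ?_ ?_)
  · rintro t s' ⟨hfr, hfa⟩ ⟨ht, h3, htab⟩
    simp [Prog.regs, Prog.arrs, State.setReg_reg, Expr.cost] at hfr hfa ht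
    refine ⟨by omega, by rw [hfr] <;> simp; omega, htab⟩
  · simp only [State.setReg_reg, if_true, State.setReg_arr]
    refine ⟨trivial, by simp [hz], by simp [hz]⟩
  · rintro i s' - hi ⟨hfr, hfa⟩ ⟨h3, htab⟩
    have h2 : s'.reg 2 = 2 * m + n := by
      rw [hfr] <;> simp [State.setReg_reg, Prog.regs]; omega
    have hr1 : s'.reg 1 = m := by
      rw [hfr] <;> simp [State.setReg_reg, Prog.regs, hm]
    have h4 : s'.arr 0 = s.arr 0 := by
      rw [hfa] <;> simp [State.setReg_arr, Prog.arrs]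
    have h5 : s'.arr 1 = s.arr 1 := by
      rw [hfa] <;> simp [State.setReg_arr, Prog.arrs]
    simp [wp, Expr.ok, Expr.val, Expr.cost, State.setReg_reg, State.setReg_arr, State.setArr_reg,
      State.setArr_arr, h1, h2, h3, h4, h5, hr1, hi]
    have hai := ha i hi
    have hbi := hb i hi
    have t1 := htab.insert (x := s.arr 0 i + 1) (y := s.arr 1 i + 1) (by omega) (by omega)
    have t2 := t1.insert (x := s.arr 1 i + 1) (y := s.arr 0 i + 1) (by omega) (by omega)
    have hp1 := htab.ptr_le (v := s.arr 0 i + 1) (by omega)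
    have hp2 := t1.ptr_le (v := s.arr 1 i + 1) (by omega)
    have ha1 := addr_lt hX (x := s.arr 0 i + 1) (by omega) le_rfl (hp1.trans (by omega))
    have ha2 := addr_lt hX (x := s.arr 1 i + 1) (by omega) le_rfl (hp2.trans (by omega))
    refine ⟨by omega, by omega, ⟨by omega, ha1⟩, by omega, ⟨by omega, ha2⟩, by omega, by omega, ?_⟩
    refine IsTable.congr t2 fun v _ u => ?_
    simp only [Nat.le_iff_lt_or_eq, or_and_right, exists_or, exists_eq_left, or_assoc]
  · rintro s' ⟨hfr, hfa⟩ ⟨h3, htab⟩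
    have hr1 : s'.reg 1 = m := by
      rw [hfr] <;> simp [State.setReg_reg, Prog.regs, hm]
    simp [Expr.ok, Expr.val, h3, hr1]

theorem rootRowProg_spec {w B n m : ℕ} (hB : B ≤ 2 ^ w) (hX : (n + m + 2) ^ 4 ≤ B) {s : State}
    {R : ℕ → ℕ → Prop} (hn : s.reg 0 = n)
    (ht : IsTable n (2 * m + n) R (s.arr 2) (s.arr 3) (2 * m)) :
    Ends w rootRowProg s (fun t s' => t ≤ 100 * (n + m + 1) ∧
      IsTable n (2 * m + n) (fun v u => R v u ∨ (v = 0 ∧ 1 ≤ u ∧ u ≤ n)) (s'.arr 2) (s'.arr 3)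
        (2 * m + n)) := by
  have hS := small_lt hX
  have h1 : 1 < B := by omega
  have h0 : 0 < B := by omega
  apply Ends.of_wp hB h1
  simp [rootRowProg, wp, Expr.ok, Expr.val, Expr.cost, h0]
  apply Ends.mono (Ends.for_const hB h1 (fun i s' => s'.reg 3 = i ∧
    IsTable n (2 * m + n) (fun v u => R v u ∨ (v = 0 ∧ 1 ≤ u ∧ u ≤ i)) (s'.arr 2) (s'.arr 3)
      (2 * m + i)) 60 (Nat.zero_le n) ?_ ?_ ?_)
  · rintro t s' - ⟨ht, h3, htab⟩
    simp [Expr.cost] at ht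
    exact ⟨by omega, htab⟩
  · refine ⟨by simp [State.setReg_reg], ht.congr fun v _ u => ?_⟩
    simp only [iff_self_or]
    omega
  · rintro i s' - hi ⟨hfr, hfa⟩ ⟨h3, htab⟩
    have hr0 : s'.reg 0 = n := (hfr 0 (by decide)).trans (by simpa [State.setReg_reg] using hn)
    have hp := htab.ptr_le (v := 0) (by omega)
    have t1 := htab.insert (x := 0) (y := i + 1) (by omega) (by omega)
    simp [wp, Expr.ok, Expr.val, Expr.cost, State.setReg_reg, State.setReg_arr, State.setArr_reg,
      State.setArr_arr, h0, h1, h3, hr0, hi]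
    refine ⟨by omega, by omega, ?_⟩
    simp only [zero_mul, zero_add] at t1
    refine IsTable.congr t1 fun v _ u => ?_
    rw [or_assoc, ← and_or_left]
    exact or_congr_right (and_congr_right fun _ => by omega)
  · rintro s' ⟨hfr, hfa⟩ ⟨h3, htab⟩
    have hr0 : s'.reg 0 = n := (hfr 0 (by decide)).trans (by simpa [State.setReg_reg] using hn)
    simp [Expr.ok, Expr.val, h3, hr0]

/-- Register `6` is the current preorder number, `7` the last number given, and `8` the flag that
keeps the loop running. Number `0` means unvisited; the artificial root has it too, which is
harmless because the root occurs in no row. -/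
def dfsProg : Prog :=
  6 ≔ const 0 ;;
  7 ≔ const 0 ;;
  8 ≔ const 1 ;;
  .loop (reg 8)
    (4 ≔ load 5 (reg 6) ;;
     5 ≔ load 2 (reg 4) ;;
     .branch (reg 5)
       (5 ≔ reg 5 -ₑ const 1 ;;
        .store 2 (reg 4) (reg 5) ;;
        5 ≔ load 3 (reg 4 *ₑ reg 2 +ₑ reg 5) ;;
        .branch (load 4 (reg 5)) .skip
          (7 ≔ reg 7 +ₑ const 1 ;;
           .store 4 (reg 5) (reg 7) ;;
           .store 5 (reg 7) (reg 5) ;;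
           .store 6 (reg 7) (reg 6) ;;
           6 ≔ reg 7))
       (.branch (reg 6) (6 ≔ load 6 (reg 6)) (8 ≔ const 0)))

theorem dfsProg_spec {w B n m : ℕ} (hB : B ≤ 2 ^ w) (hX : (n + m + 2) ^ 4 ≤ B) {s : State}
    {R : ℕ → ℕ → Prop} (hR : ∀ v u, R v u → 1 ≤ u ∧ u ≤ n) (hW : s.reg 2 = 2 * m + n)
    (ht : IsTable n (2 * m + n) R (s.arr 2) (s.arr 3) (2 * m + n)) (hz4 : ∀ v, s.arr 4 v = 0)
    (hz5 : ∀ v, s.arr 5 v = 0) (hz6 : ∀ v, s.arr 6 v = 0) :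
    Ends w dfsProg s (fun t s' => t ≤ 400 * (n + m + 1) ∧ ∃ cnt μ, s'.arr 2 0 = 0 ∧
      DfsInv n (2 * m + n) R (s'.arr 2) (s'.arr 3) (s'.arr 4) (s'.arr 5) (s'.arr 6) 0 cnt μ) := by
  have hS := small_lt hX
  have h1 : 1 < B := by omega
  have h0 : 0 < B := by omega
  apply Ends.of_wp hB h1
  simp [dfsProg, wp, Expr.ok, Expr.val, Expr.cost, h0, h1]
  -- Postcondition and invariant are made opaque, so that simplifying the weakest precondition does
  -- not take them apart; the same device recurs in the other loops.
  obtain ⟨Q, hQ⟩ : ∃ Q : State → Prop, ∀ s', Q s' ↔ (∃ cnt μ, s'.arr 2 0 = 0 ∧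
      DfsInv n (2 * m + n) R (s'.arr 2) (s'.arr 3) (s'.arr 4) (s'.arr 5) (s'.arr 6) 0 cnt μ) :=
    ⟨_, fun _ => Iff.rfl⟩
  -- The additional `1` pays for the last pass, which only clears the flag.
  obtain ⟨Inv, hInv⟩ : ∃ Inv : ℕ → State → Prop, ∀ μ s', Inv μ s' ↔ (s'.reg 8 = 1 ∧ ∃ μ',
      μ = μ' + 1 ∧ DfsInv n (2 * m + n) R (s'.arr 2) (s'.arr 3) (s'.arr 4) (s'.arr 5) (s'.arr 6)
        (s'.reg 6) (s'.reg 7) μ' ∧ ∀ v ≤ n, s'.arr 2 v ≤ 2 * m + n) ∨ (s'.reg 8 = 0 ∧ Q s') :=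
    ⟨_, fun _ _ => Iff.rfl⟩
  apply Ends.mono (Ends.while hB h1 Inv Q 50 (μ₀ := 2 * (2 * m + n) + 1) ?_ ?_)
  · rintro t s' - ⟨ht, h⟩
    simp [Expr.cost] at ht
    exact ⟨by omega, by simpa using (hQ s').1 h⟩
  · rw [hInv]
    left
    simp only [State.setReg_reg, State.setReg_arr]
    refine ⟨by simp, _, rfl, ⟨by simp, hz5 0, by simp; omega, ?_, hz6 0, by simp; omega,
      by simp; omega, ?_, ?_, ?_, by simp; omega, ⟨0, by rw [ht.total]; rfl, rfl⟩⟩, ?_⟩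
    · intro v _ _ hv
      exact absurd (hz4 v) hv
    · intro v hv u hu
      exact Or.inr ((ht.mem_iff v hv u).1 hu)
    · intro v hv q hq
      exact (ht.mem_iff v hv _).2 ⟨q, hq, rfl⟩
    · intro i hi hk
      exact absurd (show (0 : ℕ) = i by simp at hi; omega) (by simpa using hk 0)
    · intro v hv
      exact ht.ptr_le hv
  · intro μ s' hf hI
    rw [hInv] at hI
    obtain ⟨h8, μ', rfl, hI, hp⟩ | ⟨h8, hI⟩ := hI
    · have hW' : s'.reg 2 = 2 * m + n :=
        (hf.1 2 (by decide)).trans (by simpa [State.setReg_reg] using hW)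
      simp only [wp, Expr.ok, Expr.val, Expr.cost, State.setReg_reg, State.setReg_arr,
        State.setArr_reg, State.setArr_arr]
      simp only [Nat.reduceEqDiff, reduceIte, hW', h8, h0, h1, true_and, ne_eq, hInv,
        State.setReg_reg, State.setReg_arr, State.setArr_reg, State.setArr_arr, hQ]
      have ho := hI.org_le hI.cur_le
      refine ⟨fun _ => ⟨fun hne => ?_, fun he => ⟨fun hc => ?_, fun hc => ?_⟩⟩, by simp⟩
      · have hpo := hp _ ho
        have := addr_lt hX ho (le_refl (2 * m + n))
          (show s'.arr 2 (s'.arr 5 (s'.reg 6)) - 1 ≤ 2 * m + n by omega)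
        refine ⟨⟨by omega, this⟩, fun hu => ?_, fun hu => ?_⟩
        · obtain ⟨μ'', hμ, hI'⟩ := hI.skip hne hu
          refine ⟨by omega, μ'' + 1, by omega, Or.inl ⟨_, rfl, hI', fun v hv => ?_⟩⟩
          rw [Function.update_apply]
          split_ifs
          · omega
          · exact hp v hv
        · have hc := hI.cnt_le
          obtain ⟨μ'', hμ, hI'⟩ := hI.push hR hne rfl hu
          refine ⟨by omega, by omega, μ'' + 1, by omega,
            Or.inl ⟨_, rfl, hI', fun v hv => ?_⟩⟩
          rw [Function.update_apply]
          split_ifs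
          · omega
          · exact hp v hv
      · obtain ⟨μ'', hμ, hI'⟩ := hI.pop he hc
        exact ⟨by omega, μ'' + 1, by omega, Or.inl ⟨_, rfl, hI', hp⟩⟩
      · rw [hc] at hI he
        rw [hI.org_zero] at he
        exact ⟨by omega, 0, by omega, Or.inr ⟨_, _, he, hI⟩⟩
    · simp [Expr.ok, Expr.val, h8, hI]

end OnePage

namespace OnePage

open Finset WordRAM WordRAM.Expr

/-! ### Low points and classes -/

/-- Array `8` stores `n - V` instead of `V`: minima become maxima, and the initial value `0`
correctly stands for the absence of edges. -/
def lowProg : Prog :=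
  3 ≔ const 0 ;;
  .loop (reg 3 <ₑ reg 1)
    (4 ≔ load 4 (load 0 (reg 3) +ₑ const 1) ;;
     5 ≔ load 4 (load 1 (reg 3) +ₑ const 1) ;;
     .branch (reg 4 <ₑ reg 5) (6 ≔ reg 4 ;; 4 ≔ reg 5 ;; 5 ≔ reg 6) .skip ;;
     .store 20 (reg 3) (reg 4) ;;
     .store 21 (reg 3) (reg 5) ;;
     5 ≔ reg 0 -ₑ reg 5 ;;
     .branch (load 8 (reg 4) <ₑ reg 5) (.store 8 (reg 4) (reg 5)) .skip ;;
     3 ≔ reg 3 +ₑ const 1)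

/-- In decreasing preorder every vertex has received the values of all its children before it passes
its own value to its parent. -/
def pushProg : Prog :=
  3 ≔ reg 0 ;;
  .loop (reg 3)
    (4 ≔ load 6 (reg 3) ;;
     .branch (load 8 (reg 4) <ₑ load 8 (reg 3)) (.store 8 (reg 4) (load 8 (reg 3))) .skip ;;
     3 ≔ reg 3 -ₑ const 1)

/-- The test asks whether some edge leaves the subtree strictly above the parent. In increasing
preorder the class of the parent is already known. -/
def classProg : Prog :=
  3 ≔ const 0 ;;
  .loop (reg 3 <ₑ reg 0)
    (3 ≔ reg 3 +ₑ const 1 ;;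
     4 ≔ load 6 (reg 3) ;;
     .branch (reg 0 -ₑ reg 4 <ₑ load 8 (reg 3)) (.store 10 (reg 3) (load 10 (reg 4)))
       (.store 10 (reg 3) (reg 3)))

/-- A maximum is described by the set of numbers below it, which turns it into an existential
statement and avoids empty maxima. -/
theorem lowProg_spec {w B n m : ℕ} (hB : B ≤ 2 ^ w) (hX : (n + m + 2) ^ 4 ≤ B) {s : State}
    (hn : s.reg 0 = n) (hm : s.reg 1 = m) (ha : ∀ i < m, s.arr 0 i < n)
    (hb : ∀ i < m, s.arr 1 i < n) (hz : ∀ v, s.arr 8 v = 0) :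
    Ends w lowProg s (fun t s' => t ≤ 100 * (n + m + 1) ∧
      (∀ i < m, s'.arr 20 i = max (s.arr 4 (s.arr 0 i + 1)) (s.arr 4 (s.arr 1 i + 1))) ∧
      (∀ i < m, s'.arr 21 i = min (s.arr 4 (s.arr 0 i + 1)) (s.arr 4 (s.arr 1 i + 1))) ∧
      ∀ x c, c < s'.arr 8 x ↔ ∃ i < m, s'.arr 20 i = x ∧ c < n - s'.arr 21 i) := by
  have hS := small_lt hX
  have h1 : 1 < B := by omega
  have h0 : 0 < B := by omega
  apply Ends.of_wp hB h1
  simp [lowProg, wp, Expr.ok, Expr.val, Expr.cost, h0]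
  obtain ⟨Inv, hInv⟩ : ∃ Inv : ℕ → State → Prop, ∀ j s', Inv j s' ↔ s'.reg 3 = j ∧
      (∀ i < j, s'.arr 20 i = max (s.arr 4 (s.arr 0 i + 1)) (s.arr 4 (s.arr 1 i + 1))) ∧
      (∀ i < j, s'.arr 21 i = min (s.arr 4 (s.arr 0 i + 1)) (s.arr 4 (s.arr 1 i + 1))) ∧
      ∀ x c, c < s'.arr 8 x ↔ ∃ i < j, s'.arr 20 i = x ∧ c < n - s'.arr 21 i :=
    ⟨_, fun _ _ => Iff.rfl⟩
  apply Ends.mono (Ends.for_const hB h1 Inv 60 (Nat.zero_le m) ?_ ?_ ?_)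
  · rintro t s' - ⟨ht, h⟩
    simp [Expr.cost] at ht
    exact ⟨by omega, ((hInv _ _).1 h).2⟩
  · rw [hInv]
    simp [State.setReg_reg, State.setReg_arr, hz]
  · intro j s' _ hj hf hI
    rw [hInv] at hI
    obtain ⟨h3, hU, hV, hl⟩ := hI
    have hr0 : s'.reg 0 = n := (hf.1 0 (by decide)).trans (by simpa [State.setReg_reg] using hn)
    have hr1 : s'.reg 1 = m := (hf.1 1 (by decide)).trans (by simpa [State.setReg_reg] using hm)
    have ha0 : s'.arr 0 = s.arr 0 := hf.2 0 (by decide)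
    have ha1 : s'.arr 1 = s.arr 1 := hf.2 1 (by decide)
    have ha4 : s'.arr 4 = s.arr 4 := hf.2 4 (by decide)
    have haj := ha j hj
    have hbj := hb j hj
    simp only [wp, Expr.ok, Expr.val, Expr.cost, State.setReg_reg, State.setReg_arr,
      State.setArr_reg, State.setArr_arr, hInv]
    simp only [Nat.reduceEqDiff, reduceIte, hr0, hr1, ha0, ha1, ha4, h3, h1, hj, true_and,
      ne_eq]
    have key : ∀ x y : ℕ, x = max (s.arr 4 (s.arr 0 j + 1)) (s.arr 4 (s.arr 1 j + 1)) →
        y = min (s.arr 4 (s.arr 0 j + 1)) (s.arr 4 (s.arr 1 j + 1)) → ∀ l' : ℕ → ℕ,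
        l' = Function.update (s'.arr 8) x (max (s'.arr 8 x) (n - y)) →
        (∀ i < j + 1, Function.update (s'.arr 20) j x i =
          max (s.arr 4 (s.arr 0 i + 1)) (s.arr 4 (s.arr 1 i + 1))) ∧
        (∀ i < j + 1, Function.update (s'.arr 21) j y i =
          min (s.arr 4 (s.arr 0 i + 1)) (s.arr 4 (s.arr 1 i + 1))) ∧
        ∀ z c, c < l' z ↔ ∃ i < j + 1, Function.update (s'.arr 20) j x i = z ∧
          c < n - Function.update (s'.arr 21) j y i := by
      intro x y hx hy l' hl'
      refine ⟨fun i hi => ?_, fun i hi => ?_, fun z c => ?_⟩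
      · by_cases hij : i = j
        · subst hij; simpa using hx
        · rw [Function.update_of_ne hij]; exact hU i (by omega)
      · by_cases hij : i = j
        · subst hij; simpa using hy
        · rw [Function.update_of_ne hij]; exact hV i (by omega)
      · have : (∃ i < j + 1, Function.update (s'.arr 20) j x i = z ∧
            c < n - Function.update (s'.arr 21) j y i) ↔
            (∃ i < j, s'.arr 20 i = z ∧ c < n - s'.arr 21 i) ∨ (x = z ∧ c < n - y) := by
          constructor
          · rintro ⟨i, hi, h⟩
            by_cases hij : i = j
            · subst hij; right; simpa using h
            · rw [Function.update_of_ne hij, Function.update_of_ne hij] at h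
              exact Or.inl ⟨i, by omega, h⟩
          · rintro (⟨i, hi, h⟩ | h)
            · refine ⟨i, by omega, ?_⟩
              rwa [Function.update_of_ne (by omega), Function.update_of_ne (by omega)]
            · exact ⟨j, by omega, by simpa using h⟩
        rw [this, ← hl, hl', Function.update_apply]
        split_ifs with hzx
        · subst hzx; simp
        · simp [Ne.symm hzx]
    have upd : ∀ (f : ℕ → ℕ) x y, f x < y → Function.update f x y =
        Function.update f x (max (f x) y) := fun f x y h => by rw [max_eq_right h.le]
    have upd' : ∀ (f : ℕ → ℕ) x y, ¬ f x < y → f = Function.update f x (max (f x) y) :=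
      fun f x y h => by rw [max_eq_left (by omega)]; simp
    refine ⟨by simp, by omega, by omega, fun h => ⟨fun h' => ?_, fun h' => ?_⟩,
      fun h => ⟨fun h' => ?_, fun h' => ?_⟩⟩
    · have h : s.arr 4 (s.arr 0 j + 1) < s.arr 4 (s.arr 1 j + 1) := by
        by_contra hc; simp [hc] at h
      have h' : s'.arr 8 (s.arr 4 (s.arr 1 j + 1)) < n - s.arr 4 (s.arr 0 j + 1) := by
        by_contra hc; simp [hc] at h'
      exact ⟨by omega, by omega, key _ _ (by omega) (by omega) _ (upd _ _ _ h')⟩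
    · have h : s.arr 4 (s.arr 0 j + 1) < s.arr 4 (s.arr 1 j + 1) := by
        by_contra hc; simp [hc] at h
      have h' : ¬ s'.arr 8 (s.arr 4 (s.arr 1 j + 1)) < n - s.arr 4 (s.arr 0 j + 1) := by
        intro hc; simp [hc] at h'
      exact ⟨by omega, by omega, key _ _ (by omega) (by omega) _ (upd' _ _ _ h')⟩
    · have h : ¬ s.arr 4 (s.arr 0 j + 1) < s.arr 4 (s.arr 1 j + 1) := by
        intro hc; simp [hc] at h
      have h' : s'.arr 8 (s.arr 4 (s.arr 0 j + 1)) < n - s.arr 4 (s.arr 1 j + 1) := by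
        by_contra hc; simp [hc] at h'
      exact ⟨by omega, by omega, key _ _ (by omega) (by omega) _ (upd _ _ _ h')⟩
    · have h : ¬ s.arr 4 (s.arr 0 j + 1) < s.arr 4 (s.arr 1 j + 1) := by
        intro hc; simp [hc] at h
      have h' : ¬ s'.arr 8 (s.arr 4 (s.arr 0 j + 1)) < n - s.arr 4 (s.arr 1 j + 1) := by
        intro hc; simp [hc] at h'
      exact ⟨by omega, by omega, key _ _ (by omega) (by omega) _ (upd' _ _ _ h')⟩
  · intro s' hf hI
    rw [hInv] at hI
    have hr1 : s'.reg 1 = m := (hf.1 1 (by decide)).trans (by simpa [State.setReg_reg] using hm)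
    simp [Expr.ok, Expr.val, hI.1, hr1]

theorem pushProg_spec {w B n m : ℕ} (hB : B ≤ 2 ^ w) (hX : (n + m + 2) ^ 4 ≤ B) {s : State}
    {U V : ℕ → ℕ} (hn : s.reg 0 = n) (hU : ∀ i < m, U i ≤ n)
    (hP0 : s.arr 6 0 = 0) (hP : ∀ x, 1 ≤ x → x ≤ n → s.arr 6 x < x)
    (hl : ∀ x c, c < s.arr 8 x ↔ ∃ i < m, U i = x ∧ c < n - V i) :
    Ends w pushProg s (fun t s' => t ≤ 100 * (n + m + 1) ∧ ∀ x, 1 ≤ x → x ≤ n →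
      ∀ c, c < s'.arr 8 x ↔ ∃ i < m, (∃ k, (s.arr 6)^[k] (U i) = x) ∧ c < n - V i) := by
  have hS := small_lt hX
  have h1 : 1 < B := by omega
  have h0 : 0 < B := by omega
  apply Ends.of_wp hB h1
  simp [pushProg, wp, Expr.ok, Expr.val, Expr.cost, hn]
  set P := s.arr 6 with hPdef
  have hPle : ∀ x ≤ n, P x ≤ x := fun x hx => by
    rcases Nat.eq_zero_or_pos x with rfl | h
    · omega
    · exact (hP x h hx).le
  have hPk : ∀ k x, x ≤ n → P^[k] x ≤ x := by
    intro k
    induction k with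
    | zero => simp
    | succ k ih =>
      intro x hx
      exact (ih _ ((hPle x hx).trans hx)).trans (hPle x hx)
  -- After `j` passes the vertices above `n - j` have been pushed, so `x` knows its own edges and
  -- those below its children `y > n - j`.
  obtain ⟨Inv, hInv⟩ : ∃ Inv : ℕ → State → Prop, ∀ j s', Inv j s' ↔ s'.reg 3 = n - j ∧
      ∀ x c, c < s'.arr 8 x ↔ ∃ i < m, (U i = x ∨ ∃ y > n - j, y ≤ n ∧ P y = x ∧
        ∃ k, P^[k] (U i) = y) ∧ c < n - V i := ⟨_, fun _ _ => Iff.rfl⟩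
  apply Ends.mono (Ends.for_const hB h1 Inv 60 (Nat.zero_le n) ?_ ?_ ?_)
  · rintro t s' - ⟨ht, h⟩
    simp [Expr.cost] at ht
    refine ⟨by omega, fun x hx hxn c => ?_⟩
    rw [hInv] at h
    rw [h.2]
    refine exists_congr fun i => and_congr_right fun hi => and_congr_left fun _ => ⟨?_, ?_⟩
    · rintro (h' | ⟨y, _, _, hy, k, hk⟩)
      · exact ⟨0, h'⟩
      · exact ⟨k + 1, by rw [Function.iterate_succ_apply', hk, hy]⟩
    · rintro ⟨k, hk⟩
      cases k with
      | zero => exact Or.inl hk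
      | succ k =>
        rw [Function.iterate_succ_apply'] at hk
        have := hPk k (U i) (hU i hi)
        have := hU i hi
        refine Or.inr ⟨P^[k] (U i), ?_, by omega, hk, k, rfl⟩
        rcases Nat.eq_zero_or_pos (P^[k] (U i)) with h | h
        · rw [h] at hk; omega
        · omega
  · rw [hInv]
    refine ⟨by simp [State.setReg_reg], fun x c => ?_⟩
    rw [State.setReg_arr, hl]
    refine exists_congr fun i => and_congr_right fun hi => and_congr_left fun _ => ?_
    simp only [iff_self_or]
    rintro ⟨y, hy, hy', _⟩
    omega
  · intro j s' _ hj hf hI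
    rw [hInv] at hI
    obtain ⟨h3, hl'⟩ := hI
    have ha6 : s'.arr 6 = P := hf.2 6 (by decide)
    simp only [wp, Expr.ok, Expr.val, Expr.cost, State.setReg_reg, State.setReg_arr,
      State.setArr_reg, State.setArr_arr, hInv]
    simp only [Nat.reduceEqDiff, reduceIte, ha6, h3, h1, true_and, ne_eq]
    have key : ∀ l' : ℕ → ℕ, l' = Function.update (s'.arr 8) (P (n - j))
        (max (s'.arr 8 (P (n - j))) (s'.arr 8 (n - j))) → ∀ x c, c < l' x ↔ ∃ i < m,
        (U i = x ∨ ∃ y > n - (j + 1), y ≤ n ∧ P y = x ∧ ∃ k, P^[k] (U i) = y) ∧ c < n - V i := by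
      rintro _ rfl x c
      -- A pass only adds what is known at the child `n - j`. That knowledge is complete, since all
      -- children of `n - j` have larger numbers.
      have h4 : (∃ i < m, (U i = x ∨ ∃ y > n - (j + 1), y ≤ n ∧ P y = x ∧
          ∃ k, P^[k] (U i) = y) ∧ c < n - V i) ↔ c < s'.arr 8 x ∨
          (P (n - j) = x ∧ c < s'.arr 8 (n - j)) := by
        rw [hl', hl']
        constructor
        · rintro ⟨i, hi, (h | ⟨y, hy, hyn, hyx, k, hk⟩), hc⟩
          · exact Or.inl ⟨i, hi, Or.inl h, hc⟩
          · by_cases hyj : y = n - j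
            · subst hyj
              refine Or.inr ⟨hyx, i, hi, ?_, hc⟩
              cases k with
              | zero => exact Or.inl hk
              | succ k =>
                rw [Function.iterate_succ_apply'] at hk
                have h5 := hPk k (U i) (hU i hi)
                have h6 := hU i hi
                have h7 := hP (P^[k] (U i)) (by
                  rcases Nat.eq_zero_or_pos (P^[k] (U i)) with h | h
                  · rw [h] at hk; omega
                  · omega) (by omega)
                exact Or.inr ⟨P^[k] (U i), by omega, by omega, hk, k, rfl⟩
            · exact Or.inl ⟨i, hi, Or.inr ⟨y, by omega, hyn, hyx, k, hk⟩, hc⟩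
        · rintro (⟨i, hi, (h | ⟨y, hy, h⟩), hc⟩ | ⟨hx, i, hi, (h | ⟨y, hy, hyn, h, k, hk⟩), hc⟩)
          · exact ⟨i, hi, Or.inl h, hc⟩
          · exact ⟨i, hi, Or.inr ⟨y, by omega, h⟩, hc⟩
          · exact ⟨i, hi, Or.inr ⟨n - j, by omega, by omega, hx, 0, h⟩, hc⟩
          · exact ⟨i, hi, Or.inr ⟨n - j, by omega, by omega, hx, k + 1, by
              rw [Function.iterate_succ_apply', hk, h]⟩, hc⟩
      rw [h4, Function.update_apply]
      split_ifs with hxP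
      · subst hxP; simp
      · simp [Ne.symm hxP]
    refine ⟨by omega, fun h => ?_, fun h => ?_⟩
    · have h : s'.arr 8 (P (n - j)) < s'.arr 8 (n - j) := by
        by_contra hc; simp [hc] at h
      exact ⟨by omega, by omega, key _ (by rw [max_eq_right h.le])⟩
    · have h : ¬ s'.arr 8 (P (n - j)) < s'.arr 8 (n - j) := by
        intro hc; simp [hc] at h
      exact ⟨by omega, by omega, key _ (by rw [max_eq_left (by omega)]; simp)⟩
  · intro s' hf hI
    rw [hInv] at hI
    simp [Expr.ok, Expr.val, hI.1]

theorem classProg_spec {w B n m : ℕ} (hB : B ≤ 2 ^ w) (hX : (n + m + 2) ^ 4 ≤ B) {s : State}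
    (hn : s.reg 0 = n) (hP : ∀ x, 1 ≤ x → x ≤ n → s.arr 6 x < x) :
    Ends w classProg s (fun t s' => t ≤ 100 * (n + m + 1) ∧ ∀ x, 1 ≤ x → x ≤ n →
      s'.arr 10 x = if n - s.arr 6 x < s.arr 8 x then s'.arr 10 (s.arr 6 x) else x) := by
  have hS := small_lt hX
  have h1 : 1 < B := by omega
  have h0 : 0 < B := by omega
  apply Ends.of_wp hB h1
  simp [classProg, wp, Expr.ok, Expr.val, Expr.cost, h0]
  obtain ⟨Inv, hInv⟩ : ∃ Inv : ℕ → State → Prop, ∀ j s', Inv j s' ↔ s'.reg 3 = j ∧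
      ∀ x, 1 ≤ x → x ≤ j →
      s'.arr 10 x = if n - s.arr 6 x < s.arr 8 x then s'.arr 10 (s.arr 6 x) else x :=
    ⟨_, fun _ _ => Iff.rfl⟩
  apply Ends.mono (Ends.for_const hB h1 Inv 60 (Nat.zero_le n) ?_ ?_ ?_)
  · rintro t s' - ⟨ht, h⟩
    simp [Expr.cost] at ht
    exact ⟨by omega, ((hInv _ _).1 h).2⟩
  · rw [hInv]
    exact ⟨by simp [State.setReg_reg], fun x _ _ => by omega⟩
  · intro j s' _ hj hf hI
    rw [hInv] at hI
    obtain ⟨h3, hI⟩ := hI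
    have hr0 : s'.reg 0 = n := (hf.1 0 (by decide)).trans (by simpa [State.setReg_reg] using hn)
    have ha6 : s'.arr 6 = s.arr 6 := hf.2 6 (by decide)
    have ha8 : s'.arr 8 = s.arr 8 := hf.2 8 (by decide)
    simp only [wp, Expr.ok, Expr.val, Expr.cost, State.setReg_reg, State.setReg_arr,
      State.setArr_reg, State.setArr_arr, hInv]
    simp only [Nat.reduceEqDiff, reduceIte, hr0, ha6, ha8, h3, h1, hj, true_and, ne_eq]
    have key : ∀ v, (v = if n - s.arr 6 (j + 1) < s.arr 8 (j + 1) then s'.arr 10 (s.arr 6 (j + 1))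
        else j + 1) → ∀ x, 1 ≤ x → x ≤ j + 1 → Function.update (s'.arr 10) (j + 1) v x =
        if n - s.arr 6 x < s.arr 8 x then Function.update (s'.arr 10) (j + 1) v (s.arr 6 x)
        else x := by
      intro v hv x hx hxj
      have := hP x hx (by omega)
      rw [Function.update_of_ne (a := s.arr 6 x) (by omega)]
      by_cases hxj' : x = j + 1
      · subst hxj'; simpa using hv
      · rw [Function.update_of_ne hxj']
        exact hI x hx (by omega)
    refine ⟨by simp, by omega, fun h => ?_, fun h => ?_⟩
    · refine ⟨by omega, key _ ?_⟩
      by_cases hc : n - s.arr 6 (j + 1) < s.arr 8 (j + 1)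
      · simp [hc]
      · simp [hc] at h
    · refine ⟨by omega, key _ ?_⟩
      by_cases hc : n - s.arr 6 (j + 1) < s.arr 8 (j + 1)
      · simp [hc] at h
      · simp [hc]
  · intro s' hf hI
    rw [hInv] at hI
    have hr0 : s'.reg 0 = n := (hf.1 0 (by decide)).trans (by simpa [State.setReg_reg] using hn)
    simp [Expr.ok, Expr.val, hI.1, hr0]

end OnePage

namespace OnePage

open Finset WordRAM WordRAM.Expr

/-! ### Degrees, contraction, and the edges of the classes -/

def degProg : Prog :=
  3 ≔ const 0 ;;
  .loop (reg 3 <ₑ reg 1)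
    (4 ≔ load 20 (reg 3) ;;
     5 ≔ load 21 (reg 3) ;;
     .store 11 (reg 4) (load 11 (reg 4) +ₑ const 1) ;;
     .branch (load 10 (reg 5) =ₑ load 10 (reg 4))
       (.store 11 (reg 5) (load 11 (reg 5) +ₑ const 1)) .skip ;;
     3 ≔ reg 3 +ₑ const 1)

/-- Indices within a class start at `1`, because `0` is reserved for the parent of the top vertex,
which belongs to the block but not to the class. The product of the two comparisons is their
conjunction. -/
def indexProg : Prog :=
  3 ≔ const 0 ;;
  .loop (reg 3 <ₑ reg 0)
    (3 ≔ reg 3 +ₑ const 1 ;;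
     4 ≔ load 6 (reg 3) ;;
     5 ≔ load 10 (reg 3) ;;
     .branch (reg 5 =ₑ reg 3)
       (.store 13 (reg 5) (load 13 (reg 5) +ₑ const 1) ;; .store 12 (reg 3) (load 13 (reg 5)))
       (.branch ((load 11 (reg 3) <ₑ const 3) *ₑ (load 11 (reg 4) <ₑ const 3))
         (.store 12 (reg 3) (load 12 (reg 4)))
         (.store 13 (reg 5) (load 13 (reg 5) +ₑ const 1) ;;
          .store 12 (reg 3) (load 13 (reg 5)))))

/-- An edge whose ends have the same index has become a loop by contraction and is not listed. -/
def bucketProg : Prog :=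
  3 ≔ const 0 ;;
  .loop (reg 3 <ₑ reg 1)
    (4 ≔ load 20 (reg 3) ;;
     5 ≔ load 21 (reg 3) ;;
     9 ≔ load 10 (reg 4) ;;
     4 ≔ load 12 (reg 4) ;;
     .branch (load 10 (reg 5) =ₑ reg 9) (5 ≔ load 12 (reg 5)) (5 ≔ const 0) ;;
     .store 14 (reg 3) (reg 4) ;;
     .store 15 (reg 3) (reg 5) ;;
     .branch (reg 4 =ₑ reg 5) .skip
       (.store 16 (reg 9 *ₑ reg 1 +ₑ load 17 (reg 9)) (reg 3) ;;
        .store 17 (reg 9) (load 17 (reg 9) +ₑ const 1)) ;;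
     3 ≔ reg 3 +ₑ const 1)

/-- The degree of a vertex within its class; `U` and `V` give the endpoints of the edges. -/
def classDegree (m : ℕ) (U V cls : ℕ → ℕ) (x : ℕ) : ℕ :=
  ∑ i ∈ range m, ((if U i = x then 1 else 0) +
    (if V i = x ∧ cls (V i) = cls (U i) then 1 else 0))

/-- The edge from `x` to its parent is contracted. -/
def Contracted (cls deg P : ℕ → ℕ) (x : ℕ) : Prop :=
  cls x ≠ x ∧ deg x < 3 ∧ deg (P x) < 3

open Classical in
/-- The vertices up to `j` in class `t` that remain after the contraction. -/
noncomputable def remaining (cls deg P : ℕ → ℕ) (j t : ℕ) : Finset ℕ :=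
  {y ∈ Icc 1 j | ¬ Contracted cls deg P y ∧ cls y = t}

/-- The index of the lower endpoint of an edge in its class; the root has index `0`. -/
def lowerIndex (U V cls idx : ℕ → ℕ) (i : ℕ) : ℕ :=
  if cls (V i) = cls (U i) then idx (V i) else 0

/-- The edges below `j` in class `t` that are not contracted. -/
def classEdges (U V cls idx : ℕ → ℕ) (j t : ℕ) : Finset ℕ :=
  {i ∈ range j | cls (U i) = t ∧ idx (U i) ≠ lowerIndex U V cls idx i}

theorem update_succ (f : ℕ → ℕ) (u x : ℕ) :
    Function.update f u (f u + 1) x = f x + if u = x then 1 else 0 := by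
  by_cases h : x = u
  · subst h; simp
  · simp [h, Ne.symm h]

theorem degProg_spec {w B n m : ℕ} (hB : B ≤ 2 ^ w) (hX : (n + m + 2) ^ 4 ≤ B) {s : State}
    (hm : s.reg 1 = m) (hz : ∀ v, s.arr 11 v = 0) :
    Ends w degProg s (fun t s' => t ≤ 100 * (n + m + 1) ∧
      ∀ x, s'.arr 11 x = classDegree m (s.arr 20) (s.arr 21) (s.arr 10) x) := by
  have hS := small_lt hX
  have h1 : 1 < B := by omega
  have h0 : 0 < B := by omega
  apply Ends.of_wp hB h1
  simp [degProg, wp, Expr.ok, Expr.val, Expr.cost, h0]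
  obtain ⟨Inv, hInv⟩ : ∃ Inv : ℕ → State → Prop, ∀ j s', Inv j s' ↔ s'.reg 3 = j ∧
      ∀ x, s'.arr 11 x = classDegree j (s.arr 20) (s.arr 21) (s.arr 10) x :=
    ⟨_, fun _ _ => Iff.rfl⟩
  apply Ends.mono (Ends.for_const hB h1 Inv 60 (Nat.zero_le m) ?_ ?_ ?_)
  · rintro t s' - ⟨ht, h⟩
    simp [Expr.cost] at ht
    exact ⟨by omega, ((hInv _ _).1 h).2⟩
  · rw [hInv]
    simp [State.setReg_reg, State.setReg_arr, hz, classDegree]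
  · intro j s' _ hj hf hI
    rw [hInv] at hI
    obtain ⟨h3, hI⟩ := hI
    have hr1 : s'.reg 1 = m := (hf.1 1 (by decide)).trans (by simpa [State.setReg_reg] using hm)
    have ha10 : s'.arr 10 = s.arr 10 := hf.2 10 (by decide)
    have ha20 : s'.arr 20 = s.arr 20 := hf.2 20 (by decide)
    have ha21 : s'.arr 21 = s.arr 21 := hf.2 21 (by decide)
    have hle : ∀ x, s'.arr 11 x ≤ j * 2 := by
      intro x
      rw [hI, classDegree]
      refine (sum_le_card_nsmul _ _ 2 fun i _ => ?_).trans (by simp)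
      split_ifs <;> omega
    simp only [wp, Expr.ok, Expr.val, Expr.cost, State.setReg_reg, State.setReg_arr,
      State.setArr_reg, State.setArr_arr, hInv]
    simp only [Nat.reduceEqDiff, reduceIte, hr1, ha10, ha20, ha21, h3, h1, hj, true_and,
      ne_eq, ite_eq_right_iff, one_ne_zero, imp_false, not_not, not_false_eq_true]
    have hle1 := hle (s.arr 20 j)
    have hle2 := hle (s.arr 21 j)
    refine ⟨by omega, fun h => ⟨?_, by omega, by omega, fun x => ?_⟩,
      fun h => ⟨by omega, by omega, fun x => ?_⟩⟩
    · rw [Function.update_apply]; split_ifs <;> omega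
    · have := hI x
      simp only [classDegree, sum_range_succ] at this ⊢
      rw [update_succ, update_succ, this, add_assoc]
      simp only [h, and_true]
    · have := hI x
      simp only [classDegree, sum_range_succ] at this ⊢
      rw [update_succ, this]
      simp only [h, and_false, reduceIte, add_zero]
  · intro s' hf hI
    rw [hInv] at hI
    have hr1 : s'.reg 1 = m := (hf.1 1 (by decide)).trans (by simpa [State.setReg_reg] using hm)
    simp [Expr.ok, Expr.val, hI.1, hr1]

theorem remaining_succ {cls deg P : ℕ → ℕ} {j t : ℕ} :
    (¬ Contracted cls deg P (j + 1) ∧ cls (j + 1) = t →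
      #(remaining cls deg P (j + 1) t) = #(remaining cls deg P j t) + 1) ∧
    (¬ (¬ Contracted cls deg P (j + 1) ∧ cls (j + 1) = t) →
      remaining cls deg P (j + 1) t = remaining cls deg P j t) := by
  classical
  have : Icc 1 (j + 1) = insert (j + 1) (Icc 1 j) := by
    ext; simp; omega
  constructor
  · intro h
    rw [remaining, remaining, this, filter_insert, if_pos h, card_insert_of_notMem (by simp)]
  · intro h
    rw [remaining, remaining, this, filter_insert, if_neg h]

theorem card_remaining_le {cls deg P : ℕ → ℕ} (j t : ℕ) : #(remaining cls deg P j t) ≤ j := by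
  classical
  exact (card_filter_le _ _).trans (by simp)

theorem indexProg_spec {w B n m : ℕ} (hB : B ≤ 2 ^ w) (hX : (n + m + 2) ^ 4 ≤ B) {s : State}
    (hn : s.reg 0 = n) (hP : ∀ x, 1 ≤ x → x ≤ n → s.arr 6 x < x) (hz : ∀ v, s.arr 13 v = 0) :
    Ends w indexProg s (fun t s' => t ≤ 100 * (n + m + 1) ∧
      (∀ t, s'.arr 13 t = #(remaining (s.arr 10) (s.arr 11) (s.arr 6) n t)) ∧
      ∀ x, 1 ≤ x → x ≤ n →
        (Contracted (s.arr 10) (s.arr 11) (s.arr 6) x → s'.arr 12 x = s'.arr 12 (s.arr 6 x)) ∧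
        (¬ Contracted (s.arr 10) (s.arr 11) (s.arr 6) x →
          s'.arr 12 x = #(remaining (s.arr 10) (s.arr 11) (s.arr 6) x (s.arr 10 x)))) := by
  have hS := small_lt hX
  have h1 : 1 < B := by omega
  have h0 : 0 < B := by omega
  have h33 : 3 < B := by omega
  apply Ends.of_wp hB h1
  simp [indexProg, wp, Expr.ok, Expr.val, Expr.cost, h0]
  obtain ⟨Inv, hInv⟩ : ∃ Inv : ℕ → State → Prop, ∀ j s', Inv j s' ↔ s'.reg 3 = j ∧
      (∀ t, s'.arr 13 t = #(remaining (s.arr 10) (s.arr 11) (s.arr 6) j t)) ∧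
      ∀ x, 1 ≤ x → x ≤ j →
        (Contracted (s.arr 10) (s.arr 11) (s.arr 6) x → s'.arr 12 x = s'.arr 12 (s.arr 6 x)) ∧
        (¬ Contracted (s.arr 10) (s.arr 11) (s.arr 6) x →
          s'.arr 12 x = #(remaining (s.arr 10) (s.arr 11) (s.arr 6) x (s.arr 10 x))) :=
    ⟨_, fun _ _ => Iff.rfl⟩
  apply Ends.mono (Ends.for_const hB h1 Inv 60 (Nat.zero_le n) ?_ ?_ ?_)
  · rintro t s' - ⟨ht, h⟩
    simp [Expr.cost] at ht
    exact ⟨by omega, ((hInv _ _).1 h).2⟩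
  · rw [hInv]
    refine ⟨by simp [State.setReg_reg], fun t => ?_, fun x _ _ => by omega⟩
    simp [State.setReg_arr, hz, remaining]
  · intro j s' _ hj hf hI
    rw [hInv] at hI
    obtain ⟨h3, hI, hI'⟩ := hI
    have hr0 : s'.reg 0 = n := (hf.1 0 (by decide)).trans (by simpa [State.setReg_reg] using hn)
    have ha6 : s'.arr 6 = s.arr 6 := hf.2 6 (by decide)
    have ha10 : s'.arr 10 = s.arr 10 := hf.2 10 (by decide)
    have ha11 : s'.arr 11 = s.arr 11 := hf.2 11 (by decide)
    have hlt : s.arr 6 (j + 1) < j + 1 := hP _ (by omega) (by omega)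
    have hle : s'.arr 13 (s.arr 10 (j + 1)) ≤ j := by
      rw [hI]; exact card_remaining_le _ _
    simp only [wp, Expr.ok, Expr.val, Expr.cost, State.setReg_reg, State.setReg_arr,
      State.setArr_reg, State.setArr_arr, hInv]
    simp only [Nat.reduceEqDiff, reduceIte, hr0, ha6, ha10, ha11, h3, h1, h33, hj, true_and,
      ne_eq, ite_eq_right_iff, one_ne_zero, imp_false, not_not, not_false_eq_true, mul_eq_zero]
    have kept : ¬ Contracted (s.arr 10) (s.arr 11) (s.arr 6) (j + 1) → ∀ l' c' : ℕ → ℕ,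
        c' = Function.update (s'.arr 13) (s.arr 10 (j + 1)) (s'.arr 13 (s.arr 10 (j + 1)) + 1) →
        l' = Function.update (s'.arr 12) (j + 1) (s'.arr 13 (s.arr 10 (j + 1)) + 1) →
        (∀ t, c' t = #(remaining (s.arr 10) (s.arr 11) (s.arr 6) (j + 1) t)) ∧
        ∀ x, 1 ≤ x → x ≤ j + 1 →
        (Contracted (s.arr 10) (s.arr 11) (s.arr 6) x → l' x = l' (s.arr 6 x)) ∧
        (¬ Contracted (s.arr 10) (s.arr 11) (s.arr 6) x →
          l' x = #(remaining (s.arr 10) (s.arr 11) (s.arr 6) x (s.arr 10 x))) := by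
      rintro hc _ _ rfl rfl
      refine ⟨fun t => ?_, fun x hx hxj => ?_⟩
      · rw [Function.update_apply]
        split_ifs with ht
        · rw [(remaining_succ).1 ⟨hc, ht.symm⟩, hI, ht]
        · rw [(remaining_succ).2 (by rintro ⟨_, h⟩; exact ht h.symm), hI]
      · have := hP x hx (by omega)
        rw [Function.update_of_ne (a := s.arr 6 x) (by omega)]
        by_cases hxj' : x = j + 1
        · subst hxj'
          refine ⟨fun h => absurd h hc, fun _ => ?_⟩
          rw [Function.update_self, (remaining_succ).1 ⟨hc, rfl⟩, hI]
        · rw [Function.update_of_ne hxj']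
          exact hI' x hx (by omega)
    refine ⟨by omega, fun h => ⟨by omega, by omega, ?_⟩, fun h => ⟨by split_ifs <;> omega,
      fun h' => ⟨by omega, ?_⟩, fun h' => ⟨by omega, by omega, ?_⟩⟩⟩
    · exact kept (fun hc => hc.1 h) _ _ rfl (by simp)
    · rw [not_or, not_not, not_not] at h'
      have hc : Contracted (s.arr 10) (s.arr 11) (s.arr 6) (j + 1) := ⟨h, h'⟩
      refine ⟨fun t => ?_, fun x hx hxj => ?_⟩
      · rw [(remaining_succ).2 (by simp [hc]), hI]
      · have := hP x hx (by omega)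
        rw [Function.update_of_ne (a := s.arr 6 x) (by omega)]
        by_cases hxj' : x = j + 1
        · subst hxj'
          exact ⟨fun _ => by simp, fun h => absurd hc h⟩
        · rw [Function.update_of_ne hxj']
          exact hI' x hx (by omega)
    · exact kept (fun hc => by simp [hc.2.1, hc.2.2] at h') _ _ rfl (by simp)
  · intro s' hf hI
    rw [hInv] at hI
    have hr0 : s'.reg 0 = n := (hf.1 0 (by decide)).trans (by simpa [State.setReg_reg] using hn)
    simp [Expr.ok, Expr.val, hI.1, hr0]

/-- Row length and image together say that each edge of the class is listed exactly once;
`cost_image` uses them in this form. -/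
theorem bucketProg_spec {w B n m : ℕ} (hB : B ≤ 2 ^ w) (hX : (n + m + 2) ^ 4 ≤ B) {s : State}
    (hm : s.reg 1 = m) (hc : ∀ i < m, s.arr 10 (s.arr 20 i) ≤ n) (hz : ∀ v, s.arr 17 v = 0) :
    Ends w bucketProg s (fun t s' => t ≤ 100 * (n + m + 1) ∧
      (∀ i < m, s'.arr 14 i = s.arr 12 (s.arr 20 i)) ∧
      (∀ i < m, s'.arr 15 i = lowerIndex (s.arr 20) (s.arr 21) (s.arr 10) (s.arr 12) i) ∧
      ∀ t ≤ n, s'.arr 17 t = #(classEdges (s.arr 20) (s.arr 21) (s.arr 10) (s.arr 12) m t) ∧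
        (range (s'.arr 17 t)).image (fun q => s'.arr 16 (t * m + q)) =
          classEdges (s.arr 20) (s.arr 21) (s.arr 10) (s.arr 12) m t) := by
  have hS := small_lt hX
  have h1 : 1 < B := by omega
  have h0 : 0 < B := by omega
  apply Ends.of_wp hB h1
  simp [bucketProg, wp, Expr.ok, Expr.val, Expr.cost, h0]
  obtain ⟨E, hE⟩ : ∃ E, E = classEdges (s.arr 20) (s.arr 21) (s.arr 10) (s.arr 12) := ⟨_, rfl⟩
  obtain ⟨L, hL⟩ : ∃ L, L = lowerIndex (s.arr 20) (s.arr 21) (s.arr 10) (s.arr 12) := ⟨_, rfl⟩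
  have hEc : ∀ j t, #(E j t) ≤ j := fun j t => by
    rw [hE]; exact (card_filter_le _ _).trans (by simp)
  have hEs : ∀ j t, E (j + 1) t = if s.arr 10 (s.arr 20 j) = t ∧ s.arr 12 (s.arr 20 j) ≠ L j
      then insert j (E j t) else E j t := fun j t => by
    rw [hE, hL, classEdges, classEdges, range_add_one, filter_insert]
  have hEn : ∀ j t, j ∉ E j t := fun j t => by
    rw [hE]; simp [classEdges]
  obtain ⟨Inv, hInv⟩ : ∃ Inv : ℕ → State → Prop, ∀ j s', Inv j s' ↔ s'.reg 3 = j ∧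
      (∀ i < j, s'.arr 14 i = s.arr 12 (s.arr 20 i)) ∧
      (∀ i < j, s'.arr 15 i = L i) ∧
      ∀ t ≤ n, s'.arr 17 t = #(E j t) ∧
        (range (s'.arr 17 t)).image (fun q => s'.arr 16 (t * m + q)) = E j t :=
    ⟨_, fun _ _ => Iff.rfl⟩
  rw [← hE, ← hL]
  apply Ends.mono (Ends.for_const hB h1 Inv 60 (Nat.zero_le m) ?_ ?_ ?_)
  · rintro t s' - ⟨ht, h⟩
    simp [Expr.cost] at ht
    exact ⟨by omega, ((hInv _ _).1 h).2⟩
  · rw [hInv]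
    simp [State.setReg_reg, State.setReg_arr, hz, hE, classEdges]
  · intro j s' _ hj hf hI
    rw [hInv] at hI
    obtain ⟨h3, hI1, hI2, hI3⟩ := hI
    have hr1 : s'.reg 1 = m := (hf.1 1 (by decide)).trans (by simpa [State.setReg_reg] using hm)
    have ha10 : s'.arr 10 = s.arr 10 := hf.2 10 (by decide)
    have ha12 : s'.arr 12 = s.arr 12 := hf.2 12 (by decide)
    have ha20 : s'.arr 20 = s.arr 20 := hf.2 20 (by decide)
    have ha21 : s'.arr 21 = s.arr 21 := hf.2 21 (by decide)
    have hcj := hc j hj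
    have hq : s'.arr 17 (s.arr 10 (s.arr 20 j)) ≤ j := by
      rw [(hI3 _ hcj).1]; exact hEc _ _
    have haddr := addr_lt hX hcj (show m ≤ 2 * m + n by omega) (hq.trans hj.le)
    simp only [wp, Expr.ok, Expr.val, Expr.cost, State.setReg_reg, State.setReg_arr,
      State.setArr_reg, State.setArr_arr, hInv]
    simp only [Nat.reduceEqDiff, reduceIte, hr1, ha10, ha12, ha20, ha21, h3, h0, h1, hj, true_and,
      ne_eq, ite_eq_right_iff, one_ne_zero, imp_false, not_not, not_false_eq_true]
    have arrs : ∀ v, v = L j →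
        (∀ i < j + 1, Function.update (s'.arr 14) j (s.arr 12 (s.arr 20 j)) i =
          s.arr 12 (s.arr 20 i)) ∧
        (∀ i < j + 1, Function.update (s'.arr 15) j v i = L i) := by
      rintro _ rfl
      constructor <;> intro i hi <;> by_cases hij : i = j
      · subst hij; simp
      · rw [Function.update_of_ne hij]; exact hI1 i (by omega)
      · subst hij; simp
      · rw [Function.update_of_ne hij]; exact hI2 i (by omega)
    have skip : s.arr 12 (s.arr 20 j) = L j → ∀ t ≤ n, s'.arr 17 t = #(E (j + 1) t) ∧
        (range (s'.arr 17 t)).image (fun q => s'.arr 16 (t * m + q)) = E (j + 1) t := by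
      intro h t ht
      rw [hEs, if_neg (by simp [h])]
      exact hI3 t ht
    have app : s.arr 12 (s.arr 20 j) ≠ L j → ∀ c r : ℕ → ℕ,
        c = Function.update (s'.arr 17) (s.arr 10 (s.arr 20 j))
          (s'.arr 17 (s.arr 10 (s.arr 20 j)) + 1) →
        r = Function.update (s'.arr 16) (s.arr 10 (s.arr 20 j) * m +
          s'.arr 17 (s.arr 10 (s.arr 20 j))) j → ∀ t ≤ n, c t = #(E (j + 1) t) ∧
        (range (c t)).image (fun q => r (t * m + q)) = E (j + 1) t := by
      rintro h _ _ rfl rfl t ht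
      obtain ⟨h4, h5⟩ := hI3 t ht
      have hold : ∀ q < s'.arr 17 t, Function.update (s'.arr 16) (s.arr 10 (s.arr 20 j) * m +
          s'.arr 17 (s.arr 10 (s.arr 20 j))) j (t * m + q) = s'.arr 16 (t * m + q) := by
        intro q hq'
        rw [Function.update_of_ne]
        intro he
        have := hEc j t
        obtain ⟨rfl, rfl⟩ := row_inj (by omega) (by omega) he
        omega
      by_cases htc : s.arr 10 (s.arr 20 j) = t
      · rw [hEs, if_pos ⟨htc, h⟩, card_insert_of_notMem (hEn _ _), ← h4, ← h5, htc,
          Function.update_self]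
        refine ⟨rfl, ?_⟩
        rw [range_add_one, image_insert, Function.update_self]
        congr 1
        exact image_congr fun q hq' => htc ▸ hold q (by simpa using hq')
      · rw [hEs, if_neg (by simp [htc]), Function.update_of_ne (Ne.symm htc)]
        refine ⟨h4, ?_⟩
        rw [← h5]
        exact image_congr fun q hq' => hold q (by simpa using hq')
    have hL1 : s.arr 10 (s.arr 21 j) = s.arr 10 (s.arr 20 j) → L j = s.arr 12 (s.arr 21 j) :=
      fun h => by rw [hL, lowerIndex, if_pos h]
    have hL2 : s.arr 10 (s.arr 21 j) ≠ s.arr 10 (s.arr 20 j) → L j = 0 :=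
      fun h => by rw [hL, lowerIndex, if_neg h]
    refine ⟨fun h => ⟨fun h' => ?_, fun h' => ?_⟩, fun h => ⟨fun h' => ?_, fun h' => ?_⟩⟩
    · rw [← hL1 h] at h' ⊢
      exact ⟨by omega, by omega, (arrs _ rfl).1, (arrs _ rfl).2, skip h'⟩
    · rw [← hL1 h] at h' ⊢
      exact ⟨⟨by omega, haddr⟩, by omega, by omega, by omega, (arrs _ rfl).1, (arrs _ rfl).2,
        app h' _ _ rfl rfl⟩
    · rw [← hL2 h] at h' ⊢
      exact ⟨by omega, by omega, (arrs _ rfl).1, (arrs _ rfl).2, skip h'⟩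
    · rw [← hL2 h] at h' ⊢
      exact ⟨⟨by omega, haddr⟩, by omega, by omega, by omega, (arrs _ rfl).1, (arrs _ rfl).2,
        app h' _ _ rfl rfl⟩
  · intro s' hf hI
    rw [hInv] at hI
    have hr1 : s'.reg 1 = m := (hf.1 1 (by decide)).trans (by simpa [State.setReg_reg] using hm)
    simp [Expr.ok, Expr.val, hI.1, hr1]

end OnePage

namespace OnePage

open Finset WordRAM WordRAM.Expr

/-! ### Costs of drawings -/

/-- `1` if `x < y`, and `0` otherwise. -/
def ltNat (x y : ℕ) : ℕ := if x < y then 1 else 0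

/-- `1` if the arc between `a` and `b` crosses the arc between `c` and `d` and starts further left,
and `0` otherwise. -/
def cross (a b c d : ℕ) : ℕ :=
  ltNat a c * ltNat c b * ltNat b d + ltNat a d * ltNat d b * ltNat b c +
    (ltNat b c * ltNat c a * ltNat a d + ltNat b d * ltNat d a * ltNat a c)

theorem ltNat_mul (a b c d : ℕ) :
    ltNat a b * ltNat b c * ltNat c d = if a < b ∧ b < c ∧ c < d then 1 else 0 := by
  unfold ltNat
  by_cases h1 : a < b <;> by_cases h2 : b < c <;> by_cases h3 : c < d <;> simp [h1, h2, h3]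

theorem cross_eq (a b c d : ℕ) : cross a b c d =
    if (a < c ∧ c < b ∧ b < d) ∨ (a < d ∧ d < b ∧ b < c) ∨ (b < c ∧ c < a ∧ a < d) ∨
      (b < d ∧ d < a ∧ a < c) then 1 else 0 := by
  simp only [cross, ltNat_mul]
  split_ifs <;> omega

theorem cross_le (a b c d : ℕ) : cross a b c d ≤ 1 := by
  rw [cross_eq]
  split_ifs <;> omega

/-- The contribution of a pair of edges: for `k = false` we count crossings and for `k = true`
crossed edges. -/
def pairCost (k : Bool) (a b c d : ℕ) : ℕ :=
  if k then cross a b c d + cross c d a b else cross a b c d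

/-- The contribution of an edge. -/
def edgeCost (k : Bool) (x : ℕ) : ℕ := if k then ltNat 0 x else x

theorem pairCost_le (k : Bool) (a b c d : ℕ) : pairCost k a b c d ≤ 2 := by
  have := cross_le a b c d
  have := cross_le c d a b
  unfold pairCost; split_ifs <;> omega

theorem edgeCost_le (k : Bool) (x : ℕ) : edgeCost k x ≤ x := by
  unfold edgeCost ltNat; split_ifs <;> omega

/-- The number of crossings (`k = false`) or of crossed edges (`k = true`) if the edge `i ∈ S` is
drawn as an arc from `U i` to `V i`. -/
def cost (k : Bool) (S : Finset ℕ) (U V : ℕ → ℕ) : ℕ :=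
  ∑ i ∈ S, edgeCost k (∑ j ∈ S, pairCost k (U i) (V i) (U j) (V j))

/-! ### Permutations -/

/-- The `i`-th digit of `x` in the factorial number system. -/
def digit (x i : ℕ) : ℕ := x / i.factorial % (i + 1)

/-- Insert `0, …, i - 1` into a line one after the other, `j` at position `d j`; the result is the
map from elements to positions. -/
def insertPos (d : ℕ → ℕ) : ℕ → ℕ → ℕ
  | 0, _ => 0
  | i + 1, j => if j = i then d i else insertPos d i j + if insertPos d i j < d i then 0 else 1

theorem digit_le (x i : ℕ) : digit x i ≤ i :=
  Nat.lt_succ_iff.1 (Nat.mod_lt _ (Nat.succ_pos i))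

theorem digit_zero (i : ℕ) : digit 0 i = 0 := by simp [digit]

theorem insertPos_lt {d : ℕ → ℕ} {i : ℕ} (hd : ∀ j < i, d j ≤ j) {j : ℕ} (hj : j < i) :
    insertPos d i j < i := by
  induction i generalizing j with
  | zero => omega
  | succ i ih =>
    rw [insertPos]
    split_ifs with h
    · have := hd i (by omega); omega
    · have := ih (fun j hj => hd j (by omega)) (j := j) (by omega); omega
    · have := ih (fun j hj => hd j (by omega)) (j := j) (by omega); omega

theorem insertPos_congr {d d' : ℕ → ℕ} {i : ℕ} (hd : ∀ j < i, d j = d' j) (j : ℕ) :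
    insertPos d i j = insertPos d' i j := by
  induction i generalizing j with
  | zero => rfl
  | succ i ih =>
    rw [insertPos, insertPos, hd i (by omega), ih (fun j hj => hd j (by omega))]

/-- Inductively `x + 1 = j! * q`, so `x / j! = q - 1`; if its remainder modulo `j + 1` is maximal,
then `j + 1` divides `q`. -/
theorem factorial_dvd_of_digits {x j : ℕ} (h : ∀ i < j, digit x i = i) :
    j.factorial ∣ x + 1 := by
  induction j with
  | zero => simp
  | succ j ih =>
    obtain ⟨q, hq⟩ := ih fun i hi => h i (by omega)
    have hj := h j (by omega)
    have hpos := Nat.factorial_pos j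
    have hq0 : q ≠ 0 := by rintro rfl; simp at hq
    have hx : x / j.factorial = q - 1 := by
      obtain ⟨q, rfl⟩ := Nat.exists_eq_succ_of_ne_zero hq0
      rw [Nat.succ_eq_add_one] at *
      have : x = (j.factorial - 1) + j.factorial * q := by
        have : j.factorial * (q + 1) = j.factorial * q + j.factorial := by ring
        rw [← hq] at this
        omega
      rw [this, Nat.add_mul_div_left _ _ hpos, Nat.div_eq_of_lt (by omega)]
      simp
    rw [digit, hx] at hj
    have h1 : (j + 1) ∣ q := by
      have := Nat.div_add_mod (q - 1) (j + 1)
      rw [hj] at this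
      refine ⟨(q - 1) / (j + 1) + 1, ?_⟩
      rw [mul_add]
      omega
    obtain ⟨r, rfl⟩ := h1
    exact ⟨r, by rw [hq, Nat.factorial_succ]; ring⟩

theorem digit_of_dvd {x i j : ℕ} (h : j.factorial ∣ x) (hi : i < j) : digit x i = 0 := by
  have h1 : (i + 1).factorial ∣ x := (Nat.factorial_dvd_factorial hi).trans h
  obtain ⟨q, rfl⟩ := h1
  rw [digit, Nat.factorial_succ, show (i + 1) * i.factorial * q = i.factorial * ((i + 1) * q) by
    ring, Nat.mul_div_cancel_left _ (Nat.factorial_pos i)]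
  simp

theorem not_dvd_of_digit {x j : ℕ} (hj : digit x j ≠ j) : ¬ (j + 1).factorial ∣ x + 1 := by
  rintro ⟨q, hq⟩
  apply hj
  have hq0 : q ≠ 0 := by rintro rfl; simp at hq
  obtain ⟨q, rfl⟩ := Nat.exists_eq_succ_of_ne_zero hq0
  have hpos := Nat.factorial_pos j
  have : x = (j.factorial - 1) + j.factorial * (j + (j + 1) * q) := by
    have h1 : (j + 1).factorial * q.succ =
        j.factorial + j.factorial * (j + (j + 1) * q) := by
      rw [Nat.factorial_succ, Nat.succ_eq_add_one]; ring
    omega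
  rw [digit, this, Nat.add_mul_div_left _ _ hpos, Nat.div_eq_of_lt (by omega), zero_add,
    Nat.add_mul_mod_self_left, Nat.mod_eq_of_lt (by omega)]

/-- This is counting with a carry, which stops at the first digit `j` that is not maximal. -/
theorem digit_succ {x j : ℕ} (h : ∀ i < j, digit x i = i) (hj : digit x j ≠ j) (i : ℕ) :
    digit (x + 1) i = if i < j then 0 else if i = j then digit x j + 1 else digit x i := by
  have hd := factorial_dvd_of_digits h
  have hnd := not_dvd_of_digit hj
  split_ifs with h1 h2
  · exact digit_of_dvd hd h1
  · subst h2
    have hlt : x / i.factorial % (i + 1) + 1 < i + 1 := by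
      have := digit_le x i
      unfold digit at this hj
      omega
    rw [digit, digit, Nat.succ_div, if_pos hd, Nat.add_mod, Nat.mod_eq_of_lt (a := 1)]
    · exact Nat.mod_eq_of_lt hlt
    · omega
  · rw [digit, digit, Nat.succ_div, if_neg]
    · simp
    · exact fun h3 => hnd ((Nat.factorial_dvd_factorial (by omega)).trans h3)

/-! ### Enumeration of the drawings of a class -/

def crossExpr (a b c d : ℕ) : Expr :=
  (reg a <ₑ reg c) *ₑ (reg c <ₑ reg b) *ₑ (reg b <ₑ reg d) +ₑ
    (reg a <ₑ reg d) *ₑ (reg d <ₑ reg b) *ₑ (reg b <ₑ reg c) +ₑ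
    ((reg b <ₑ reg c) *ₑ (reg c <ₑ reg a) *ₑ (reg a <ₑ reg d) +ₑ
      (reg b <ₑ reg d) *ₑ (reg d <ₑ reg a) *ₑ (reg a <ₑ reg c))

theorem crossExpr_val (s : State) (a b c d : ℕ) :
    (crossExpr a b c d).val s = cross (s.reg a) (s.reg b) (s.reg c) (s.reg d) := rfl

theorem crossExpr_ok {B : ℕ} (hB : 4 < B) (s : State) (a b c d : ℕ) :
    (crossExpr a b c d).ok B s := by
  have h2 : ∀ x y z u : ℕ, (if x < y then 1 else 0) * (if z < u then 1 else 0) ≤ 1 := by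
    intro x y z u; split_ifs <;> simp
  have h3 : ∀ x y z u v t : ℕ, (if x < y then 1 else 0) * (if z < u then 1 else 0) *
      (if v < t then 1 else 0) ≤ 1 := by
    intro x y z u v t; split_ifs <;> simp
  simp only [crossExpr, Expr.ok, Expr.val]
  and_intros
  all_goals first
    | trivial
    | exact lt_of_le_of_lt (h2 _ _ _ _) (by omega)
    | exact lt_of_le_of_lt (h3 _ _ _ _ _ _) (by omega)
    | exact lt_of_le_of_lt (add_le_add (h3 _ _ _ _ _ _) (h3 _ _ _ _ _ _)) (by omega)
    | exact lt_of_le_of_lt (add_le_add (add_le_add (h3 _ _ _ _ _ _) (h3 _ _ _ _ _ _))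
        (add_le_add (h3 _ _ _ _ _ _) (h3 _ _ _ _ _ _))) (by omega)

def pairExpr (k : Bool) : Expr :=
  if k then crossExpr 14 15 16 17 +ₑ crossExpr 16 17 14 15 else crossExpr 14 15 16 17

theorem pairExpr_val (k : Bool) (s : State) : (pairExpr k).val s =
    pairCost k (s.reg 14) (s.reg 15) (s.reg 16) (s.reg 17) := by
  cases k <;> rfl

theorem pairExpr_ok {B : ℕ} (hB : 4 < B) (k : Bool) (s : State) : (pairExpr k).ok B s := by
  cases k
  · exact crossExpr_ok hB s _ _ _ _
  · refine ⟨crossExpr_ok hB s _ _ _ _, crossExpr_ok hB s _ _ _ _, ?_⟩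
    rw [crossExpr_val, crossExpr_val]
    have := cross_le (s.reg 14) (s.reg 15) (s.reg 16) (s.reg 17)
    have := cross_le (s.reg 16) (s.reg 17) (s.reg 14) (s.reg 15)
    omega

theorem pairExpr_cost (k : Bool) : (pairExpr k).cost ≤ 200 := by cases k <;> decide

def edgeExpr (k : Bool) : Expr := if k then const 0 <ₑ reg 18 else reg 18

theorem edgeExpr_val (k : Bool) (s : State) : (edgeExpr k).val s = edgeCost k (s.reg 18) := by
  cases k <;> rfl

theorem edgeExpr_ok {B : ℕ} (hB : 0 < B) (k : Bool) (s : State) : (edgeExpr k).ok B s := by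
  cases k
  · trivial
  · exact ⟨hB, trivial⟩

theorem edgeExpr_cost (k : Bool) : (edgeExpr k).cost ≤ 3 := by cases k <;> decide

def pairLoop (k : Bool) : Prog :=
  .loop (reg 13 <ₑ reg 11)
    (16 ≔ load 19 (load 14 (load 16 (reg 10 +ₑ reg 13))) ;;
     17 ≔ load 19 (load 15 (load 16 (reg 10 +ₑ reg 13))) ;;
     18 ≔ reg 18 +ₑ pairExpr k ;;
     13 ≔ reg 13 +ₑ const 1)

def costProg (k : Bool) : Prog :=
  19 ≔ const 0 ;;
  12 ≔ const 0 ;;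
  .loop (reg 12 <ₑ reg 11)
    (14 ≔ load 19 (load 14 (load 16 (reg 10 +ₑ reg 12))) ;;
     15 ≔ load 19 (load 15 (load 16 (reg 10 +ₑ reg 12))) ;;
     18 ≔ const 0 ;;
     13 ≔ const 0 ;;
     pairLoop k ;;
     19 ≔ reg 19 +ₑ edgeExpr k ;;
     12 ≔ reg 12 +ₑ const 1)

/-- Each ordered pair of edges adds at most `2` to a running total. -/
theorem sq_lt {n m B : ℕ} (hB : (n + m + 2) ^ 4 ≤ B) : 2 * (m * m) < B := by
  have h1 : m * m ≤ (n + m + 2) * (n + m + 2) := Nat.mul_le_mul (by omega) (by omega)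
  have h2 : 2 * 2 ≤ (n + m + 2) * (n + m + 2) := Nat.mul_le_mul (by omega) (by omega)
  have h3 : (n + m + 2) ^ 4 = (n + m + 2) * (n + m + 2) * ((n + m + 2) * (n + m + 2)) := by ring
  have h4 : (n + m + 2) * (n + m + 2) * (2 * 2) ≤
      (n + m + 2) * (n + m + 2) * ((n + m + 2) * (n + m + 2)) := Nat.mul_le_mul le_rfl h2
  omega

theorem pairLoop_spec {w B n m b M : ℕ} (hB : B ≤ 2 ^ w) (hX : (n + m + 2) ^ 4 ≤ B) (k : Bool)
    {s : State} (h11 : s.reg 11 = M) (hM : M ≤ m) (h10 : s.reg 10 = b) (hb : b ≤ n * m)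
    (h13 : s.reg 13 = 0) (h18 : s.reg 18 = 0) {U V : ℕ → ℕ}
    (hU : U = fun j => s.arr 19 (s.arr 14 (s.arr 16 (b + j))))
    (hV : V = fun j => s.arr 19 (s.arr 15 (s.arr 16 (b + j)))) :
    Ends w (pairLoop k) s (fun t s' => t ≤ 300 * (M + 1) ∧
      s'.reg 18 = ∑ j ∈ range M, pairCost k (s.reg 14) (s.reg 15) (U j) (V j)) := by
  have hS := small_lt hX
  have h1 : 1 < B := by omega
  have haddr := addr_lt hX (le_refl n) (show m ≤ 2 * m + n by omega) (show M ≤ m by omega)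
  obtain ⟨Inv, hInv⟩ : ∃ Inv : ℕ → State → Prop, ∀ j s', Inv j s' ↔ s'.reg 13 = j ∧
      s'.reg 18 = ∑ j ∈ range j, pairCost k (s.reg 14) (s.reg 15) (U j) (V j) :=
    ⟨_, fun _ _ => Iff.rfl⟩
  have hc := pairExpr_cost k
  apply Ends.mono (Ends.for_const hB h1 Inv 240 (Nat.zero_le M) ?_ ?_ ?_)
  · rintro t s' - ⟨ht, h⟩
    simp [Expr.cost] at ht
    exact ⟨by omega, ((hInv _ _).1 h).2⟩
  · rw [hInv]
    simp [h13, h18]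
  · intro j s' _ hj hf hI
    rw [hInv] at hI
    obtain ⟨h13, hI⟩ := hI
    have hr10 : s'.reg 10 = b := (hf.1 10 (by simp [Prog.regs])).trans h10
    have hr11 : s'.reg 11 = M := (hf.1 11 (by simp [Prog.regs])).trans h11
    have hr14 : s'.reg 14 = s.reg 14 := hf.1 14 (by simp [Prog.regs])
    have hr15 : s'.reg 15 = s.reg 15 := hf.1 15 (by simp [Prog.regs])
    have ha14 : s'.arr 14 = s.arr 14 := hf.2 14 (by simp [Prog.arrs])
    have ha15 : s'.arr 15 = s.arr 15 := hf.2 15 (by simp [Prog.arrs])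
    have ha16 : s'.arr 16 = s.arr 16 := hf.2 16 (by simp [Prog.arrs])
    have ha19 : s'.arr 19 = s.arr 19 := hf.2 19 (by simp [Prog.arrs])
    simp only [wp, Expr.ok, Expr.val, Expr.cost, State.setReg_reg, State.setReg_arr,
      hInv, pairExpr_val, pairExpr_ok (show 4 < B by omega)]
    simp only [Nat.reduceEqDiff, reduceIte, hr10, hr11, hr14, hr15, ha14, ha15, ha16, ha19, h13,
      h1, hj, true_and, ne_eq, one_ne_zero, not_false_eq_true]
    have hle : s'.reg 18 ≤ j * 2 := by
      rw [hI]
      exact (sum_le_card_nsmul _ _ 2 fun j _ => pairCost_le _ _ _ _ _).trans (by simp)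
    have hle' := pairCost_le k (s.reg 14) (s.reg 15) (s.arr 19 (s.arr 14 (s.arr 16 (b + j))))
      (s.arr 19 (s.arr 15 (s.arr 16 (b + j))))
    refine ⟨by omega, by omega, by omega, by omega, by omega, ?_⟩
    rw [sum_range_succ, ← hI, hU, hV]
  · intro s' hf hI
    rw [hInv] at hI
    have hr11 : s'.reg 11 = M := (hf.1 11 (by simp [Prog.regs])).trans h11
    simp [Expr.ok, Expr.val, hI.1, hr11]

theorem costProg_spec {w B n m b M : ℕ} (hB : B ≤ 2 ^ w) (hX : (n + m + 2) ^ 4 ≤ B) (k : Bool)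
    {s : State} (h11 : s.reg 11 = M) (hM : M ≤ m) (h10 : s.reg 10 = b) (hb : b ≤ n * m)
    {U V : ℕ → ℕ} (hU : U = fun j => s.arr 19 (s.arr 14 (s.arr 16 (b + j))))
    (hV : V = fun j => s.arr 19 (s.arr 15 (s.arr 16 (b + j)))) :
    Ends w (costProg k) s (fun t s' => t ≤ 400 * (M + 1) * (M + 1) ∧
      s'.reg 19 = cost k (range M) U V) := by
  have hS := small_lt hX
  have h1 : 1 < B := by omega
  have h0 : 0 < B := by omega
  have haddr := addr_lt hX (le_refl n) (show m ≤ 2 * m + n by omega) (show M ≤ m by omega)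
  apply Ends.of_wp hB h1
  simp [costProg, wp, Expr.ok, Expr.val, Expr.cost, h0]
  obtain ⟨Inv, hInv⟩ : ∃ Inv : ℕ → State → Prop, ∀ j s', Inv j s' ↔ s'.reg 12 = j ∧
      s'.reg 19 = ∑ i ∈ range j, edgeCost k (∑ j ∈ range M, pairCost k (U i) (V i) (U j) (V j)) :=
    ⟨_, fun _ _ => Iff.rfl⟩
  have hc := edgeExpr_cost k
  apply Ends.mono (Ends.for_const hB h1 Inv (300 * (M + 1) + 50) (Nat.zero_le M) ?_ ?_ ?_)
  · rintro t s' - ⟨ht, h⟩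
    simp [Expr.cost] at ht
    exact ⟨by linarith [Nat.zero_le (M * M)], ((hInv _ _).1 h).2⟩
  · rw [hInv]
    simp [State.setReg_reg]
  · intro j s' _ hj hf hI
    rw [hInv] at hI
    obtain ⟨h12, hI⟩ := hI
    have hr10 : s'.reg 10 = b := (hf.1 10 (by simp [Prog.regs, pairLoop])).trans h10
    have hr11 : s'.reg 11 = M := (hf.1 11 (by simp [Prog.regs, pairLoop])).trans h11
    have ha14 : s'.arr 14 = s.arr 14 := hf.2 14 (by simp [Prog.arrs, pairLoop])
    have ha15 : s'.arr 15 = s.arr 15 := hf.2 15 (by simp [Prog.arrs, pairLoop])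
    have ha16 : s'.arr 16 = s.arr 16 := hf.2 16 (by simp [Prog.arrs, pairLoop])
    have ha19 : s'.arr 19 = s.arr 19 := hf.2 19 (by simp [Prog.arrs, pairLoop])
    have hr12 : (12 : ℕ) ∉ (pairLoop k).regs := by simp [Prog.regs, pairLoop]
    have hr19 : (19 : ℕ) ∉ (pairLoop k).regs := by simp [Prog.regs, pairLoop]
    simp only [wp, Expr.ok, Expr.val, Expr.cost, State.setReg_reg, State.setReg_arr
      ]
    simp only [Nat.reduceEqDiff, reduceIte, hr10, hr11, h12, ha14, ha15, ha16, ha19,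
      h1, h0, hj, true_and, ne_eq, one_ne_zero, not_false_eq_true]
    refine ⟨by omega, by omega, ?_⟩
    -- A loop is opaque to `wp`; this exposes the `Ends` statement to which the specification of the
    -- inner loop applies.
    rw [show wp w B (pairLoop k) = fun Q s => Ends w (pairLoop k) s Q from rfl]
    apply Ends.mono (pairLoop_spec hB hX k (n := n) (m := m) (b := b) (M := M) (U := U) (V := V)
      ?_ hM ?_ hb ?_ ?_ ?_ ?_)
    · rintro t s'' hf' ⟨ht, h18⟩
      have h12' := hf'.1 12 hr12
      have h19' := hf'.1 19 hr19
      simp only [State.setReg_reg, Nat.reduceEqDiff, reduceIte] at h12' h19' h18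
      have hUV : s''.reg 18 = ∑ x ∈ range M, pairCost k (U j) (V j) (U x) (V x) := by
        rw [h18, hU, hV]
      simp only [edgeExpr_val, edgeExpr_ok h0, hInv, State.setReg_reg, Nat.reduceEqDiff, reduceIte,
        h12', h19', h12, true_and]
      have hle : s''.reg 18 ≤ M * 2 := by
        rw [h18]
        exact (sum_le_card_nsmul _ _ 2 fun j _ => pairCost_le _ _ _ _ _).trans (by simp)
      have hle2 := edgeCost_le k (s''.reg 18)
      have hle3 : s'.reg 19 ≤ j * (M * 2) := by
        rw [hI]
        refine (sum_le_card_nsmul _ _ (M * 2) fun i _ => (edgeCost_le _ _).trans ?_).trans (by simp)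
        exact (sum_le_card_nsmul _ _ 2 fun j _ => pairCost_le _ _ _ _ _).trans (by simp)
      have hle4 : s'.reg 19 + edgeCost k (s''.reg 18) < B := by
        have h5 : (j + 1) * (M * 2) ≤ m * (m * 2) := Nat.mul_le_mul (by omega) (by omega)
        have h6 := sq_lt hX
        rw [add_mul] at h5
        have h7 : m * (m * 2) = 2 * (m * m) := by ring
        omega
      refine ⟨hle4, by omega, by omega, ?_⟩
      rw [sum_range_succ, ← hI, hUV]
    all_goals simp only [State.setReg_reg, State.setReg_arr, Nat.reduceEqDiff, reduceIte, hr10,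
      hr11, ha14, ha15, ha16, ha19, hU, hV]
  · intro s' hf hI
    rw [hInv] at hI
    have hr11 : s'.reg 11 = M := (hf.1 11 (by simp [Prog.regs, pairLoop])).trans h11
    simp [Expr.ok, Expr.val, hI.1, hr11]

end OnePage

/-! ### Programs that run through all orders of a block and through all blocks -/

namespace OnePage

open Finset WordRAM WordRAM.Expr

def shiftLoop : Prog :=
  .loop (reg 13 <ₑ reg 12)
    (.branch (load 19 (reg 13) <ₑ reg 14) .skip
      (.store 19 (reg 13) (load 19 (reg 13) +ₑ const 1)) ;;
     13 ≔ reg 13 +ₑ const 1)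

def insertProg : Prog :=
  12 ≔ const 0 ;;
  .loop (reg 12 <ₑ reg 20)
    (14 ≔ load 18 (reg 12) ;;
     13 ≔ const 0 ;;
     shiftLoop ;;
     .store 19 (reg 12) (reg 14) ;;
     12 ≔ reg 12 +ₑ const 1)

/-- This increments a counter in the factorial number system: low maximal digits become `0` and the
next digit grows. If all digits are maximal, the enumeration is over and the flag in register `8` is
cleared. -/
def countProg : Prog :=
  13 ≔ const 0 ;;
  .loop ((reg 13 <ₑ reg 20) *ₑ (load 18 (reg 13) =ₑ reg 13))
    (.store 18 (reg 13) (const 0) ;; 13 ≔ reg 13 +ₑ const 1) ;;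
  .branch (reg 13 <ₑ reg 20) (.store 18 (reg 13) (load 18 (reg 13) +ₑ const 1)) (8 ≔ const 0)

def enumBody (k : Bool) : Prog :=
  insertProg ;; costProg k ;; .branch (reg 19 <ₑ reg 21) (21 ≔ reg 19) .skip ;; countProg

/-- The start value `m * m` serves as infinity: by `cost_le_sq` no drawing costs more. -/
def enumProg (k : Bool) : Prog :=
  (21 ≔ reg 1 *ₑ reg 1 ;; 8 ≔ const 1) ;; .loop (reg 8) (enumBody k)

/-- The extra vertex is the parent of the top vertex, with index `0`. Numbers that are not the top
of a block are treated alike: their classes are empty, and a single order is tried. -/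
def sumBody (k : Bool) : Prog :=
  (9 ≔ reg 9 +ₑ const 1 ;;
   20 ≔ load 13 (reg 9) +ₑ const 1 ;;
   11 ≔ load 17 (reg 9) ;;
   10 ≔ reg 9 *ₑ reg 1) ;;
  enumProg k ;;
  22 ≔ reg 22 +ₑ reg 21

def sumProg (k : Bool) : Prog :=
  (9 ≔ const 0 ;; 22 ≔ const 0) ;; .loop (reg 9 <ₑ reg 0) (sumBody k) ;; 0 ≔ reg 22

theorem shiftLoop_spec {w B i : ℕ} (hB : B ≤ 2 ^ w) {s : State}
    (h12 : s.reg 12 = i) (h13 : s.reg 13 = 0) (hi : i + 1 < B)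
    (hp : ∀ j < i, s.arr 19 j + 1 < B) :
    Ends w shiftLoop s (fun t s' => t ≤ 30 * (i + 1) ∧
      (∀ j, s'.arr 19 j =
        if j < i then s.arr 19 j + if s.arr 19 j < s.reg 14 then 0 else 1 else s.arr 19 j)) := by
  have h1 : 1 < B := by omega
  obtain ⟨Inv, hInv⟩ : ∃ Inv : ℕ → State → Prop, ∀ l s', Inv l s' ↔ s'.reg 13 = l ∧
      (∀ j, s'.arr 19 j =
        if j < l then s.arr 19 j + if s.arr 19 j < s.reg 14 then 0 else 1 else s.arr 19 j) :=
    ⟨_, fun _ _ => Iff.rfl⟩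
  apply Ends.mono (Ends.for_const hB h1 Inv 25 (Nat.zero_le i) ?_ ?_ ?_)
  · rintro t s' - ⟨ht, h⟩
    simp [Expr.cost] at ht
    exact ⟨by omega, ((hInv _ _).1 h).2⟩
  · rw [hInv]
    simp [h13]
  · intro l s' _ hl hf hI
    rw [hInv] at hI
    obtain ⟨h13, hI⟩ := hI
    have hr12 : s'.reg 12 = i := (hf.1 12 (by decide)).trans h12
    have hr14 : s'.reg 14 = s.reg 14 := hf.1 14 (by decide)
    have hl19 : s'.arr 19 l = s.arr 19 l := by rw [hI]; simp
    simp only [wp, Expr.ok, Expr.val, Expr.cost, State.setReg_reg, State.setReg_arr,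
      State.setArr_reg, State.setArr_arr, hInv]
    simp only [reduceIte, hr12, hr14, h13, h1, hl, hl19, true_and,
      ne_eq, ite_eq_right_iff, one_ne_zero, imp_false, not_not, not_false_eq_true]
    have := hp l hl
    refine ⟨fun h => ⟨by omega, by omega, fun j => ?_⟩,
      fun h => ⟨by omega, by omega, by omega, fun j => ?_⟩⟩
    · rw [hI]
      by_cases hjl : j = l
      · subst hjl; simp [h]
      · simp [show j < l + 1 ↔ j < l by omega]
    · rw [Function.update_apply]
      by_cases hjl : j = l
      · subst hjl; simp [h]
      · rw [if_neg hjl, hI]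
        simp [show j < l + 1 ↔ j < l by omega]
  · intro s' hf hI
    rw [hInv] at hI
    have hr12 : s'.reg 12 = i := (hf.1 12 (by decide)).trans h12
    simp [Expr.ok, Expr.val, hI.1, hr12]

theorem insertProg_spec {w B N : ℕ} (hB : B ≤ 2 ^ w) {s : State} {d : ℕ → ℕ}
    (h20 : s.reg 20 = N) (hN : N + 1 < B) (hd : ∀ i < N, s.arr 18 i = d i)
    (hd' : ∀ i < N, d i ≤ i) :
    Ends w insertProg s (fun t s' => t ≤ 50 * (N + 1) * (N + 1) ∧
      ∀ j < N, s'.arr 19 j = insertPos d N j) := by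
  have h1 : 1 < B := by omega
  have h0 : 0 < B := by omega
  apply Ends.of_wp hB h1
  simp [insertProg, wp, Expr.ok, Expr.val, Expr.cost, h0]
  obtain ⟨Inv, hInv⟩ : ∃ Inv : ℕ → State → Prop, ∀ i s', Inv i s' ↔ s'.reg 12 = i ∧
      ∀ j < i, s'.arr 19 j = insertPos d i j := ⟨_, fun _ _ => Iff.rfl⟩
  apply Ends.mono (Ends.for_const hB h1 Inv (30 * (N + 1) + 15) (Nat.zero_le N) ?_ ?_ ?_)
  · rintro t s' - ⟨ht, h⟩
    simp [Expr.cost] at ht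
    exact ⟨by linarith [Nat.zero_le (N * N)], ((hInv _ _).1 h).2⟩
  · rw [hInv]
    simp [State.setReg_reg]
  · intro i s' _ hi hf hI
    rw [hInv] at hI
    obtain ⟨h12, hI⟩ := hI
    have hr20 : s'.reg 20 = N := (hf.1 20 (by decide)).trans (by simpa [State.setReg_reg] using h20)
    have ha18 : s'.arr 18 = s.arr 18 := hf.2 18 (by decide)
    simp only [wp, Expr.ok, Expr.val, Expr.cost,
      State.setArr_reg]
    simp only [reduceIte, hr20, h12, ha18,
      h1, h0, hi, true_and, ne_eq, one_ne_zero, not_false_eq_true, hd i hi]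
    rw [show wp w B shiftLoop = fun Q s => Ends w shiftLoop s Q from rfl]
    apply Ends.mono (shiftLoop_spec hB (i := i) ?_ ?_ (by omega) ?_)
    · rintro t s'' hf' ⟨ht, h19⟩
      have h12' : s''.reg 12 = i := (hf'.1 12 (by decide)).trans (by simp [State.setReg_reg, h12])
      have h14' : s''.reg 14 = d i := (hf'.1 14 (by decide)).trans (by simp [State.setReg_reg])
      simp only [State.setReg_reg, State.setReg_arr, Nat.reduceEqDiff, reduceIte] at h19
      simp only [hInv, State.setReg_reg, State.setReg_arr, State.setArr_reg, State.setArr_arr,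
        reduceIte, h12', h14', true_and]
      refine ⟨by omega, by omega, fun j hj => ?_⟩
      rw [insertPos, Function.update_apply]
      split_ifs with hji
      · rfl
      · have hji' : j < i := by omega
        rw [h19, if_pos hji', hI j hji', if_pos ‹_›]
      · have hji' : j < i := by omega
        rw [h19, if_pos hji', hI j hji', if_neg ‹_›]
    · simp [State.setReg_reg, h12]
    · simp [State.setReg_reg]
    · intro j hj
      simp only [State.setReg_arr]
      rw [hI j hj]
      have := insertPos_lt (fun j hj => hd' j (by omega)) hj
      omega
  · intro s' hf hI
    rw [hInv] at hI
    have hr20 : s'.reg 20 = N := (hf.1 20 (by decide)).trans (by simpa [State.setReg_reg] using h20)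
    simp [Expr.ok, Expr.val, hI.1, hr20]

theorem countProg_spec {w B N x : ℕ} (hB : B ≤ 2 ^ w) {s : State} (h20 : s.reg 20 = N)
    (hN : N + 1 < B) (hx : x < N.factorial)
    (hd : ∀ i, s.arr 18 i = if i < N then digit x i else 0) :
    Ends w countProg s (fun t s' => t ≤ 50 * (N + 1) ∧
      (∀ i, s'.arr 18 i = if i < N then digit (x + 1) i else 0) ∧
      s'.reg 8 = if x + 1 < N.factorial then s.reg 8 else 0) := by
  have h1 : 1 < B := by omega
  have h0 : 0 < B := by omega
  apply Ends.of_wp hB h1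
  simp [countProg, wp, Expr.ok, Expr.val, Expr.cost, h0]
  -- The `j` lowest digits were maximal and have been cleared.
  obtain ⟨J, hJ⟩ : ∃ J : ℕ → State → Prop, ∀ j s', J j s' ↔ s'.reg 13 = j ∧ j ≤ N ∧
      (∀ i < j, digit x i = i) ∧
      (∀ i, s'.arr 18 i = if i < j then 0 else if i < N then digit x i else 0) :=
    ⟨_, fun _ _ => Iff.rfl⟩
  apply Ends.mono (Ends.while hB h1 (fun μ s' => ∃ j, J j s' ∧ μ = N - j)
    (fun s' => ∃ j, J j s' ∧ (j < N → digit x j ≠ j)) 10 (μ₀ := N) ?_ ?_)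
  · rintro t s' hf ⟨ht, j, hj, hjN⟩
    rw [hJ] at hj
    obtain ⟨h13, hjN', hdig, harr⟩ := hj
    have hr20 : s'.reg 20 = N := (hf.1 20 (by decide)).trans (by simpa [State.setReg_reg] using h20)
    have hr8 : s'.reg 8 = s.reg 8 := (hf.1 8 (by decide)).trans (by simp [State.setReg_reg])
    simp [Expr.cost] at ht
    simp only [hr20, h13, hr8, State.setReg_reg, State.setReg_arr, State.setArr_reg,
      State.setArr_arr, reduceIte, ite_eq_right_iff, one_ne_zero,
      imp_false, not_not]
    refine ⟨fun hlt => ⟨?_, by omega, fun i => ?_, ?_⟩, fun hge => ⟨by omega, fun i => ?_, ?_⟩⟩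
    · have := digit_le x j
      rw [harr, if_neg (lt_irrefl _), if_pos hlt]
      omega
    · rw [digit_succ hdig (hjN hlt), Function.update_apply]
      by_cases hij : i = j
      · subst hij; simp [harr, hlt]
      · rw [if_neg hij, harr]
        split_ifs <;> rfl
    · rw [if_pos]
      have hnd := not_dvd_of_digit (hjN hlt)
      have : (j + 1).factorial ∣ N.factorial := Nat.factorial_dvd_factorial hlt
      rcases Nat.lt_or_ge (x + 1) N.factorial with h | h
      · exact h
      · rw [show x + 1 = N.factorial by omega] at hnd
        exact absurd this hnd
    · obtain rfl : j = N := by omega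
      have hdv := factorial_dvd_of_digits hdig
      rw [harr]
      split_ifs with h
      · rw [digit_of_dvd hdv h]
      · rfl
    · obtain rfl : j = N := by omega
      have hdv := Nat.le_of_dvd (by omega) (factorial_dvd_of_digits hdig)
      rw [if_neg (by omega)]
  · refine ⟨0, (hJ _ _).2 ⟨by simp [State.setReg_reg], by omega, by omega, fun i => ?_⟩, rfl⟩
    simp [State.setReg_arr, hd]
  · rintro μ s' hf ⟨j, hj, rfl⟩
    have hj0 := hj
    rw [hJ] at hj
    obtain ⟨h13, hjN', hdig, harr⟩ := hj
    have hr20 : s'.reg 20 = N := (hf.1 20 (by decide)).trans (by simpa [State.setReg_reg] using h20)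
    simp only [wp, Expr.ok, Expr.val, Expr.cost, State.setReg_reg, State.setReg_arr,
      State.setArr_reg, State.setArr_arr, hJ]
    simp only [reduceIte, hr20, h13, h0, h1, true_and, ne_eq, mul_eq_zero,
      ite_eq_right_iff, one_ne_zero, imp_false, not_or, not_not]
    refine ⟨by split_ifs <;> omega, fun ⟨hlt, he⟩ => ⟨by omega, by omega, N - (j + 1), by omega,
      j + 1, ⟨rfl, by omega, ?_, ?_⟩, rfl⟩, fun h => ⟨j, ⟨rfl, hjN', hdig, harr⟩, fun hlt => ?_⟩⟩
    · intro i hi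
      by_cases hij : i = j
      · subst hij
        rw [harr, if_neg (lt_irrefl _), if_pos hlt] at he
        exact he
      · exact hdig i (by omega)
    · intro i
      rw [Function.update_apply]
      by_cases hij : i = j
      · subst hij; simp
      · rw [if_neg hij, harr]
        split_ifs <;> first | rfl | omega
    · rcases h with h | h
      · omega
      · rwa [harr, if_neg (lt_irrefl _), if_pos hlt] at h

/-- `b` is the minimum of `c` and the first `N` values of `f`. -/
structure IsBest (c : ℕ) (f : ℕ → ℕ) (N b : ℕ) : Prop where
  le : b ≤ c
  le_of_lt : ∀ x < N, b ≤ f x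
  eq : b = c ∨ ∃ x < N, b = f x

theorem IsBest.step {c N b b' : ℕ} {f : ℕ → ℕ} (h : IsBest c f N b) (hb : b' = min b (f N)) :
    IsBest c f (N + 1) b' := by
  subst hb
  refine ⟨(min_le_left _ _).trans h.le, fun x hx => ?_, ?_⟩
  · rcases Nat.lt_succ_iff_lt_or_eq.1 hx with hx | rfl
    · exact (min_le_left _ _).trans (h.le_of_lt x hx)
    · exact min_le_right _ _
  · rcases min_choice b (f N) with h1 | h1 <;> rw [h1]
    · rcases h.eq with h2 | ⟨x, hx, h2⟩
      · exact Or.inl h2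
      · exact Or.inr ⟨x, by omega, h2⟩
    · exact Or.inr ⟨N, by omega, rfl⟩

/-- The cost of the drawing with number `x` for the edges in a segment of a table of edges. -/
def drawingCost (k : Bool) (N M b : ℕ) (al be row : ℕ → ℕ) (x : ℕ) : ℕ :=
  cost k (range M) (fun j => insertPos (digit x) N (al (row (b + j))))
    (fun j => insertPos (digit x) N (be (row (b + j))))

theorem enumProg_spec {w B n m b M N : ℕ} (hB : B ≤ 2 ^ w) (hX : (n + m + 2) ^ 4 ≤ B) (k : Bool)
    {s : State} (hm : s.reg 1 = m) (h11 : s.reg 11 = M) (hM : M ≤ m) (h10 : s.reg 10 = b)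
    (hb : b ≤ n * m) (h20 : s.reg 20 = N) (hN : N ≤ n + 1) (hz : ∀ i, s.arr 18 i = 0)
    (hal : ∀ j < M, s.arr 14 (s.arr 16 (b + j)) < N)
    (hbe : ∀ j < M, s.arr 15 (s.arr 16 (b + j)) < N) :
    Ends w (enumProg k) s (fun t s' =>
      t ≤ N.factorial * (1000 * (N + M + 1) * (N + M + 1)) + 10 ∧ (∀ i, s'.arr 18 i = 0) ∧
      IsBest (m * m) (drawingCost k N M b (s.arr 14) (s.arr 15) (s.arr 16)) N.factorial
        (s'.reg 21)) := by
  have hS := small_lt hX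
  have hsq := sq_lt hX
  have h1 : 1 < B := by omega
  have h0 : 0 < B := by omega
  obtain ⟨c, hc⟩ : ∃ c, c = drawingCost k N M b (s.arr 14) (s.arr 15) (s.arr 16) := ⟨_, rfl⟩
  obtain ⟨Inv, hInv⟩ : ∃ Inv : ℕ → State → Prop, ∀ x s', Inv x s' ↔
      (s'.reg 8 = if x < N.factorial then 1 else 0) ∧
      (∀ i, s'.arr 18 i = if i < N then digit x i else 0) ∧ IsBest (m * m) c x (s'.reg 21) :=
    ⟨_, fun _ _ => Iff.rfl⟩
  rw [← hc]
  refine Ends.seq (Q' := fun t s' => t = 6 ∧ s'.arr = s.arr ∧ Inv 0 s') ?_ ?_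
  · apply Ends.of_wp hB h1
    simp only [wp, Expr.ok, Expr.val, Expr.cost, State.setReg_reg, State.setReg_arr, hInv]
    simp only [Nat.reduceEqDiff, reduceIte, hm, h1, true_and, Nat.factorial_pos, hz, digit_zero]
    exact ⟨by omega, by simp, ⟨le_rfl, by simp, Or.inl rfl⟩⟩
  · rintro t₀ s₀ hf₀ ⟨rfl, ha₀, hI₀⟩
    apply Ends.mono (Ends.for_of_ends hB h1 Inv (fun _ => 990 * (N + M + 1) * (N + M + 1))
      (Nat.zero_le N.factorial) hI₀ ?_ ?_)
    · rintro t s' - ⟨ht, h⟩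
      rw [hInv] at h
      simp [Expr.cost] at ht
      refine ⟨?_, fun i => ?_, h.2.2⟩
      · have h2 : 990 * (N + M + 1) * (N + M + 1) + 2 ≤ 1000 * (N + M + 1) * (N + M + 1) := by
          have : 1 * 1 ≤ (N + M + 1) * (N + M + 1) := Nat.mul_le_mul (by omega) (by omega)
          linarith
        have := Nat.mul_le_mul_left N.factorial h2
        omega
      · rw [h.2.1]
        split_ifs with hi
        -- After `N!` increments the counter has wrapped around to zero, as the next block requires.
        · exact digit_of_dvd dvd_rfl hi
        · rfl
    · intro x s₁ _ hx hf₁ hI₁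
      rw [hInv] at hI₁
      obtain ⟨h8, hd, hbest⟩ := hI₁
      have hne : ∀ r, r ∈ [1, 10, 11, 20] → s₁.reg r = s.reg r := by
        intro r hr
        refine (hf₁.1 r ?_).trans (hf₀.1 r ?_) <;> fin_cases hr <;>
          simp [Prog.regs, enumBody, insertProg, costProg, pairLoop, shiftLoop, countProg]
      have hne' : ∀ a, a ∈ [14, 15, 16] → s₁.arr a = s.arr a := by
        intro a ha
        refine (hf₁.2 a ?_).trans (hf₀.2 a ?_) <;> fin_cases ha <;>
          simp [Prog.arrs, enumBody, insertProg, costProg, pairLoop, shiftLoop, countProg]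
      refine ⟨trivial, by simp [Expr.val, h8, hx], ?_⟩
      refine Ends.seq (insertProg_spec hB (N := N) (d := digit x)
        ((hne 20 (by simp)).trans h20) (by omega) (fun i hi => by rw [hd, if_pos hi])
        (fun i _ => digit_le x i)) ?_
      rintro t₂ s₂ hf₂ ⟨ht₂, hp⟩
      have hne₂ : ∀ r, r ∈ [10, 11, 20, 8, 21] → s₂.reg r = s₁.reg r := by
        intro r hr
        refine hf₂.1 r ?_
        fin_cases hr <;> simp [Prog.regs, insertProg, shiftLoop]
      have hne₂' : ∀ a, a ∈ [14, 15, 16, 18] → s₂.arr a = s₁.arr a := by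
        intro a ha
        refine hf₂.2 a ?_
        fin_cases ha <;> simp [Prog.arrs, insertProg, shiftLoop]
      refine Ends.seq (costProg_spec hB hX k (n := n) (m := m) (b := b) (M := M)
        ((hne₂ 11 (by simp)).trans ((hne 11 (by simp)).trans h11)) hM
        ((hne₂ 10 (by simp)).trans ((hne 10 (by simp)).trans h10)) hb rfl rfl) ?_
      rintro t₃ s₃ hf₃ ⟨ht₃, h19⟩
      have hne₃ : ∀ r, r ∈ [20, 8, 21] → s₃.reg r = s₂.reg r := by
        intro r hr
        refine hf₃.1 r ?_
        fin_cases hr <;> simp [Prog.regs, costProg, pairLoop]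
      have hne₃' : s₃.arr = s₂.arr := by
        funext a
        exact hf₃.2 a (by simp [Prog.arrs, costProg, pairLoop])
      have hcost : s₃.reg 19 = c x := by
        rw [h19, hc, drawingCost, hne₂' 14 (by simp), hne₂' 15 (by simp), hne₂' 16 (by simp),
          hne' 14 (by simp), hne' 15 (by simp), hne' 16 (by simp)]
        have e1 : ∀ j < M, s₂.arr 19 (s.arr 14 (s.arr 16 (b + j))) =
            insertPos (digit x) N (s.arr 14 (s.arr 16 (b + j))) := fun j hj => hp _ (hal j hj)
        have e2 : ∀ j < M, s₂.arr 19 (s.arr 15 (s.arr 16 (b + j))) =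
            insertPos (digit x) N (s.arr 15 (s.arr 16 (b + j))) := fun j hj => hp _ (hbe j hj)
        refine sum_congr rfl fun i hi => ?_
        congr 1
        refine sum_congr rfl fun j hj => ?_
        dsimp only
        rw [e1 i (mem_range.1 hi), e2 i (mem_range.1 hi), e1 j (mem_range.1 hj),
          e2 j (mem_range.1 hj)]
      refine Ends.seq (Q' := fun t s' => t ≤ 10 ∧ s'.arr = s₃.arr ∧ s'.reg 20 = N ∧
        s'.reg 8 = 1 ∧ s'.reg 21 = min (s₁.reg 21) (c x)) ?_ ?_
      · have h20' : s₃.reg 20 = N := by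
          rw [hne₃ 20 (by simp), hne₂ 20 (by simp), hne 20 (by simp), h20]
        have h8' : s₃.reg 8 = 1 := by
          rw [hne₃ 8 (by simp), hne₂ 8 (by simp), h8, if_pos hx]
        have h21' : s₃.reg 21 = s₁.reg 21 := by rw [hne₃ 21 (by simp), hne₂ 21 (by simp)]
        apply Ends.of_wp hB h1
        simp only [wp, Expr.ok, Expr.val, Expr.cost, State.setReg_reg, State.setReg_arr]
        simp only [Nat.reduceEqDiff, reduceIte, hcost, h20', h8', h21', true_and, ne_eq,
          ite_eq_right_iff, one_ne_zero, imp_false, not_not]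
        exact ⟨fun h => ⟨by omega, by omega⟩, fun h => ⟨by omega, by omega⟩⟩
      · rintro t₄ s₄ hf₄ ⟨ht₄, ha₄, h20₄, h8₄, h21₄⟩
        apply Ends.mono (countProg_spec hB h20₄ (by omega) hx (fun i => by
          rw [ha₄, hne₃', hne₂' 18 (by simp), hd]))
        rintro t₅ s₅ hf₅ ⟨ht₅, hd₅, h8₅⟩
        have h21₅ : s₅.reg 21 = s₄.reg 21 := hf₅.1 21 (by simp [Prog.regs, countProg])
        refine ⟨?_, (hInv _ _).2 ⟨?_, hd₅, ?_⟩⟩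
        · have e1 : (N + 1) * (N + 1) ≤ (N + M + 1) * (N + M + 1) :=
            Nat.mul_le_mul (by omega) (by omega)
          have e2 : (M + 1) * (M + 1) ≤ (N + M + 1) * (N + M + 1) :=
            Nat.mul_le_mul (by omega) (by omega)
          have e3 : (N + 1) * 1 ≤ (N + 1) * (N + 1) :=
            Nat.mul_le_mul (by omega) (by omega)
          have e4 : 1 ≤ (N + M + 1) * (N + M + 1) := Nat.mul_pos (by omega) (by omega)
          rw [mul_assoc] at ht₂ ht₃ ⊢
          omega
        · rw [h8₅, h8₄]
        · rw [h21₅]; exact hbest.step h21₄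
    · intro s₁ _ hI₁
      rw [hInv] at hI₁
      exact ⟨trivial, by simp [Expr.val, hI₁.1]⟩

theorem sumProg_spec {w B n m : ℕ} (hB : B ≤ 2 ^ w) (hX : (n + m + 2) ^ 4 ≤ B) (k : Bool)
    {s : State} (hn : s.reg 0 = n) (hm : s.reg 1 = m) (hM : ∀ t ≤ n, s.arr 17 t ≤ m)
    (hN : ∀ t ≤ n, s.arr 13 t ≤ n) (hz : ∀ i, s.arr 18 i = 0)
    (hal : ∀ t ≤ n, ∀ j < s.arr 17 t, s.arr 14 (s.arr 16 (t * m + j)) < s.arr 13 t + 1)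
    (hbe : ∀ t ≤ n, ∀ j < s.arr 17 t, s.arr 15 (s.arr 16 (t * m + j)) < s.arr 13 t + 1) :
    Ends w (sumProg k) s (fun t s' =>
      t ≤ ∑ t ∈ range n, (s.arr 13 (t + 1) + 1).factorial * (1100 *
        (s.arr 13 (t + 1) + s.arr 17 (t + 1) + 2) * (s.arr 13 (t + 1) + s.arr 17 (t + 1) + 2))
        + 20 ∧
      ∃ best : ℕ → ℕ, s'.reg 0 = ∑ t ∈ range n, best (t + 1) ∧
        ∀ t, 1 ≤ t → t ≤ n → IsBest (m * m) (drawingCost k (s.arr 13 t + 1) (s.arr 17 t) (t * m)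
          (s.arr 14) (s.arr 15) (s.arr 16)) (s.arr 13 t + 1).factorial (best t)) := by
  have hS := small_lt hX
  have h1 : 1 < B := by omega
  have h0 : 0 < B := by omega
  -- The final sum has `n` terms of at most `m * m` each.
  have haddr : n * (m * m) < B := by
    have h2 : n * (m * m) ≤ (n + m + 2) * ((n + m + 2) * (n + m + 2)) :=
      Nat.mul_le_mul (by omega) (Nat.mul_le_mul (by omega) (by omega))
    have h3 : (n + m + 2) ^ 4 = (n + m + 2) * ((n + m + 2) * (n + m + 2)) * (n + m + 2) := by ring
    have h4 : (n + m + 2) * ((n + m + 2) * (n + m + 2)) * 2 ≤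
      (n + m + 2) * ((n + m + 2) * (n + m + 2)) * (n + m + 2) := Nat.mul_le_mul le_rfl (by omega)
    have h5 : 0 < (n + m + 2) * ((n + m + 2) * (n + m + 2)) := by positivity
    omega
  obtain ⟨F, hF⟩ : ∃ F : ℕ → ℕ → ℕ, ∀ t, F t = drawingCost k (s.arr 13 t + 1) (s.arr 17 t) (t * m)
    (s.arr 14) (s.arr 15) (s.arr 16) := ⟨_, fun _ => rfl⟩
  obtain ⟨Inv, hInv⟩ : ∃ Inv : ℕ → State → Prop, ∀ j s', Inv j s' ↔ s'.reg 9 = j ∧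
      (∀ i, s'.arr 18 i = 0) ∧ ∃ best : ℕ → ℕ, s'.reg 22 = ∑ t ∈ range j, best (t + 1) ∧
        ∀ t, 1 ≤ t → t ≤ j → IsBest (m * m) (F t) (s.arr 13 t + 1).factorial (best t) :=
    ⟨_, fun _ _ => Iff.rfl⟩
  refine Ends.seq (Q' := fun t s' => t = 4 ∧ s'.arr = s.arr ∧ Inv 0 s') ?_ ?_
  · apply Ends.of_wp hB h1
    simp only [wp, Expr.ok, Expr.val, Expr.cost, State.setReg_reg, State.setReg_arr, hInv]
    simp only [Nat.reduceEqDiff, reduceIte, h0, true_and, hz, implies_true]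
    exact ⟨fun _ => 0, by simp, fun t _ _ => by omega⟩
  · rintro t₀ s₀ hf₀ ⟨rfl, ha₀, hI₀⟩
    have hne₀ : ∀ r, r ∈ [0, 1] → s₀.reg r = s.reg r := by
      intro r hr
      refine hf₀.1 r ?_
      fin_cases hr <;> simp [Prog.regs]
    refine Ends.seq (Ends.for_of_ends hB h1 Inv (fun t => (s.arr 13 (t + 1) + 1).factorial * (1000 *
        (s.arr 13 (t + 1) + s.arr 17 (t + 1) + 2) * (s.arr 13 (t + 1) + s.arr 17 (t + 1) + 2)) + 40)
        (Nat.zero_le n) hI₀ ?_ ?_) ?_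
    · intro j s₁ _ hj hf₁ hI₁
      rw [hInv] at hI₁
      obtain ⟨h9, hz₁, best, h22, hbest⟩ := hI₁
      have hne : ∀ r, r ∈ [0, 1] → s₁.reg r = s.reg r := by
        intro r hr
        refine (hf₁.1 r ?_).trans (hne₀ r hr)
        fin_cases hr <;>
          simp [Prog.regs, sumBody, enumProg, enumBody, insertProg, costProg, pairLoop, shiftLoop,
            countProg]
      have hne' : ∀ a, a ∈ [13, 14, 15, 16, 17] → s₁.arr a = s.arr a := by
        intro a ha
        refine (hf₁.2 a ?_).trans (by rw [ha₀])
        fin_cases ha <;>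
          simp [Prog.arrs, sumBody, enumProg, enumBody, insertProg, costProg, pairLoop, shiftLoop,
            countProg]
      have hr0 : s₁.reg 0 = n := (hne 0 (by simp)).trans hn
      have hr1 : s₁.reg 1 = m := (hne 1 (by simp)).trans hm
      have hjm : (j + 1) * m ≤ n * m := Nat.mul_le_mul_right _ hj
      have haddr' := addr_lt hX (le_refl n) (show m ≤ 2 * m + n by omega) (Nat.zero_le m)
      refine ⟨⟨trivial, trivial⟩, by simp [Expr.val, h9, hr0, hj], ?_⟩
      refine Ends.seq (Q' := fun t s' => t ≤ 20 ∧ s'.arr = s₁.arr ∧ s'.reg 9 = j + 1 ∧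
        s'.reg 20 = s.arr 13 (j + 1) + 1 ∧ s'.reg 11 = s.arr 17 (j + 1) ∧
        s'.reg 10 = (j + 1) * m ∧ s'.reg 1 = m ∧ s'.reg 22 = s₁.reg 22) ?_ ?_
      · apply Ends.of_wp hB h1
        simp only [wp, Expr.ok, Expr.val, Expr.cost, State.setReg_reg, State.setReg_arr]
        simp only [Nat.reduceEqDiff, reduceIte, h9, h1, hr1, true_and, hne' 13 (by simp),
          hne' 17 (by simp)]
        have := hN (j + 1) hj
        constructorm* _ ∧ _ <;> first | trivial | omega
      · rintro t₂ s₂ hf₂ ⟨ht₂, ha₂, h9₂, h20₂, h11₂, h10₂, h1₂, h22₂⟩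
        have hne₂ : ∀ a, a ∈ [13, 14, 15, 16, 17] → s₂.arr a = s.arr a := by
          intro a ha
          rw [ha₂, hne' a ha]
        refine Ends.seq (enumProg_spec hB hX k h1₂ h11₂ (hM _ hj) h10₂ hjm h20₂
          (by have := hN (j + 1) hj; omega) (fun i => by rw [ha₂]; exact hz₁ i) ?_ ?_) ?_
        · rw [hne₂ 14 (by simp), hne₂ 16 (by simp)]
          exact hal _ hj
        · rw [hne₂ 15 (by simp), hne₂ 16 (by simp)]
          exact hbe _ hj
        · rintro t₃ s₃ hf₃ ⟨ht₃, hz₃, hb₃⟩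
          rw [hne₂ 14 (by simp), hne₂ 15 (by simp), hne₂ 16 (by simp), ← hF] at hb₃
          have h9₃ : s₃.reg 9 = j + 1 := (hf₃.1 9 (by
            simp [Prog.regs, enumProg, enumBody, insertProg, costProg, pairLoop, shiftLoop,
              countProg])).trans h9₂
          have h22₃ : s₃.reg 22 = s₁.reg 22 := (hf₃.1 22 (by
            simp [Prog.regs, enumProg, enumBody, insertProg, costProg, pairLoop, shiftLoop,
              countProg])).trans h22₂
          have hbest' : ∀ t, 1 ≤ t → t ≤ j → best t ≤ m * m := fun t h h' => (hbest t h h').le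
          have hle : s₁.reg 22 ≤ j * (m * m) := by
            rw [h22]
            refine (sum_le_card_nsmul _ _ (m * m) fun t ht => hbest' _ (by omega) ?_).trans
              (by simp)
            have := mem_range.1 ht
            omega
          have hle' : (j + 1) * (m * m) ≤ n * (m * m) := Nat.mul_le_mul_right _ hj
          have hle'' := hb₃.le
          rw [add_mul, one_mul] at hle'
          apply Ends.of_wp hB h1
          simp only [wp, Expr.ok, Expr.val, Expr.cost, State.setReg_reg, State.setReg_arr, hInv]
          simp only [Nat.reduceEqDiff, reduceIte, h9₃, h22₃, true_and]
          refine ⟨by omega, ?_, hz₃, Function.update best (j + 1) (s₃.reg 21), ?_, ?_⟩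
          · have : s.arr 13 (j + 1) + 1 + s.arr 17 (j + 1) + 1 =
              s.arr 13 (j + 1) + s.arr 17 (j + 1) + 2 := by omega
            rw [this] at ht₃
            omega
          · rw [sum_range_succ, Function.update_self, h22]
            congr 1
            refine sum_congr rfl fun t ht => ?_
            rw [Function.update_of_ne]
            have := mem_range.1 ht
            omega
          · intro t ht ht'
            by_cases htj : t = j + 1
            · subst htj; simpa using hb₃
            · rw [Function.update_of_ne htj]
              exact hbest t ht (by omega)
    · intro s₁ hf₁ hI₁
      rw [hInv] at hI₁
      have hr0 : s₁.reg 0 = n := (hf₁.1 0 (by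
        simp [Prog.regs, sumBody, enumProg, enumBody, insertProg, costProg, pairLoop, shiftLoop,
            countProg])).trans ((hne₀ 0 (by simp)).trans hn)
      exact ⟨⟨trivial, trivial⟩, by simp [Expr.val, hI₁.1, hr0]⟩
    · rintro t₁ s₁ hf₁ ⟨ht₁, hI₁⟩
      rw [hInv] at hI₁
      obtain ⟨-, -, best, h22, hbest⟩ := hI₁
      have : ∑ t ∈ range n, ((s.arr 13 (t + 1) + 1).factorial * (1000 *
          (s.arr 13 (t + 1) + s.arr 17 (t + 1) + 2) * (s.arr 13 (t + 1) + s.arr 17 (t + 1) + 2))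
          + 40 + (3 + 1)) ≤ ∑ t ∈ range n, (s.arr 13 (t + 1) + 1).factorial * (1100 *
        (s.arr 13 (t + 1) + s.arr 17 (t + 1) + 2) * (s.arr 13 (t + 1) + s.arr 17 (t + 1) + 2)) := by
        refine sum_le_sum fun t _ => ?_
        set a := s.arr 13 (t + 1) + s.arr 17 (t + 1) + 2
        have e1 : 1 * (2 * 2) ≤ (s.arr 13 (t + 1) + 1).factorial * (a * a) :=
          Nat.mul_le_mul (Nat.factorial_pos _) (Nat.mul_le_mul (by omega) (by omega))
        linarith
      rw [show Expr.cost (reg 9 <ₑ reg 0) = 3 from rfl] at ht₁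
      rw [Nat.Ico_zero_eq_range] at ht₁
      have ht₁' := ht₁.trans (Nat.add_le_add_right this _)
      clear this ht₁
      revert ht₁'
      generalize (∑ t ∈ range n, (s.arr 13 (t + 1) + 1).factorial * (1100 *
        (s.arr 13 (t + 1) + s.arr 17 (t + 1) + 2) * (s.arr 13 (t + 1) + s.arr 17 (t + 1) + 2))) = T
      intro ht₁
      apply Ends.of_wp hB h1
      simp only [wp, Expr.ok, Expr.val, Expr.cost, State.setReg_reg]
      refine ⟨trivial, by omega, best, h22, fun t ht ht' => by rw [← hF]; exact hbest t ht ht'⟩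

end OnePage

/-! ### Search forests, blocks and numberings as combinatorial objects -/

namespace OnePage

open Finset WordRAM WordRAM.Expr

/-- The vertices `1, …, n` of a graph are numbered in the preorder of a depth-first search, `P x` is
the parent of `x` (`0` for a root), and the edges are the pairs `V i < U i` with `i < m`. -/
structure DfsForest (n m : ℕ) (U V P : ℕ → ℕ) : Prop where
  parent_zero : P 0 = 0
  parent_lt : ∀ x, 1 ≤ x → x ≤ n → P x < x
  lower_pos : ∀ i < m, 1 ≤ V i
  lower_lt : ∀ i < m, V i < U i
  upper_le : ∀ i < m, U i ≤ n
  comparable : ∀ i < m, ∃ k, P^[k] (U i) = V i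
  inj : ∀ i < m, ∀ j < m, U i = U j → V i = V j → i = j
  tree : ∀ x, 1 ≤ x → x ≤ n → P x ≠ 0 → ∃ i < m, U i = x ∧ V i = P x

/-- The edges that leave the subtree of `x` above the parent of `x`. -/
def Covered (m : ℕ) (U V P : ℕ → ℕ) (x : ℕ) : Prop :=
  ∃ i < m, (∃ k, P^[k] (U i) = x) ∧ V i < P x

open Classical in
/-- `cls x` is the top vertex of the block that contains the edge from `x` to its parent. -/
structure BlockForest (n m : ℕ) (U V P cls : ℕ → ℕ) : Prop extends DfsForest n m U V P where
  cls_eq : ∀ x, 1 ≤ x → x ≤ n → cls x = if Covered m U V P x then cls (P x) else x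

/-- The vertices are numbered within their blocks, after the contraction of the edges between
vertices of small degree. -/
structure Numbering (n m : ℕ) (U V P cls idx : ℕ → ℕ) : Prop where
  contracted : ∀ x, 1 ≤ x → x ≤ n → Contracted cls (classDegree m U V cls) P x → idx x = idx (P x)
  kept : ∀ x, 1 ≤ x → x ≤ n → ¬ Contracted cls (classDegree m U V cls) P x →
    idx x = #(remaining cls (classDegree m U V cls) P x (cls x))

/-- The search ends at the artificial root with its row used up. The root is joined to all vertices,
so all of them are numbered, and the numbers are exactly `1, …, n`. A parent other than `0` is a
neighbour in the graph itself. -/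
theorem DfsInv.forest {n m W : ℕ} {a b : ℕ → ℕ} {ptr adj num org P : ℕ → ℕ} {cnt μ : ℕ}
    (h : DfsInv n W (Rel n m a b) ptr adj num org P 0 cnt μ) (h0 : ptr 0 = 0)
    (ha : ∀ i < m, a i < n) (hb : ∀ i < m, b i < n) (hab : ∀ i < m, a i ≠ b i)
    (hinj : ∀ i < m, ∀ j < m, (a i = a j ∧ b i = b j) ∨ (a i = b j ∧ b i = a j) → i = j)
    {U V : ℕ → ℕ} (hU : ∀ i < m, U i = max (num (a i + 1)) (num (b i + 1)))
    (hV : ∀ i < m, V i = min (num (a i + 1)) (num (b i + 1))) :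
    DfsForest n m U V P ∧ (∀ v, 1 ≤ v → v ≤ n → 1 ≤ num v ∧ num v ≤ n) ∧
      Set.InjOn num (Set.Icc 1 n) := by
  have hvis : ∀ v, 1 ≤ v → v ≤ n → num v ≠ 0 := by
    intro v h1 h2
    rcases h.rows 0 (Nat.zero_le _) v (Or.inr ⟨rfl, h1, h2⟩) with h3 | ⟨q, hq, -⟩
    · exact h3
    · omega
  have horg : ∀ v, 1 ≤ v → v ≤ n → num v ≤ cnt ∧ org (num v) = v :=
    fun v h1 h2 => h.num_spec v h1 h2 (hvis v h1 h2)
  have hnum : Set.InjOn num (Set.Icc 1 n) := by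
    intro x hx y hy hxy
    rw [← (horg x hx.1 hx.2).2, hxy, (horg y hy.1 hy.2).2]
  have hcle := h.cnt_le
  have hcnt : n ≤ cnt := by
    have : (Icc 1 n).card ≤ (Icc 1 cnt).card := by
      apply card_le_card_of_injOn num
      · intro v hv
        simp only [coe_Icc, Set.mem_Icc] at hv ⊢
        have := horg v hv.1 hv.2
        have := hvis v hv.1 hv.2
        omega
      · simpa using hnum
    simpa using this
  have hne : ∀ i < m, num (a i + 1) ≠ num (b i + 1) := by
    intro i hi he
    have := hnum ⟨by omega, by have := ha i hi; omega⟩ ⟨by omega, by have := hb i hi; omega⟩ he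
    have := hab i hi
    omega
  have hva : ∀ i < m, num (a i + 1) ≠ 0 ∧ num (a i + 1) ≤ cnt ∧ org (num (a i + 1)) = a i + 1 :=
    fun i hi => by
      have := ha i hi
      exact ⟨hvis _ (by omega) (by omega), horg _ (by omega) (by omega)⟩
  have hvb : ∀ i < m, num (b i + 1) ≠ 0 ∧ num (b i + 1) ≤ cnt ∧ org (num (b i + 1)) = b i + 1 :=
    fun i hi => by
      have := hb i hi
      exact ⟨hvis _ (by omega) (by omega), horg _ (by omega) (by omega)⟩
  refine ⟨⟨h.parent_zero, fun x h1 h2 => h.parent_lt x h1 (by omega), ?_, ?_, ?_, ?_, ?_, ?_⟩,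
    fun v h1 h2 => ⟨Nat.one_le_iff_ne_zero.2 (hvis v h1 h2), by
      have := (horg v h1 h2).1; omega⟩, hnum⟩
  · intro i hi
    have := hva i hi
    have := hvb i hi
    rw [hV i hi]
    omega
  · intro i hi
    have := hne i hi
    rw [hV i hi, hU i hi]
    omega
  · intro i hi
    have := hva i hi
    have := hvb i hi
    rw [hU i hi]
    omega
  · intro i hi
    have h1 := hva i hi
    have h2 := hvb i hi
    rw [hV i hi, hU i hi]
    rcases Nat.lt_or_gt_of_ne (hne i hi) with h3 | h3
    · rw [max_eq_right h3.le, min_eq_left h3.le]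
      refine h.comparable _ _ (by omega) h3 h2.2.1 (Or.inl ⟨i, hi, Or.inl ?_⟩)
      exact ⟨h1.2.2, h2.2.2⟩
    · rw [max_eq_left h3.le, min_eq_right h3.le]
      refine h.comparable _ _ (by omega) h3 h1.2.1 (Or.inl ⟨i, hi, Or.inr ?_⟩)
      exact ⟨h2.2.2, h1.2.2⟩
  · intro i hi j hj h1 h2
    rw [hU i hi, hU j hj] at h1
    rw [hV i hi, hV j hj] at h2
    have hi1 := hva i hi
    have hi2 := hvb i hi
    have hj1 := hva j hj
    have hj2 := hvb j hj
    apply hinj i hi j hj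
    have : (num (a i + 1) = num (a j + 1) ∧ num (b i + 1) = num (b j + 1)) ∨
        (num (a i + 1) = num (b j + 1) ∧ num (b i + 1) = num (a j + 1)) := by omega
    rcases this with ⟨e1, e2⟩ | ⟨e1, e2⟩
    · left
      have e1 := congrArg org e1
      have e2 := congrArg org e2
      omega
    · right
      have e1 := congrArg org e1
      have e2 := congrArg org e2
      omega
  · intro x h1 h2 h3
    have hlt := h.parent_lt x h1 (by omega)
    have ox := h.org_spec x h1 (by omega)
    have oP := h.org_spec (P x) (by omega) (by omega)
    rcases h.parent_rel x h1 (by omega) with ⟨i, hi, ⟨e1, e2⟩ | ⟨e1, e2⟩⟩ | ⟨e1, -⟩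
    · refine ⟨i, hi, ?_⟩
      rw [hU i hi, hV i hi, ← e1, ← e2]
      omega
    · refine ⟨i, hi, ?_⟩
      rw [hU i hi, hV i hi, ← e1, ← e2]
      omega
    · omega

theorem BlockForest.cls_bounds {n m : ℕ} {U V P cls : ℕ → ℕ} (h : BlockForest n m U V P cls) {x : ℕ}
    (h1 : 1 ≤ x) (h2 : x ≤ n) : 1 ≤ cls x ∧ cls x ≤ x := by
  induction x using Nat.strong_induction_on with
  | _ x ih =>
    rw [h.cls_eq x h1 h2]
    split_ifs with hc
    · obtain ⟨i, hi, -, hlt⟩ := hc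
      have hP := h.parent_lt x h1 h2
      have := h.lower_pos i hi
      have := ih (P x) hP (by omega) (by omega)
      omega
    · omega

theorem BlockForest.cls_parent {n m : ℕ} {U V P cls : ℕ → ℕ} (h : BlockForest n m U V P cls) {x : ℕ}
    (h1 : 1 ≤ x) (h2 : x ≤ n) (hx : cls x ≠ x) : cls x = cls (P x) ∧ 1 ≤ P x ∧ P x < x := by
  have := h.cls_eq x h1 h2
  split_ifs at this with hc
  · obtain ⟨i, hi, -, hlt⟩ := hc
    have hP := h.parent_lt x h1 h2
    exact ⟨this, by omega, hP⟩
  · exact absurd this hx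

theorem remaining_mono {cls deg P : ℕ → ℕ} {j j' t : ℕ} (h : j ≤ j') :
    remaining cls deg P j t ⊆ remaining cls deg P j' t :=
  by classical exact filter_subset_filter _ (Icc_subset_Icc le_rfl h)

/-- A contracted vertex shares index and class with its parent, so induction along parents leads to
a vertex that remains and is counted. -/
theorem Numbering.bounds {n m : ℕ} {U V P cls idx : ℕ → ℕ} (hN : Numbering n m U V P cls idx)
    (h : BlockForest n m U V P cls) {x : ℕ} (h1 : 1 ≤ x) (h2 : x ≤ n) :
    1 ≤ idx x ∧ idx x ≤ #(remaining cls (classDegree m U V cls) P n (cls x)) := by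
  induction x using Nat.strong_induction_on with
  | _ x ih =>
    by_cases hc : Contracted cls (classDegree m U V cls) P x
    · obtain ⟨e1, e2, e3⟩ := h.cls_parent h1 h2 hc.1
      rw [hN.contracted x h1 h2 hc, e1]
      exact ih (P x) e3 e2 (by omega)
    · rw [hN.kept x h1 h2 hc]
      refine ⟨card_pos.2 ⟨x, ?_⟩, card_le_card (remaining_mono h2)⟩
      simp [OnePage.remaining, hc, h1]

end OnePage

/-! ### The complete program -/

namespace OnePage

open Finset WordRAM WordRAM.Expr

/-- The endpoints of the `i`-th edge of a list. -/
def fstEnd {n : ℕ} (es : List (Fin n × Fin n)) (i : ℕ) : ℕ := (es[i]?.map fun e => (e.1 : ℕ)).getD 0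

def sndEnd {n : ℕ} (es : List (Fin n × Fin n)) (i : ℕ) : ℕ := (es[i]?.map fun e => (e.2 : ℕ)).getD 0

theorem fstEnd_eq {n : ℕ} {es : List (Fin n × Fin n)} {i : ℕ} (hi : i < es.length) :
    fstEnd es i = es[i].1 := by simp [fstEnd, hi]

theorem sndEnd_eq {n : ℕ} {es : List (Fin n × Fin n)} {i : ℕ} (hi : i < es.length) :
    sndEnd es i = es[i].2 := by simp [sndEnd, hi]

theorem IsEdgeList.adj {n : ℕ} {G : SimpleGraph (Fin n)} {es : List (Fin n × Fin n)}
    (h : IsEdgeList G es) {i : ℕ} (hi : i < es.length) : G.Adj es[i].1 es[i].2 :=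
  (h.2 _ _).1 (List.mem_map.2 ⟨es[i], List.getElem_mem hi, rfl⟩)

theorem IsEdgeList.inj {n : ℕ} {G : SimpleGraph (Fin n)} {es : List (Fin n × Fin n)}
    (h : IsEdgeList G es) {i j : ℕ} (hi : i < es.length) (hj : j < es.length)
    (he : s(es[i].1, es[i].2) = s(es[j].1, es[j].2)) : i = j := by
  have := (h.1.getElem_inj_iff (i := i) (j := j) (hi := by simpa using hi)
    (hj := by simpa using hj)).1 (by simpa using he)
  exact this

def prepProg : Prog :=
  edgeRowsProg ;; rootRowProg ;; dfsProg ;; lowProg ;; pushProg ;; classProg ;; degProg ;;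
    indexProg ;; bucketProg

theorem prepProg_spec {w B n m : ℕ} (hB : B ≤ 2 ^ w) (hX : (n + m + 2) ^ 4 ≤ B) {s : State}
    (hn : s.reg 0 = n) (hm : s.reg 1 = m) (ha : ∀ i < m, s.arr 0 i < n)
    (hb : ∀ i < m, s.arr 1 i < n) (hab : ∀ i < m, s.arr 0 i ≠ s.arr 1 i)
    (hinj : ∀ i < m, ∀ j < m, (s.arr 0 i = s.arr 0 j ∧ s.arr 1 i = s.arr 1 j) ∨
      (s.arr 0 i = s.arr 1 j ∧ s.arr 1 i = s.arr 0 j) → i = j)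
    (hz : ∀ a, 2 ≤ a → ∀ i, s.arr a i = 0) :
    Ends w prepProg s (fun t s' => t ≤ 1200 * (n + m + 1) ∧ s'.reg 0 = n ∧ s'.reg 1 = m ∧
      (∀ i, s'.arr 18 i = 0) ∧ ∃ num U V P cls idx : ℕ → ℕ,
        (∀ v, 1 ≤ v → v ≤ n → 1 ≤ num v ∧ num v ≤ n) ∧ Set.InjOn num (Set.Icc 1 n) ∧
        (∀ i < m, U i = max (num (s.arr 0 i + 1)) (num (s.arr 1 i + 1))) ∧
        (∀ i < m, V i = min (num (s.arr 0 i + 1)) (num (s.arr 1 i + 1))) ∧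
        BlockForest n m U V P cls ∧ Numbering n m U V P cls idx ∧
        (∀ t, s'.arr 13 t = #(remaining cls (classDegree m U V cls) P n t)) ∧
        (∀ i < m, s'.arr 14 i = idx (U i)) ∧
        (∀ i < m, s'.arr 15 i = lowerIndex U V cls idx i) ∧
        ∀ t ≤ n, s'.arr 17 t = #(classEdges U V cls idx m t) ∧
          (range (s'.arr 17 t)).image (fun q => s'.arr 16 (t * m + q)) =
            classEdges U V cls idx m t) := by
  unfold prepProg
  refine Ends.seq (edgeRowsProg_spec hB hX hn hm ha hb (hz 2 (by omega))) ?_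
  rintro t₁ s₁ f₁ ⟨ht₁, h2₁, htab₁⟩
  have z₁ : ∀ a, a ∈ [4, 5, 6, 8, 11, 13, 17, 18] → ∀ i, s₁.arr a i = 0 := by
    intro a ha i
    rw [f₁.2 a (by fin_cases ha <;> decide)]
    exact hz a (by fin_cases ha <;> decide) i
  have r₁ : s₁.reg 0 = n ∧ s₁.reg 1 = m := ⟨(f₁.1 0 (by decide)).trans hn,
    (f₁.1 1 (by decide)).trans hm⟩
  have a₁ : s₁.arr 0 = s.arr 0 ∧ s₁.arr 1 = s.arr 1 := ⟨f₁.2 0 (by decide), f₁.2 1 (by decide)⟩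
  refine Ends.seq (rootRowProg_spec hB hX r₁.1 htab₁) ?_
  rintro t₂ s₂ f₂ ⟨ht₂, htab₂⟩
  have z₂ : ∀ a, a ∈ [4, 5, 6, 8, 11, 13, 17, 18] → ∀ i, s₂.arr a i = 0 := by
    intro a ha i
    rw [f₂.2 a (by fin_cases ha <;> decide)]
    exact z₁ a ha i
  have r₂ : s₂.reg 0 = n ∧ s₂.reg 1 = m := ⟨(f₂.1 0 (by decide)).trans r₁.1,
    (f₂.1 1 (by decide)).trans r₁.2⟩
  have a₂ : s₂.arr 0 = s.arr 0 ∧ s₂.arr 1 = s.arr 1 := ⟨(f₂.2 0 (by decide)).trans a₁.1,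
    (f₂.2 1 (by decide)).trans a₁.2⟩
  refine Ends.seq (dfsProg_spec hB hX (R := Rel n m (s.arr 0) (s.arr 1)) ?_
    ((f₂.1 2 (by decide)).trans h2₁) htab₂ (z₂ 4 (by simp)) (z₂ 5 (by simp)) (z₂ 6 (by simp))) ?_
  · rintro v u (⟨i, hi, h⟩ | h)
    · have := ha i hi
      have := hb i hi
      omega
    · exact h.2
  rintro t₃ s₃ f₃ ⟨ht₃, cnt, μ, h0₃, hinv⟩
  have z₃ : ∀ a, a ∈ [8, 11, 13, 17, 18] → ∀ i, s₃.arr a i = 0 := by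
    intro a ha i
    rw [f₃.2 a (by fin_cases ha <;> decide)]
    exact z₂ a (by fin_cases ha <;> decide) i
  have r₃ : s₃.reg 0 = n ∧ s₃.reg 1 = m := ⟨(f₃.1 0 (by decide)).trans r₂.1,
    (f₃.1 1 (by decide)).trans r₂.2⟩
  have a₃ : s₃.arr 0 = s.arr 0 ∧ s₃.arr 1 = s.arr 1 := ⟨(f₃.2 0 (by decide)).trans a₂.1,
    (f₃.2 1 (by decide)).trans a₂.2⟩
  refine Ends.seq (lowProg_spec hB hX r₃.1 r₃.2 (by rwa [a₃.1]) (by rwa [a₃.2])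
    (z₃ 8 (by simp))) ?_
  rintro t₄ s₄ f₄ ⟨ht₄, hU, hV, hlow⟩
  rw [a₃.1, a₃.2] at hU hV
  have z₄ : ∀ a, a ∈ [11, 13, 17, 18] → ∀ i, s₄.arr a i = 0 := by
    intro a ha i
    rw [f₄.2 a (by fin_cases ha <;> decide)]
    exact z₃ a (by fin_cases ha <;> decide) i
  have r₄ : s₄.reg 0 = n ∧ s₄.reg 1 = m := ⟨(f₄.1 0 (by decide)).trans r₃.1,
    (f₄.1 1 (by decide)).trans r₃.2⟩
  obtain ⟨hF, hnum, hnuminj⟩ := hinv.forest h0₃ ha hb hab hinj hU hV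
  generalize s₃.arr 4 = num at hU hV hnum hnuminj
  obtain ⟨U, hUdef⟩ : ∃ U, U = s₄.arr 20 := ⟨_, rfl⟩
  obtain ⟨V, hVdef⟩ : ∃ V, V = s₄.arr 21 := ⟨_, rfl⟩
  obtain ⟨P, hPdef⟩ : ∃ P, P = s₃.arr 6 := ⟨_, rfl⟩
  have hP₄ : s₄.arr 6 = P := (f₄.2 6 (by decide)).trans hPdef.symm
  rw [← hUdef] at hU hlow hF
  rw [← hVdef] at hV hlow hF
  rw [← hPdef] at hF
  refine Ends.seq (pushProg_spec hB hX r₄.1 hF.upper_le (by rw [hP₄]; exact hF.parent_zero)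
    (by rw [hP₄]; exact hF.parent_lt) hlow) ?_
  rintro t₅ s₅ f₅ ⟨ht₅, hpush⟩
  rw [hP₄] at hpush
  have z₅ : ∀ a, a ∈ [11, 13, 17, 18] → ∀ i, s₅.arr a i = 0 := by
    intro a ha i
    rw [f₅.2 a (by fin_cases ha <;> decide)]
    exact z₄ a ha i
  have r₅ : s₅.reg 0 = n ∧ s₅.reg 1 = m := ⟨(f₅.1 0 (by decide)).trans r₄.1,
    (f₅.1 1 (by decide)).trans r₄.2⟩
  have a₅ : s₅.arr 20 = U ∧ s₅.arr 21 = V ∧ s₅.arr 6 = P := ⟨(f₅.2 20 (by decide)).trans hUdef.symm,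
    (f₅.2 21 (by decide)).trans hVdef.symm, (f₅.2 6 (by decide)).trans hP₄⟩
  refine Ends.seq (classProg_spec hB hX r₅.1 (by rw [a₅.2.2]; exact hF.parent_lt)) ?_
  rintro t₆ s₆ f₆ ⟨ht₆, hcls⟩
  have z₆ : ∀ a, a ∈ [11, 13, 17, 18] → ∀ i, s₆.arr a i = 0 := by
    intro a ha i
    rw [f₆.2 a (by fin_cases ha <;> decide)]
    exact z₅ a ha i
  have r₆ : s₆.reg 0 = n ∧ s₆.reg 1 = m := ⟨(f₆.1 0 (by decide)).trans r₅.1,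
    (f₆.1 1 (by decide)).trans r₅.2⟩
  have a₆ : s₆.arr 20 = U ∧ s₆.arr 21 = V ∧ s₆.arr 6 = P := ⟨(f₆.2 20 (by decide)).trans a₅.1,
    (f₆.2 21 (by decide)).trans a₅.2.1, (f₆.2 6 (by decide)).trans a₅.2.2⟩
  rw [a₅.2.2] at hcls
  generalize hcdef : s₆.arr 10 = cls at hcls
  have hBF : BlockForest n m U V P cls := by
    refine ⟨hF, fun x h1 h2 => ?_⟩
    rw [hcls x h1 h2]
    -- The stored values are differences from `n`. As `V i < n` and `P x < n`, truncation is
    -- harmless and the comparison means `V i < P x`.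
    have : n - P x < s₅.arr 8 x ↔ Covered m U V P x := by
      rw [hpush x h1 h2]
      have := hF.parent_lt x h1 h2
      refine exists_congr fun i => and_congr_right fun hi => and_congr_right fun _ => ?_
      have := hF.lower_lt i hi
      have := hF.upper_le i hi
      omega
    classical exact if_congr this rfl rfl
  refine Ends.seq (degProg_spec hB hX r₆.2 (z₆ 11 (by simp))) ?_
  rintro t₇ s₇ f₇ ⟨ht₇, hdeg⟩
  rw [a₆.1, a₆.2.1, hcdef] at hdeg
  have z₇ : ∀ a, a ∈ [13, 17, 18] → ∀ i, s₇.arr a i = 0 := by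
    intro a ha i
    rw [f₇.2 a (by fin_cases ha <;> decide)]
    exact z₆ a (by fin_cases ha <;> decide) i
  have r₇ : s₇.reg 0 = n ∧ s₇.reg 1 = m := ⟨(f₇.1 0 (by decide)).trans r₆.1,
    (f₇.1 1 (by decide)).trans r₆.2⟩
  have a₇ : s₇.arr 20 = U ∧ s₇.arr 21 = V ∧ s₇.arr 6 = P ∧ s₇.arr 10 = cls :=
    ⟨(f₇.2 20 (by decide)).trans a₆.1, (f₇.2 21 (by decide)).trans a₆.2.1,
    (f₇.2 6 (by decide)).trans a₆.2.2, (f₇.2 10 (by decide)).trans hcdef⟩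
  refine Ends.seq (indexProg_spec hB hX r₇.1 (by rw [a₇.2.2.1]; exact hF.parent_lt)
    (z₇ 13 (by simp))) ?_
  rintro t₈ s₈ f₈ ⟨ht₈, h13, hidx⟩
  rw [a₇.2.2.1, a₇.2.2.2, funext hdeg] at h13 hidx
  have z₈ : ∀ a, a ∈ [17, 18] → ∀ i, s₈.arr a i = 0 := by
    intro a ha i
    rw [f₈.2 a (by fin_cases ha <;> decide)]
    exact z₇ a (by fin_cases ha <;> decide) i
  have r₈ : s₈.reg 0 = n ∧ s₈.reg 1 = m := ⟨(f₈.1 0 (by decide)).trans r₇.1,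
    (f₈.1 1 (by decide)).trans r₇.2⟩
  have a₈ : s₈.arr 20 = U ∧ s₈.arr 21 = V ∧ s₈.arr 10 = cls :=
    ⟨(f₈.2 20 (by decide)).trans a₇.1, (f₈.2 21 (by decide)).trans a₇.2.1,
    (f₈.2 10 (by decide)).trans a₇.2.2.2⟩
  generalize hidef : s₈.arr 12 = idx at hidx
  apply Ends.mono (bucketProg_spec hB hX r₈.2 ?_ (z₈ 17 (by simp)))
  · rintro t₉ s₉ f₉ ⟨ht₉, h14, h15, h17⟩
    rw [a₈.1, hidef] at h14
    rw [a₈.1, a₈.2.1, a₈.2.2, hidef] at h15 h17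
    refine ⟨by omega, (f₉.1 0 (by decide)).trans r₈.1, (f₉.1 1 (by decide)).trans r₈.2, fun i => ?_,
      num, U, V, P, cls, idx, hnum, hnuminj, hU, hV, hBF,
      ⟨fun x h1 h2 => (hidx x h1 h2).1, fun x h1 h2 => (hidx x h1 h2).2⟩, ?_, h14, h15, h17⟩
    · rw [f₉.2 18 (by decide)]
      exact z₈ 18 (by simp) i
    · rw [f₉.2 13 (by decide)]
      exact h13
  · intro i hi
    rw [a₈.2.2, a₈.1]
    have h1 := hF.lower_pos i hi
    have h2 := hF.lower_lt i hi
    have h3 := hF.upper_le i hi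
    exact (hBF.cls_bounds (by omega) h3).2.trans h3

def mainProg (k : Bool) : Prog := prepProg ;; sumProg k

/-- An enumeration with as many terms as its image has elements is injective, so the sums can be
reindexed. -/
theorem cost_image (k : Bool) {M : ℕ} {S : Finset ℕ} {f : ℕ → ℕ} (hS : (range M).image f = S)
    (hM : M = #S) (U V : ℕ → ℕ) :
    cost k (range M) (fun j => U (f j)) (fun j => V (f j)) = cost k S U V := by
  have hinj : Set.InjOn f (range M) := by
    rw [← card_image_iff, hS, card_range, hM]
  subst hS
  rw [cost, cost, sum_image hinj]
  refine sum_congr rfl fun i _ => ?_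
  rw [sum_image hinj]

theorem cost_congr (k : Bool) {S : Finset ℕ} {U V U' V' : ℕ → ℕ} (hU : ∀ i ∈ S, U i = U' i)
    (hV : ∀ i ∈ S, V i = V' i) : cost k S U V = cost k S U' V' := by
  refine sum_congr rfl fun i hi => ?_
  congr 1
  refine sum_congr rfl fun j hj => ?_
  rw [hU i hi, hV i hi, hU j hj, hV j hj]

/-- The number of vertices of the contracted block with top vertex `t`. -/
noncomputable def blockOrder (n m : ℕ) (U V P cls : ℕ → ℕ) (t : ℕ) : ℕ :=
  #(remaining cls (classDegree m U V cls) P n t) + 1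

/-- Numbering, forest and blocks depend on the order of the edge list, so they are existentially
quantified; only the sum of the optima will turn out to be independent of them. -/
theorem mainProg_spec (k : Bool) {n w : ℕ} {G : SimpleGraph (Fin n)} {es : List (Fin n × Fin n)}
    (hes : IsEdgeList G es) (hw : (n + es.length + 2) ^ 4 ≤ 2 ^ w) :
    Ends w (mainProg k) (inputState n es) (fun t s' => ∃ num U V P cls idx best : ℕ → ℕ,
      t ≤ 1300 * (n + es.length + 1) + ∑ t ∈ range n, (blockOrder n es.length U V P cls (t + 1)).factorial *
        (1100 * (blockOrder n es.length U V P cls (t + 1) +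
            #(classEdges U V cls idx es.length (t + 1)) + 1) *
          (blockOrder n es.length U V P cls (t + 1) +
            #(classEdges U V cls idx es.length (t + 1)) + 1)) ∧
      (∀ v, 1 ≤ v → v ≤ n → 1 ≤ num v ∧ num v ≤ n) ∧ Set.InjOn num (Set.Icc 1 n) ∧
      (∀ i < es.length, U i = max (num (fstEnd es i + 1)) (num (sndEnd es i + 1))) ∧
      (∀ i < es.length, V i = min (num (fstEnd es i + 1)) (num (sndEnd es i + 1))) ∧
      BlockForest n es.length U V P cls ∧ Numbering n es.length U V P cls idx ∧
      s'.reg 0 = ∑ t ∈ range n, best (t + 1) ∧ ∀ t, 1 ≤ t → t ≤ n →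
        IsBest (es.length * es.length) (fun x => cost k (classEdges U V cls idx es.length t)
          (fun i => insertPos (digit x) (blockOrder n es.length U V P cls t) (idx (U i)))
          (fun i => insertPos (digit x) (blockOrder n es.length U V P cls t)
            (lowerIndex U V cls idx i)))
          (blockOrder n es.length U V P cls t).factorial (best t)) := by
  obtain ⟨m, hm⟩ : ∃ m, m = es.length := ⟨_, rfl⟩
  rw [← hm] at hw ⊢
  refine Ends.seq (prepProg_spec le_rfl hw (s := inputState n es) rfl hm.symm ?_ ?_ ?_ ?_ ?_) ?_
  · intro i hi
    have hi' : i < es.length := hm ▸ hi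
    change fstEnd es i < n
    rw [fstEnd_eq hi']
    exact es[i].1.2
  · intro i hi
    have hi' : i < es.length := hm ▸ hi
    change sndEnd es i < n
    rw [sndEnd_eq hi']
    exact es[i].2.2
  · intro i hi
    have hi' : i < es.length := hm ▸ hi
    change fstEnd es i ≠ sndEnd es i
    rw [fstEnd_eq hi', sndEnd_eq hi']
    exact fun h => (hes.adj hi').ne (Fin.ext h)
  · intro i hi j hj
    have hi' : i < es.length := hm ▸ hi
    have hj' : j < es.length := hm ▸ hj
    change (fstEnd es i = fstEnd es j ∧ sndEnd es i = sndEnd es j) ∨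
      (fstEnd es i = sndEnd es j ∧ sndEnd es i = fstEnd es j) → i = j
    rw [fstEnd_eq hi', sndEnd_eq hi', fstEnd_eq hj', sndEnd_eq hj']
    intro h
    apply hes.inj hi' hj'
    rw [Sym2.eq_iff]
    simpa only [Fin.val_inj] using h
  · intro a ha i
    have h0 : a ≠ 0 := by omega
    have h1 : a ≠ 1 := by omega
    simp [inputState, h0, h1]
  rintro t₁ s₁ - ⟨ht₁, hr0, hr1, hz, num, U, V, P, cls, idx, hnum, hinj, hU, hV, hBF, hN, h13, h14,
    h15, h17⟩
  have hmem : ∀ t ≤ n, ∀ j < s₁.arr 17 t,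
      s₁.arr 16 (t * m + j) ∈ classEdges U V cls idx m t := by
    intro t ht j hj
    rw [← (h17 t ht).2]
    exact mem_image_of_mem _ (mem_range.2 hj)
  have hbd : ∀ i < m, idx (U i) < s₁.arr 13 (cls (U i)) + 1 ∧
      lowerIndex U V cls idx i < s₁.arr 13 (cls (U i)) + 1 := by
    intro i hi
    have h1 := hBF.lower_pos i hi
    have h2 := hBF.lower_lt i hi
    have h3 := hBF.upper_le i hi
    have h4 := (hN.bounds hBF (x := U i) (by omega) h3).2
    have h5 := (hN.bounds hBF (x := V i) h1 (by omega)).2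
    rw [h13]
    refine ⟨by omega, ?_⟩
    unfold lowerIndex
    split_ifs with h6
    · rw [← h6]; omega
    · omega
  apply Ends.mono (sumProg_spec le_rfl hw k hr0 hr1 ?_ ?_ hz ?_ ?_)
  · rintro t s' - ⟨ht, best, h0, hbest⟩
    refine ⟨num, U, V, P, cls, idx, best, ?_, hnum, hinj, hU, hV, hBF, hN, h0, ?_⟩
    · have e1 : ∀ a b : ℕ, a + 1 + b + 1 = a + b + 2 := fun a b => by omega
      have e2 : ∑ t ∈ range n, (s₁.arr 13 (t + 1) + 1).factorial * (1100 *
          (s₁.arr 13 (t + 1) + s₁.arr 17 (t + 1) + 2) *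
            (s₁.arr 13 (t + 1) + s₁.arr 17 (t + 1) + 2)) =
          ∑ t ∈ range n, (blockOrder n m U V P cls (t + 1)).factorial *
        (1100 * (blockOrder n m U V P cls (t + 1) + #(classEdges U V cls idx m (t + 1)) + 1) *
          (blockOrder n m U V P cls (t + 1) + #(classEdges U V cls idx m (t + 1)) + 1)) := by
        refine sum_congr rfl fun t ht => ?_
        rw [(h17 (t + 1) (mem_range.1 ht)).1, h13, blockOrder, e1]
      rw [← e2]
      generalize (∑ t ∈ range n, (s₁.arr 13 (t + 1) + 1).factorial * (1100 *
          (s₁.arr 13 (t + 1) + s₁.arr 17 (t + 1) + 2) *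
            (s₁.arr 13 (t + 1) + s₁.arr 17 (t + 1) + 2))) = T at ht
      omega
    · intro t h1 h2
      have := hbest t h1 h2
      convert this using 1
      · funext x
        rw [drawingCost, h13]
        have hi := fun i (hi : i ∈ classEdges U V cls idx m t) =>
          mem_range.1 (mem_filter.1 hi).1
        rw [cost_image k (h17 t h2).2 (h17 t h2).1
          (fun j => insertPos (digit x) (#(remaining cls (classDegree m U V cls) P n t) + 1)
            (s₁.arr 14 j))
          (fun j => insertPos (digit x) (#(remaining cls (classDegree m U V cls) P n t) + 1)
            (s₁.arr 15 j))]
        exact (cost_congr k (fun i h => by rw [h14 i (hi i h), blockOrder])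
          (fun i h => by rw [h15 i (hi i h), blockOrder]))
      · rw [h13, blockOrder]
  · intro t ht
    rw [(h17 t ht).1]
    exact (card_filter_le _ _).trans (by simp)
  · intro t ht
    rw [h13]
    classical exact (card_filter_le _ _).trans (by simp)
  · intro t ht j hj
    have := hmem t ht j hj
    rw [classEdges, mem_filter, mem_range] at this
    have hlt := (hbd _ this.1).1
    rw [this.2.1] at hlt
    rwa [h14 _ this.1]
  · intro t ht j hj
    have := hmem t ht j hj
    rw [classEdges, mem_filter, mem_range] at this
    have hlt := (hbd _ this.1).2
    rw [this.2.1] at hlt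
    rwa [h15 _ this.1]

end OnePage

namespace OnePage

open Finset

/-! ### Optimal drawings -/

/-- The arc between `a` and `b` crosses the arc between `c` and `d`. -/
def Alt (a b c d : ℕ) : Prop :=
  c ≠ a ∧ c ≠ b ∧ d ≠ a ∧ d ≠ b ∧
    ((min a b < c ∧ c < max a b) ↔ ¬ (min a b < d ∧ d < max a b))

instance (a b c d : ℕ) : Decidable (Alt a b c d) := by unfold Alt; infer_instance

theorem Alt.symm {a b c d : ℕ} (h : Alt a b c d) : Alt c d a b := by
  unfold Alt at *; omega

theorem alt_comm {a b c d : ℕ} : Alt a b c d ↔ Alt c d a b := ⟨Alt.symm, Alt.symm⟩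

theorem alt_swap_left {a b c d : ℕ} : Alt a b c d ↔ Alt b a c d := by
  unfold Alt; rw [min_comm, max_comm]; tauto

theorem alt_swap_right {a b c d : ℕ} : Alt a b c d ↔ Alt a b d c := by
  rw [alt_comm, alt_swap_left, alt_comm]

theorem Alt.ne_left {a b c d : ℕ} (h : Alt a b c d) : a ≠ b := by
  unfold Alt at h; omega

theorem Alt.ne_right {a b c d : ℕ} (h : Alt a b c d) : c ≠ d := h.symm.ne_left

theorem alt_iff {a b c d : ℕ} : Alt a b c d ↔
    (a < c ∧ c < b ∧ b < d ∨ a < d ∧ d < b ∧ b < c ∨ b < c ∧ c < a ∧ a < d ∨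
      b < d ∧ d < a ∧ a < c) ∨
    (c < a ∧ a < d ∧ d < b ∨ c < b ∧ b < d ∧ d < a ∨ d < a ∧ a < c ∧ c < b ∨
      d < b ∧ b < c ∧ c < a) := by
  constructor
  · rintro ⟨h1, h2, h3, h4, h⟩
    rcases le_total a b with hab | hab
    · rw [min_eq_left hab, max_eq_right hab] at h
      by_cases hc : a < c ∧ c < b
      · rcases lt_or_gt_of_ne h3 with hd | hd
        · exact Or.inr (Or.inr (Or.inr (Or.inl ⟨hd, hc⟩)))
        · exact Or.inl (Or.inl ⟨hc.1, hc.2, by omega⟩)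
      · have hd : a < d ∧ d < b := by omega
        rcases lt_or_gt_of_ne h1 with hc | hc
        · exact Or.inr (Or.inl ⟨hc, hd⟩)
        · exact Or.inl (Or.inr (Or.inl ⟨hd.1, hd.2, by omega⟩))
    · rw [min_eq_right hab, max_eq_left hab] at h
      by_cases hc : b < c ∧ c < a
      · rcases lt_or_gt_of_ne h4 with hd | hd
        · exact Or.inr (Or.inr (Or.inr (Or.inr ⟨hd, hc⟩)))
        · exact Or.inl (Or.inr (Or.inr (Or.inl ⟨hc.1, hc.2, by omega⟩)))
      · have hd : b < d ∧ d < a := by omega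
        rcases lt_or_gt_of_ne h2 with hc | hc
        · exact Or.inr (Or.inr (Or.inl ⟨hc, hd⟩))
        · exact Or.inl (Or.inr (Or.inr (Or.inr ⟨hd.1, hd.2, by omega⟩)))
  · unfold Alt
    rintro ((h | h | h | h) | (h | h | h | h)) <;> omega

/-- Of two crossing arcs exactly one starts further left. -/
theorem cross_add_cross (a b c d : ℕ) :
    cross a b c d + cross c d a b = if Alt a b c d then 1 else 0 := by
  rw [cross_eq, cross_eq]
  by_cases h1 : a < c ∧ c < b ∧ b < d ∨ a < d ∧ d < b ∧ b < c ∨ b < c ∧ c < a ∧ a < d ∨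
      b < d ∧ d < a ∧ a < c
  · rw [if_pos h1, if_pos (alt_iff.2 (Or.inl h1)), if_neg]
    rcases h1 with h1 | h1 | h1 | h1 <;> omega
  · rw [if_neg h1, zero_add]
    refine if_congr ?_ rfl rfl
    rw [alt_iff, or_iff_right h1]

theorem alt_congr {a b c d a' b' c' d' : ℕ} {s : Set ℕ} {f : ℕ → ℕ} (hf : StrictMonoOn f s)
    (ha : a ∈ s) (hb : b ∈ s) (hc : c ∈ s) (hd : d ∈ s) (ea : a' = f a) (eb : b' = f b)
    (ec : c' = f c) (ed : d' = f d) : Alt a' b' c' d' ↔ Alt a b c d := by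
  subst ea eb ec ed
  simp only [alt_iff, hf.lt_iff_lt ha hc, hf.lt_iff_lt ha hd,
    hf.lt_iff_lt hb hc, hf.lt_iff_lt hb hd, hf.lt_iff_lt hc ha,
    hf.lt_iff_lt hc hb, hf.lt_iff_lt hd ha, hf.lt_iff_lt hd hb]

/-- Adding the double sum with exchanged indices makes it symmetric, so that both cost functions are
expressed through `Alt`. -/
theorem two_mul_cost_false (S : Finset ℕ) (U V : ℕ → ℕ) :
    2 * cost false S U V = #{x ∈ S ×ˢ S | Alt (U x.1) (V x.1) (U x.2) (V x.2)} := by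
  have : cost false S U V = ∑ i ∈ S, ∑ j ∈ S, cross (U i) (V i) (U j) (V j) := rfl
  rw [card_filter, sum_product, two_mul]
  nth_rw 2 [this]
  rw [sum_comm, this, ← sum_add_distrib]
  refine sum_congr rfl fun i _ => ?_
  rw [← sum_add_distrib]
  exact sum_congr rfl fun j _ => cross_add_cross _ _ _ _

theorem cost_true (S : Finset ℕ) (U V : ℕ → ℕ) :
    cost true S U V = #{i ∈ S | ∃ j ∈ S, Alt (U i) (V i) (U j) (V j)} := by
  rw [card_filter]
  refine sum_congr rfl fun i _ => ?_
  have : ∀ j, pairCost true (U i) (V i) (U j) (V j) =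
      if Alt (U i) (V i) (U j) (V j) then 1 else 0 := fun j => cross_add_cross _ _ _ _
  simp only [this, edgeCost, if_true, ltNat]
  refine if_congr ?_ rfl rfl
  rw [Nat.pos_iff_ne_zero, Ne, sum_eq_zero_iff]
  simp

theorem cost_le_sq (k : Bool) (S : Finset ℕ) (U V : ℕ → ℕ) : cost k S U V ≤ #S * #S := by
  cases k with
  | false =>
    have : cost false S U V = ∑ i ∈ S, ∑ j ∈ S, cross (U i) (V i) (U j) (V j) := rfl
    rw [this, ← card_product, card_eq_sum_ones, sum_product]
    exact sum_le_sum fun i _ => sum_le_sum fun j _ => cross_le _ _ _ _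
  | true =>
    rw [cost_true]
    refine (card_filter_le _ _).trans ?_
    rcases Nat.eq_zero_or_pos (#S) with h | h
    · omega
    · exact Nat.le_mul_of_pos_left _ h

/-- Drawings are compared by redirecting an edge `i₁` to an edge `i₀` that is not crossed. -/
theorem cost_le_of_redirect (k : Bool) {S : Finset ℕ} {U V U' V' : ℕ → ℕ} {i₀ i₁ : ℕ} (h₀ : i₀ ∈ S)
    (h0 : i₀ = i₁ ∨ ∀ j ∈ S, ¬ Alt (U' i₀) (V' i₀) (U' j) (V' j))
    (h : ∀ i ∈ S, ∀ j ∈ S, Alt (U' i) (V' i) (U' j) (V' j) → Alt (U i) (V i) (U j) (V j) ∨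
      Alt (U (if i = i₁ then i₀ else i)) (V (if i = i₁ then i₀ else i))
        (U (if j = i₁ then i₀ else j)) (V (if j = i₁ then i₀ else j))) :
    cost k S U' V' ≤ cost k S U V := by
  obtain ⟨σ, hσ⟩ : ∃ σ : ℕ → ℕ, ∀ i, σ i = if i = i₁ then i₀ else i := ⟨_, fun _ => rfl⟩
  simp only [← hσ] at h
  have hσS : ∀ i ∈ S, σ i ∈ S := by
    intro i hi
    rw [hσ]; split_ifs
    · exact h₀
    · exact hi
  -- Unless redirection is trivial, `i₀` takes part in no crossing of the new drawing, so it is free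
  -- to receive those of `i₁`.
  have hne : ∀ i ∈ S, ∀ j ∈ S, Alt (U' i) (V' i) (U' j) (V' j) → i₀ = i₁ ∨ i ≠ i₀ ∧ j ≠ i₀ := by
    intro i hi j hj hA
    rcases h0 with h0 | h0
    · exact Or.inl h0
    · right
      constructor
      · rintro rfl
        exact h0 j hj hA
      · rintro rfl
        exact h0 i hi hA.symm
  cases k with
  | false =>
    suffices 2 * cost false S U' V' ≤ 2 * cost false S U V by omega
    rw [two_mul_cost_false, two_mul_cost_false]
    -- A crossing that exists in the old drawing is kept, any other is moved from `i₁` to `i₀`. If a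
    -- kept and a moved crossing coincided, the kept one would contain `i₀`, contrary to `hne`.
    apply card_le_card_of_injOn (fun x => if Alt (U x.1) (V x.1) (U x.2) (V x.2) then x else
      (σ x.1, σ x.2))
    · rintro ⟨i, j⟩ hx
      simp only [coe_filter, mem_product, Set.mem_ofPred_eq] at hx
      obtain ⟨⟨hi, hj⟩, hA⟩ := hx
      dsimp only
      split_ifs with hc
      · simp [hi, hj, hc]
      · have := (h i hi j hj hA).resolve_left hc
        simp [hσS i hi, hσS j hj, this]
    · rintro ⟨i, j⟩ hx ⟨i', j'⟩ hx' he
      simp only [coe_filter, mem_product, Set.mem_ofPred_eq] at hx hx'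
      have hn := hne i hx.1.1 j hx.1.2 hx.2
      have hn' := hne i' hx'.1.1 j' hx'.1.2 hx'.2
      have h1 := h i hx.1.1 j hx.1.2 hx.2
      have h2 := h i' hx'.1.1 j' hx'.1.2 hx'.2
      dsimp only at he
      by_cases hc : Alt (U i) (V i) (U j) (V j)
      · by_cases hc' : Alt (U i') (V i') (U j') (V j')
        · rwa [if_pos hc, if_pos hc'] at he
        · rw [if_pos hc, if_neg hc'] at he
          have h2 := h2.resolve_left hc'
          simp only [Prod.mk.injEq] at he ⊢
          by_cases e1 : i' = i₁
          · rw [hσ, hσ, if_pos e1] at he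
            have : i₀ = i₁ := by omega
            rw [this] at he
            split_ifs at he <;> omega
          · by_cases e2 : j' = i₁
            · rw [hσ, hσ, if_pos e2] at he
              have : i₀ = i₁ := by omega
              rw [this] at he
              split_ifs at he
              omega
            · rw [hσ, hσ, if_neg e1, if_neg e2] at h2
              exact absurd h2 hc'
      · have h1 := h1.resolve_left hc
        by_cases hc' : Alt (U i') (V i') (U j') (V j')
        · rw [if_neg hc, if_pos hc'] at he
          simp only [Prod.mk.injEq] at he ⊢
          by_cases e1 : i = i₁
          · rw [hσ, hσ, if_pos e1] at he
            have : i₀ = i₁ := by omega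
            rw [this] at he
            split_ifs at he <;> omega
          · by_cases e2 : j = i₁
            · rw [hσ, hσ, if_pos e2] at he
              have : i₀ = i₁ := by omega
              rw [this] at he
              split_ifs at he
              omega
            · rw [hσ, hσ, if_neg e1, if_neg e2] at h1
              exact absurd h1 hc
        · rw [if_neg hc, if_neg hc'] at he
          simp only [Prod.mk.injEq] at he ⊢
          simp only [hσ] at he
          split_ifs at he <;> omega
  | true =>
    rw [cost_true, cost_true]
    apply card_le_card_of_injOn (fun i => if ∃ j ∈ S, Alt (U i) (V i) (U j) (V j) then i else σ i)
    · intro i hi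
      simp only [coe_filter, Set.mem_ofPred_eq] at hi
      obtain ⟨hi, j, hj, hA⟩ := hi
      dsimp only
      split_ifs with hc
      · simpa [hi] using hc
      · rcases h i hi j hj hA with h1 | h1
        · exact absurd ⟨j, hj, h1⟩ hc
        · have h2 : ∃ j ∈ S, Alt (U (σ i)) (V (σ i)) (U j) (V j) := ⟨σ j, hσS j hj, h1⟩
          simpa [hσS i hi] using h2
    · intro i hi i' hi' he
      simp only [coe_filter, Set.mem_ofPred_eq] at hi hi'
      obtain ⟨hi, j, hj, hA⟩ := hi
      obtain ⟨hi', j', hj', hA'⟩ := hi'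
      have hn := hne i hi j hj hA
      have hn' := hne i' hi' j' hj' hA'
      dsimp only at he
      simp only [hσ] at he
      split_ifs at he <;> omega

theorem cost_mono (k : Bool) {S : Finset ℕ} {U V U' V' : ℕ → ℕ}
    (h : ∀ i ∈ S, ∀ j ∈ S, Alt (U' i) (V' i) (U' j) (V' j) → Alt (U i) (V i) (U j) (V j)) :
    cost k S U' V' ≤ cost k S U V := by
  rcases S.eq_empty_or_nonempty with rfl | ⟨i₀, h₀⟩
  · simp [cost]
  · exact cost_le_of_redirect k h₀ (Or.inl rfl) fun i hi j hj hA => Or.inl (h i hi j hj hA)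

theorem cost_eq_of_alt (k : Bool) {S : Finset ℕ} {U V U' V' : ℕ → ℕ}
    (h : ∀ i ∈ S, ∀ j ∈ S, Alt (U' i) (V' i) (U' j) (V' j) ↔ Alt (U i) (V i) (U j) (V j)) :
    cost k S U' V' = cost k S U V :=
  le_antisymm (cost_mono k fun i hi j hj => (h i hi j hj).1)
    (cost_mono k fun i hi j hj => (h i hi j hj).2)

theorem pairCost_eq_zero (k : Bool) {a b c d : ℕ} (h : ¬ Alt a b c d) : pairCost k a b c d = 0 := by
  have := cross_add_cross a b c d
  rw [if_neg h] at this
  unfold pairCost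
  split_ifs <;> omega

theorem cost_union (k : Bool) {S T : Finset ℕ} {U V : ℕ → ℕ} (hd : Disjoint S T)
    (h : ∀ i ∈ S, ∀ j ∈ T, ¬ Alt (U i) (V i) (U j) (V j)) :
    cost k (S ∪ T) U V = cost k S U V + cost k T U V := by
  rw [cost, sum_union hd]
  congr 1
  · refine sum_congr rfl fun i hi => ?_
    rw [sum_union hd, sum_eq_zero (s := T) fun j hj => pairCost_eq_zero k (h i hi j hj), add_zero]
  · refine sum_congr rfl fun i hi => ?_
    rw [sum_union hd, sum_eq_zero (s := S) fun j hj => pairCost_eq_zero k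
      fun hA => h j hj i hi hA.symm, zero_add]

theorem edgeCost_mono (k : Bool) {x y : ℕ} (h : x ≤ y) : edgeCost k x ≤ edgeCost k y := by
  unfold edgeCost ltNat
  split_ifs <;> omega

theorem cost_union_ge (k : Bool) {S T : Finset ℕ} {U V : ℕ → ℕ} (hd : Disjoint S T) :
    cost k S U V + cost k T U V ≤ cost k (S ∪ T) U V := by
  rw [cost, cost, cost, sum_union hd]
  refine add_le_add (sum_le_sum fun i _ => edgeCost_mono k ?_)
    (sum_le_sum fun i _ => edgeCost_mono k ?_) <;> rw [sum_union hd] <;> omega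

/-- The endpoints of the edges in `S`. -/
def verts (S : Finset ℕ) (U V : ℕ → ℕ) : Finset ℕ := S.image U ∪ S.image V

theorem left_mem_verts {S : Finset ℕ} {U : ℕ → ℕ} (V : ℕ → ℕ) {i : ℕ} (hi : i ∈ S) :
    U i ∈ verts S U V := mem_union_left _ (mem_image_of_mem _ hi)

theorem right_mem_verts {S : Finset ℕ} (U : ℕ → ℕ) {V : ℕ → ℕ} {i : ℕ} (hi : i ∈ S) :
    V i ∈ verts S U V := mem_union_right _ (mem_image_of_mem _ hi)

/-- The minimum cost of a drawing of the graph with edges `U i, V i` for `i ∈ S`. -/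
noncomputable def opt (k : Bool) (S : Finset ℕ) (U V : ℕ → ℕ) : ℕ :=
  sInf {c | ∃ p : ℕ → ℕ, Set.InjOn p (verts S U V) ∧
    c = cost k S (fun i => p (U i)) (fun i => p (V i))}

theorem opt_le (k : Bool) {S : Finset ℕ} {U V : ℕ → ℕ} {p : ℕ → ℕ}
    (hp : Set.InjOn p (verts S U V)) :
    opt k S U V ≤ cost k S (fun i => p (U i)) (fun i => p (V i)) :=
  Nat.sInf_le ⟨p, hp, rfl⟩

theorem injOn_extend {p : ℕ → ℕ} {A : Finset ℕ} (hp : Set.InjOn p A) :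
    ∃ q : ℕ → ℕ, Function.Injective q ∧ ∀ x ∈ A, q x = p x := by
  classical
  refine ⟨fun x => if x ∈ A then p x else (A.sup p + 1) + x, fun x y hxy => ?_, fun x hx => if_pos hx⟩
  dsimp only at hxy
  have hb : ∀ x ∈ A, p x ≤ A.sup p := fun x hx => le_sup (f := p) hx
  split_ifs at hxy with h1 h2 h2
  · exact hp h1 h2 hxy
  · have := hb x h1; omega
  · have := hb y h2; omega
  · omega

/-- Only the positions of endpoints matter, so an optimal drawing may be taken injective on all of
`ℕ`; later constructions are thus freed from membership conditions. -/
theorem exists_opt (k : Bool) (S : Finset ℕ) (U V : ℕ → ℕ) :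
    ∃ p : ℕ → ℕ, Function.Injective p ∧ opt k S U V =
      cost k S (fun i => p (U i)) (fun i => p (V i)) := by
  obtain ⟨p, hp, h⟩ := Nat.sInf_mem (s := {c | ∃ p : ℕ → ℕ, Set.InjOn p (verts S U V) ∧
    c = cost k S (fun i => p (U i)) (fun i => p (V i))}) ⟨_, id, Set.injOn_id _, rfl⟩
  obtain ⟨q, hq, hqp⟩ := injOn_extend hp
  refine ⟨q, hq, h.trans (cost_congr k (fun i hi => ?_) fun i hi => ?_)⟩
  · exact (hqp _ (left_mem_verts V hi)).symm
  · exact (hqp _ (right_mem_verts U hi)).symm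

theorem opt_relabel (k : Bool) {S : Finset ℕ} {U V f : ℕ → ℕ} (hf : Set.InjOn f (verts S U V)) :
    opt k S (fun i => f (U i)) (fun i => f (V i)) = opt k S U V := by
  apply le_antisymm
  · obtain ⟨p, hp, h⟩ := exists_opt k S U V
    obtain ⟨g, hg⟩ : ∃ g : ℕ → ℕ, ∀ x ∈ verts S U V, g (f x) = x :=
      ⟨Function.invFunOn f (verts S U V), fun x hx => hf.leftInvOn_invFunOn hx⟩
    have hq : Set.InjOn (fun x => p (g x)) (verts S (fun i => f (U i)) fun i => f (V i)) := by
      have : verts S (fun i => f (U i)) (fun i => f (V i)) = (verts S U V).image f := by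
        simp only [verts, image_union, image_image]; rfl
      rw [this]
      intro x hx y hy hxy
      obtain ⟨x, hx', rfl⟩ := mem_image.1 (mem_coe.1 hx)
      obtain ⟨y, hy', rfl⟩ := mem_image.1 (mem_coe.1 hy)
      have := hp hxy
      rw [hg x hx', hg y hy'] at this
      rw [this]
    refine (opt_le k hq).trans_eq (h.symm ▸ ?_)
    exact cost_congr k (fun i hi => by rw [hg _ (left_mem_verts V hi)])
      fun i hi => by rw [hg _ (right_mem_verts U hi)]
  · obtain ⟨p, hp, h⟩ := exists_opt k S (fun i => f (U i)) (fun i => f (V i))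
    rw [h]
    exact opt_le k (p := fun x => p (f x)) fun x hx y hy hxy => hf hx hy (hp hxy)

/-- The two ends of a loop coincide in every drawing, so it alternates with no arc. -/
theorem opt_filter_ne (k : Bool) (S : Finset ℕ) (U V : ℕ → ℕ) :
    opt k {i ∈ S | U i ≠ V i} U V = opt k S U V := by
  have hS : ∀ p : ℕ → ℕ, cost k {i ∈ S | U i ≠ V i} (fun i => p (U i)) (fun i => p (V i)) =
      cost k S (fun i => p (U i)) (fun i => p (V i)) := by
    intro p
    have h1 := cost_union k (U := fun i => p (U i)) (V := fun i => p (V i))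
      (disjoint_filter_filter_not S S (fun i => U i ≠ V i)) (fun i hi j hj hA => by
        have := (mem_filter.1 hj).2
        rw [not_not] at this
        exact hA.ne_right (congrArg p this))
    rw [filter_union_filter_not_eq] at h1
    rw [h1]
    have : cost k {i ∈ S | ¬ U i ≠ V i} (fun i => p (U i)) (fun i => p (V i)) = 0 := by
      refine sum_eq_zero fun i hi => ?_
      rw [sum_eq_zero]
      · exact Nat.le_zero.1 (edgeCost_le k 0)
      · intro j hj
        refine pairCost_eq_zero k fun hA => ?_
        have := (mem_filter.1 hj).2
        rw [not_not] at this
        exact hA.ne_right (congrArg p this)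
    omega
  apply le_antisymm
  · obtain ⟨p, hp, h⟩ := exists_opt k S U V
    rw [h, ← hS]
    exact opt_le k hp.injOn
  · obtain ⟨p, hp, h⟩ := exists_opt k {i ∈ S | U i ≠ V i} U V
    rw [h, hS]
    exact opt_le k hp.injOn

theorem opt_swap (k : Bool) {S : Finset ℕ} {U V U' V' : ℕ → ℕ}
    (h : ∀ i ∈ S, (U' i = U i ∧ V' i = V i) ∨ (U' i = V i ∧ V' i = U i)) :
    opt k S U' V' = opt k S U V := by
  have hc : ∀ p : ℕ → ℕ, cost k S (fun i => p (U' i)) (fun i => p (V' i)) =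
      cost k S (fun i => p (U i)) (fun i => p (V i)) := by
    intro p
    refine cost_eq_of_alt k fun i hi j hj => ?_
    rcases h i hi with ⟨e1, e2⟩ | ⟨e1, e2⟩ <;> rcases h j hj with ⟨e3, e4⟩ | ⟨e3, e4⟩ <;>
      simp only [e1, e2, e3, e4]
    · exact alt_swap_right
    · exact alt_swap_left
    · exact alt_swap_left.trans alt_swap_right
  apply le_antisymm
  · obtain ⟨p, hp, h⟩ := exists_opt k S U V
    rw [h, ← hc]
    exact opt_le k hp.injOn
  · obtain ⟨p, hp, h⟩ := exists_opt k S U' V'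
    rw [h, hc]
    exact opt_le k hp.injOn

theorem opt_union_ge (k : Bool) {S T : Finset ℕ} {U V : ℕ → ℕ} (hd : Disjoint S T) :
    opt k S U V + opt k T U V ≤ opt k (S ∪ T) U V := by
  obtain ⟨p, hp, h⟩ := exists_opt k (S ∪ T) U V
  rw [h]
  exact (add_le_add (opt_le k hp.injOn) (opt_le k hp.injOn)).trans (cost_union_ge k hd)

/-- Graphs with at most one common vertex can be drawn without crossings between them. -/
theorem opt_union (k : Bool) {S T : Finset ℕ} {U V : ℕ → ℕ} (hd : Disjoint S T) {v : ℕ}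
    (hv : ∀ x ∈ verts S U V, x ∈ verts T U V → x = v) :
    opt k (S ∪ T) U V = opt k S U V + opt k T U V := by
  refine le_antisymm ?_ (opt_union_ge k hd)
  obtain ⟨p, hp, hpS⟩ := exists_opt k S U V
  obtain ⟨q, hq, hqT⟩ := exists_opt k T U V
  -- The vertex `v` is inserted because it need not be an end of an edge in `T`.
  obtain ⟨B, hB⟩ : ∃ B, ∀ x ∈ insert v (verts T U V), q x < B :=
    ⟨_, fun x hx => Nat.lt_succ_iff.2 (le_sup (f := q) hx)⟩
  -- Cyclic rotation of the positions `0, …, B - 1` that brings `v` to `0`. Alternation depends only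
  -- on the cyclic order, which is `hrot`.
  obtain ⟨r, hr⟩ : ∃ r : ℕ → ℕ, ∀ x, r x = if q x < q v then q x + B - q v else q x - q v :=
    ⟨_, fun _ => rfl⟩
  have hqv := hB v (mem_insert_self _ _)
  have hrB : ∀ x ∈ verts T U V, r x < B := fun x hx => by
    have := hB x (mem_insert_of_mem hx)
    rw [hr]; split_ifs <;> omega
  have hrinj : ∀ x ∈ verts T U V, ∀ y ∈ verts T U V, r x = r y → x = y := by
    intro x hx y hy h
    have := hB x (mem_insert_of_mem hx)
    have := hB y (mem_insert_of_mem hy)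
    apply hq
    rw [hr, hr] at h
    split_ifs at h <;> omega
  have hrot : ∀ a ∈ verts T U V, ∀ b ∈ verts T U V, ∀ c ∈ verts T U V, ∀ d ∈ verts T U V,
      (Alt (r a) (r b) (r c) (r d) ↔ Alt (q a) (q b) (q c) (q d)) := by
    intro a ha b hb c hc d hd
    have := hB a (mem_insert_of_mem ha)
    have := hB b (mem_insert_of_mem hb)
    have := hB c (mem_insert_of_mem hc)
    have := hB d (mem_insert_of_mem hd)
    simp only [hr]
    unfold Alt
    split_ifs <;> omega
  have hrv : r v = 0 := by rw [hr]; simp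
  -- The drawing of `S` is stretched by `B`, and the rotated drawing of `T` fits into the gap that
  -- opens at `v`.
  obtain ⟨f, hf⟩ : ∃ f : ℕ → ℕ, ∀ x, f x = if x ∈ verts S U V then B * p x else B * p v + r x :=
    ⟨_, fun _ => rfl⟩
  have hfS : ∀ x ∈ verts S U V, f x = B * p x := fun x hx => by rw [hf, if_pos hx]
  have hfT : ∀ x ∈ verts T U V, f x = B * p v + r x := fun x hx => by
    rw [hf]
    split_ifs with h
    · rw [hv x h hx, hrv, add_zero]
    · rfl
  have hcmp : ∀ x y, p x < p y → B * p x + B ≤ B * p y := fun x y h => by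
    have := Nat.mul_le_mul_left B (Nat.succ_le_of_lt h)
    rwa [Nat.mul_succ] at this
  have halt : ∀ a b c d, Alt (B * p a) (B * p b) (B * p c) (B * p d) ↔
      Alt (p a) (p b) (p c) (p d) := by
    intro a b c d
    refine alt_congr (s := Set.univ) (f := fun x => B * x) (fun x _ y _ h => ?_) trivial trivial
      trivial trivial rfl rfl rfl rfl
    exact (Nat.mul_lt_mul_left (by omega)).2 h
  have hinj : Set.InjOn f (verts (S ∪ T) U V) := by
    intro x hx y hy hxy
    have hST : ∀ x ∈ verts (S ∪ T) U V, x ∈ verts S U V ∨ x ∈ verts T U V := by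
      intro x hx
      simp only [verts, image_union, mem_union] at hx ⊢
      tauto
    by_cases h1 : x ∈ verts S U V <;> by_cases h2 : y ∈ verts S U V
    · rw [hfS x h1, hfS y h2] at hxy
      exact hp (Nat.eq_of_mul_eq_mul_left (by omega) hxy)
    · have h3 := (hST y hy).resolve_left h2
      have := hrB y h3
      rw [hfS x h1, hfT y h3] at hxy
      rcases lt_trichotomy (p x) (p v) with h | h | h
      · have := hcmp x v h; omega
      · have : r y = r v := by rw [hrv]; rw [h] at hxy; omega
        rw [hrv] at this
        rw [hr] at this
        have hBy := hB y (mem_insert_of_mem h3)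
        have hqy : q y = q v := by split_ifs at this <;> omega
        rw [hp h, hq hqy]
      · have := hcmp v x h; omega
    · have h3 := (hST x hx).resolve_left h1
      have := hrB x h3
      rw [hfS y h2, hfT x h3] at hxy
      rcases lt_trichotomy (p y) (p v) with h | h | h
      · have := hcmp y v h; omega
      · have : r x = r v := by rw [hrv]; rw [h] at hxy; omega
        rw [hrv] at this
        rw [hr] at this
        have hBy := hB x (mem_insert_of_mem h3)
        have hqy : q x = q v := by split_ifs at this <;> omega
        rw [hp h, hq hqy]
      · have := hcmp v y h; omega
    · have h3 := (hST x hx).resolve_left h1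
      have h4 := (hST y hy).resolve_left h2
      rw [hfT x h3, hfT y h4] at hxy
      exact hrinj x h3 y h4 (by omega)
  refine (opt_le k hinj).trans_eq ?_
  rw [cost_union k hd]
  · rw [hpS, hqT]
    congr 1
    · refine cost_eq_of_alt k fun i hi j hj => ?_
      rw [hfS _ (left_mem_verts V hi), hfS _ (right_mem_verts U hi), hfS _ (left_mem_verts V hj),
        hfS _ (right_mem_verts U hj), halt]
    · refine cost_eq_of_alt k fun i hi j hj => ?_
      have h1 := left_mem_verts (U := U) V hi
      have h2 := right_mem_verts U (V := V) hi
      have h3 := left_mem_verts (U := U) V hj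
      have h4 := right_mem_verts U (V := V) hj
      rw [hfT _ h1, hfT _ h2, hfT _ h3, hfT _ h4, ← hrot _ h1 _ h2 _ h3 _ h4]
      unfold Alt
      omega
  · intro i hi j hj
    have h3 := left_mem_verts (U := U) V hj
    have h4 := right_mem_verts U (V := V) hj
    have hb3 := hrB _ h3
    have hb4 := hrB _ h4
    -- No vertex of `S` lies strictly inside the gap that holds `T`, so no arc of `S` separates two
    -- vertices of `T`.
    have key : ∀ x, B * p x ≤ B * p v ∨ B * p v + B ≤ B * p x := fun x => by
      rcases le_or_gt (p x) (p v) with h | h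
      · exact Or.inl (Nat.mul_le_mul_left _ h)
      · exact Or.inr (hcmp v x h)
    have k1 := key (U i)
    have k2 := key (V i)
    rw [hfS _ (left_mem_verts V hi), hfS _ (right_mem_verts U hi), hfT _ h3, hfT _ h4, alt_comm]
    unfold Alt
    omega

end OnePage

namespace OnePage

open Finset

/-! ### Contraction of edges between vertices of degree at most two -/

/-- The number of edges at `x` that are not loops. -/
def edgeDegree (S : Finset ℕ) (U V : ℕ → ℕ) (x : ℕ) : ℕ :=
  #{i ∈ S | U i ≠ V i ∧ (U i = x ∨ V i = x)}

/-- Replace `z` by `u`. -/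
def redirect (z u x : ℕ) : ℕ := if x = z then u else x

/-- If `e` is the only element, the witness is `e` itself; this covers a contracted edge with an end
of degree one. -/
theorem exists_other_edge {T : Finset ℕ} {e : ℕ} (hT : #T ≤ 2) (he : e ∈ T) :
    ∃ e' ∈ T, ∀ i ∈ T, i = e ∨ i = e' := by
  by_cases h : ∃ e' ∈ T, e' ≠ e
  · obtain ⟨e', he', hne⟩ := h
    refine ⟨e', he', fun i hi => ?_⟩
    by_contra! hc
    have : #({e, e', i} : Finset ℕ) ≤ #T := card_le_card (by
      intro x hx; simp only [mem_insert, mem_singleton] at hx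
      rcases hx with rfl | rfl | rfl <;> assumption)
    rw [card_insert_of_notMem (by simp [hne.symm, hc.1.symm]),
      card_insert_of_notMem (by simp [hc.2.symm]), card_singleton] at this
    omega
  · push Not at h
    exact ⟨e, he, fun i hi => Or.inl (h i hi)⟩

/-- The arc `cd` separates `u` from `a`. Since `z` is not one of its ends, it lies on one of the two
sides and is separated from `a` or from `u`. -/
theorem Alt.triangle {a z u c d : ℕ} (h : Alt u a c d) (hc : c ≠ z) (hd : d ≠ z) :
    Alt z a c d ∨ Alt z u c d := by
  unfold Alt at *; omega

/-- Old vertices occupy odd positions. The reinserted vertex gets an even position next to `2 * x +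
1`, so no old vertex lies between the two. -/
theorem not_alt_adjacent {x s c d : ℕ} (hs : s = 0 ∨ s = 2) (hc : c % 2 = 1) (hd : d % 2 = 1) :
    ¬ Alt (2 * x + s) (2 * x + 1) c d := by
  unfold Alt; omega

theorem alt_double {a b c d : ℕ} :
    Alt (2 * a + 1) (2 * b + 1) (2 * c + 1) (2 * d + 1) ↔ Alt a b c d :=
  alt_congr (s := Set.univ) (f := fun x => 2 * x + 1)
    (fun x _ y _ h => by dsimp only; omega) trivial trivial trivial trivial rfl rfl rfl rfl

theorem Alt.of_adjacent {x s a c d : ℕ} (hs : s = 0 ∨ s = 2)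
    (h : Alt (2 * x + s) (2 * a + 1) (2 * c + 1) (2 * d + 1)) (hc : c ≠ x) (hd : d ≠ x) :
    Alt x a c d := by
  rw [← alt_double]
  unfold Alt at *; omega

/-- There is a side of `x` from which `a` can be reached without crossing the arc from `x` to `b`. -/
theorem exists_side (x a b : ℕ) : ∃ s, (s = 0 ∨ s = 2) ∧
    ¬ Alt (2 * x + s) (2 * a + 1) (2 * x + 1) (2 * b + 1) := by
  -- The side is chosen so that the new vertex lies under the arc from `x` to `b` exactly when `a`
  -- does.
  by_cases h : (x < b ∧ x < a ∧ a < b) ∨ (b < x ∧ ¬ (b < a ∧ a < x))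
  · refine ⟨2, Or.inr rfl, ?_⟩
    unfold Alt; omega
  · refine ⟨0, Or.inl rfl, ?_⟩
    unfold Alt; omega

section

variable {S : Finset ℕ} {U V : ℕ → ℕ} {z u e : ℕ}

/-- The degree bound at `z` makes the edge to `a` the only one besides `e` that moves; its
additional crossings are charged to `e`. The degree bound at `u` leaves only one edge, the one to
`b`, from which the reinserted `z` has to be kept away. -/
theorem opt_redirect (k : Bool) (he : e ∈ S) (hzu : z ≠ u)
    (hend : U e = z ∧ V e = u ∨ U e = u ∧ V e = z) (hz : edgeDegree S U V z ≤ 2)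
    (hu : edgeDegree S U V u ≤ 2) :
    opt k S (fun i => redirect z u (U i)) (fun i => redirect z u (V i)) = opt k S U V := by
  have hloop : U e ≠ V e := by omega
  obtain ⟨e₁, he₁, hT₁⟩ := exists_other_edge hz (e := e) (mem_filter.2 ⟨he, hloop, by omega⟩)
  obtain ⟨e₂, he₂, hT₂⟩ := exists_other_edge hu (e := e) (mem_filter.2 ⟨he, hloop, by omega⟩)
  simp only [mem_filter, and_imp] at he₁ hT₁ he₂ hT₂
  have hred : ∀ x, x ≠ z → redirect z u x = x := fun x hx => if_neg hx
  have hredz : redirect z u z = u := if_pos rfl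
  have hrede : redirect z u (U e) = u ∧ redirect z u (V e) = u := by
    rcases hend with ⟨h1, h2⟩ | ⟨h1, h2⟩ <;> rw [h1, h2, hredz, hred u hzu.symm] <;> simp
  have hother : ∃ a, a ≠ z ∧ (U e₁ = z ∧ V e₁ = a ∨ U e₁ = a ∧ V e₁ = z) := by
    rcases he₁.2.2 with h | h
    · exact ⟨V e₁, fun h' => he₁.2.1 (by omega), Or.inl ⟨h, rfl⟩⟩
    · exact ⟨U e₁, fun h' => he₁.2.1 (by omega), Or.inr ⟨rfl, h⟩⟩
  obtain ⟨a, haz, ha⟩ := hother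
  apply le_antisymm
  · obtain ⟨p, hp, hopt⟩ := exists_opt k S U V
    rw [hopt]
    refine (opt_le k hp.injOn).trans ?_
    -- After the contraction `e` is a loop, hence an uncrossed target for the redirection of `e₁`.
    have hirr : ∀ j, ¬ Alt (p (redirect z u (U e))) (p (redirect z u (V e)))
        (p (redirect z u (U j))) (p (redirect z u (V j))) := fun j hA => by
      rw [hrede.1, hrede.2] at hA
      exact hA.ne_left rfl
    -- An edge that crosses the moved edge `ua` crosses `za` or `zu` in the given drawing, by the
    -- triangle argument.
    have key : ∀ i ∈ S, ∀ j ∈ S, (U i = z ∨ V i = z) →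
        Alt (p (redirect z u (U i))) (p (redirect z u (V i))) (p (redirect z u (U j)))
          (p (redirect z u (V j))) → i = e₁ ∧ j ≠ e₁ ∧ (Alt (p (U i)) (p (V i)) (p (U j)) (p (V j)) ∨
          Alt (p (U e)) (p (V e)) (p (U j)) (p (V j))) := by
      intro i hi j hj hiz hA
      have hil : U i ≠ V i := fun h => hA.ne_left (by rw [h])
      have hjl : U j ≠ V j := fun h => hA.ne_right (by rw [h])
      have hie : i = e₁ := by
        rcases hT₁ i hi hil hiz with rfl | h
        · exact absurd hA (hirr j)
        · exact h
      have hje : j ≠ e₁ := by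
        rintro rfl
        rw [hie] at hA
        exact hA.1 rfl
      have hjz : ¬ (U j = z ∨ V j = z) := fun h => by
        rcases hT₁ j hj hjl h with rfl | h
        · exact hirr i hA.symm
        · exact hje h
      refine ⟨hie, hje, ?_⟩
      push Not at hjz
      rw [hred _ hjz.1, hred _ hjz.2] at hA
      have h1 : p (U j) ≠ p z := fun h => hjz.1 (hp h)
      have h2 : p (V j) ≠ p z := fun h => hjz.2 (hp h)
      subst hie
      have hA' : Alt (p u) (p a) (p (U j)) (p (V j)) := by
        rcases ha with ⟨h3, h4⟩ | ⟨h3, h4⟩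
        · rwa [h3, h4, hredz, hred a haz] at hA
        · rwa [h3, h4, hredz, hred a haz, alt_swap_left] at hA
      rcases hA'.triangle h1 h2 with h | h
      · left
        rcases ha with ⟨h3, h4⟩ | ⟨h3, h4⟩
        · rwa [h3, h4]
        · rwa [h3, h4, alt_swap_left]
      · right
        rcases hend with ⟨h3, h4⟩ | ⟨h3, h4⟩
        · rwa [h3, h4]
        · rwa [h3, h4, alt_swap_left]
    refine cost_le_of_redirect k he (i₁ := e₁) (Or.inr fun j _ => hirr j) fun i hi j hj hA => ?_
    by_cases hiz : U i = z ∨ V i = z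
    · obtain ⟨h1, h2, h3⟩ := key i hi j hj hiz hA
      rwa [if_pos h1, if_neg h2]
    · by_cases hjz : U j = z ∨ V j = z
      · obtain ⟨h1, h2, h3⟩ := key j hj i hi hjz hA.symm
        rw [if_pos h1, if_neg h2]
        exact h3.imp Alt.symm Alt.symm
      · push Not at hiz hjz
        rw [hred _ hiz.1, hred _ hiz.2, hred _ hjz.1, hred _ hjz.2] at hA
        exact Or.inl hA
  · obtain ⟨p, hp, hopt⟩ := exists_opt k S (fun i => redirect z u (U i))
      (fun i => redirect z u (V i))
    rw [hopt]
    have hother₂ : ∃ b, U e₂ = u ∧ V e₂ = b ∨ U e₂ = b ∧ V e₂ = u := by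
      rcases he₂.2.2 with h | h
      · exact ⟨V e₂, Or.inl ⟨h, rfl⟩⟩
      · exact ⟨U e₂, Or.inr ⟨rfl, h⟩⟩
    obtain ⟨b, hb⟩ := hother₂
    obtain ⟨s, hs, hside⟩ := exists_side (p u) (p a) (p b)
    -- Doubling the positions makes room for `z` directly to the left (`s = 0`) or right (`s = 2`)
    -- of `u`.
    obtain ⟨q, hq⟩ : ∃ q : ℕ → ℕ, ∀ x, q x = if x = z then 2 * p u + s else 2 * p x + 1 :=
      ⟨_, fun _ => rfl⟩
    have hqz : q z = 2 * p u + s := by rw [hq, if_pos rfl]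
    have hqn : ∀ x, x ≠ z → q x = 2 * p x + 1 := fun x hx => by rw [hq, if_neg hx]
    have hqinj : Function.Injective q := by
      intro x y hxy
      by_cases hx : x = z <;> by_cases hy : y = z
      · rw [hx, hy]
      · rw [hx, hqz, hqn y hy] at hxy; omega
      · rw [hy, hqz, hqn x hx] at hxy; omega
      · rw [hqn x hx, hqn y hy] at hxy
        exact hp (by omega)
    have key : ∀ i ∈ S, ∀ j ∈ S, (U i = z ∨ V i = z) →
        Alt (q (U i)) (q (V i)) (q (U j)) (q (V j)) → (U j = z ∨ V j = z) ∨
        Alt (p (redirect z u (U i))) (p (redirect z u (V i))) (p (redirect z u (U j)))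
          (p (redirect z u (V j))) := by
      intro i hi j hj hiz hA
      by_cases hjz : U j = z ∨ V j = z
      · exact Or.inl hjz
      right
      push Not at hjz
      have hil : U i ≠ V i := fun h => hA.ne_left (by rw [h])
      have hjl : U j ≠ V j := fun h => hA.ne_right (by rw [h])
      have hjq : ∀ x, x ≠ z → q x % 2 = 1 := fun x hx => by rw [hqn x hx]; omega
      have hadj : ∀ j', U j' ≠ z ∧ V j' ≠ z → ¬ Alt (q z) (q u) (q (U j')) (q (V j')) := by
        intro j' hj'
        rw [hqz, hqn u hzu.symm]
        exact not_alt_adjacent hs (hjq _ hj'.1) (hjq _ hj'.2)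
      rcases hT₁ i hi hil hiz with rfl | rfl
      · exfalso
        rcases hend with ⟨h3, h4⟩ | ⟨h3, h4⟩
        · rw [h3, h4] at hA; exact hadj j hjz hA
        · rw [h3, h4, alt_swap_left] at hA; exact hadj j hjz hA
      have hA' : Alt (q z) (q a) (q (U j)) (q (V j)) := by
        rcases ha with ⟨h3, h4⟩ | ⟨h3, h4⟩
        · rwa [h3, h4] at hA
        · rwa [h3, h4, alt_swap_left] at hA
      have hau : a ≠ u := by
        rintro rfl
        exact hadj j hjz hA'
      -- The only other edge at `u` is the one to `b`, and the side was chosen to avoid it. For all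
      -- remaining edges `z` is indistinguishable from `u`.
      have hju : ¬ (U j = u ∨ V j = u) := by
        intro h
        have hje : j = e₂ := by
          rcases hT₂ j hj hjl h with rfl | h
          · omega
          · exact h
        subst hje
        have hbz : b ≠ z := by omega
        rw [hqz, hqn a haz] at hA'
        rcases hb with ⟨h3, h4⟩ | ⟨h3, h4⟩
        · rw [h3, h4, hqn u hzu.symm, hqn b hbz] at hA'
          exact hside hA'
        · rw [h3, h4, hqn u hzu.symm, hqn b hbz, alt_swap_right] at hA'
          exact hside hA'
      push Not at hju
      rw [hqz, hqn a haz, hqn _ hjz.1, hqn _ hjz.2] at hA'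
      have hA'' := hA'.of_adjacent hs (fun h => hju.1 (hp h)) (fun h => hju.2 (hp h))
      rw [hred _ hjz.1, hred _ hjz.2]
      rcases ha with ⟨h3, h4⟩ | ⟨h3, h4⟩
      · rwa [h3, h4, hredz, hred a haz]
      · rwa [h3, h4, hredz, hred a haz, alt_swap_left]
    refine (opt_le k hqinj.injOn).trans (cost_mono k fun i hi j hj hA => ?_)
    by_cases hiz : U i = z ∨ V i = z
    · rcases key i hi j hj hiz hA with hjz | h
      · exfalso
        have hil : U i ≠ V i := fun h => hA.ne_left (by rw [h])
        have hjl : U j ≠ V j := fun h => hA.ne_right (by rw [h])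
        have hsh : ∀ x y c d, (x = z ∨ y = z) → (c = z ∨ d = z) → ¬ Alt (q x) (q y) (q c) (q d) := by
          intro x y c d h1 h2 h3
          obtain ⟨n1, n2, n3, n4, -⟩ := h3
          rcases h1 with rfl | rfl <;> rcases h2 with rfl | rfl <;> contradiction
        exact hsh _ _ _ _ hiz hjz hA
      · exact h
    · by_cases hjz : U j = z ∨ V j = z
      · rcases key j hj i hi hjz hA.symm with h | h
        · exact absurd h hiz
        · exact h.symm
      · push Not at hiz hjz
        rw [hqn _ hiz.1, hqn _ hiz.2, hqn _ hjz.1, hqn _ hjz.2, alt_double] at hA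
        rwa [hred _ hiz.1, hred _ hiz.2, hred _ hjz.1, hred _ hjz.2]

theorem edgeDegree_redirect_le {x : ℕ} (hx : x ≠ u) :
    edgeDegree S (fun i => redirect z u (U i)) (fun i => redirect z u (V i)) x ≤
      edgeDegree S U V x := by
  apply card_le_card
  intro i hi
  simp only [mem_filter] at hi ⊢
  obtain ⟨hi, h1, h2⟩ := hi
  refine ⟨hi, fun h => h1 (by rw [h]), ?_⟩
  unfold redirect at h2
  split_ifs at h2 <;> omega

/-- Each end of `e` contributes at most one edge other than `e`, and `e` itself becomes a loop. -/
theorem edgeDegree_redirect (he : e ∈ S) (hzu : z ≠ u)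
    (hend : U e = z ∧ V e = u ∨ U e = u ∧ V e = z) (hz : edgeDegree S U V z ≤ 2)
    (hu : edgeDegree S U V u ≤ 2) :
    edgeDegree S (fun i => redirect z u (U i)) (fun i => redirect z u (V i)) u ≤ 2 := by
  have hloop : U e ≠ V e := by omega
  obtain ⟨e₁, he₁, hT₁⟩ := exists_other_edge hz (e := e) (mem_filter.2 ⟨he, hloop, by omega⟩)
  obtain ⟨e₂, he₂, hT₂⟩ := exists_other_edge hu (e := e) (mem_filter.2 ⟨he, hloop, by omega⟩)
  simp only [mem_filter, and_imp] at hT₁ hT₂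
  refine (card_le_card (t := {e₁, e₂}) ?_).trans card_le_two
  intro i hi
  simp only [mem_filter] at hi
  obtain ⟨hi, h1, h2⟩ := hi
  have hil : U i ≠ V i := fun h => h1 (by rw [h])
  have hie : i ≠ e := by
    rintro rfl
    apply h1
    unfold redirect
    split_ifs <;> omega
  have : (U i = z ∨ V i = z) ∨ (U i = u ∨ V i = u) := by
    unfold redirect at h2
    split_ifs at h2 <;> omega
  simp only [mem_insert, mem_singleton]
  rcases this with h | h
  · exact Or.inl ((hT₁ i hi hil h).resolve_left hie)
  · exact Or.inr ((hT₂ i hi hil h).resolve_left hie)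

end

/-- The vertex that `x` is contracted to if the vertices `z ≤ j` in `F` are contracted to their
parents one after the other. -/
def rep (F : ℕ → Prop) [DecidablePred F] (P : ℕ → ℕ) : ℕ → ℕ → ℕ
  | 0, x => x
  | j + 1, x => if F (j + 1) then redirect (j + 1) (rep F P j (P (j + 1))) (rep F P j x)
      else rep F P j x

section

variable {F : ℕ → Prop} [DecidablePred F] {P : ℕ → ℕ}

theorem rep_le (hP : ∀ x, F x → P x < x) (j x : ℕ) : rep F P j x ≤ x := by
  induction j generalizing x with
  | zero => exact le_rfl
  | succ j ih =>
    rw [rep]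
    split_ifs with h
    · unfold redirect
      split_ifs with h1
      · have := ih (P (j + 1))
        have := hP _ h
        have := ih x
        omega
      · exact ih x
    · exact ih x

theorem rep_of_lt {j x : ℕ} (hx : j < x) : rep F P j x = x := by
  induction j with
  | zero => rfl
  | succ j ih =>
    rw [rep, ih (by omega)]
    split_ifs
    · exact if_neg (by omega)
    · rfl

theorem rep_induction {p : ℕ → Prop} (hP : ∀ x, F x → p x → p (P x)) (j x : ℕ) (hx : p x) :
    p (rep F P j x) := by
  induction j generalizing x with
  | zero => exact hx
  | succ j ih =>
    rw [rep]
    split_ifs with h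
    · unfold redirect
      split_ifs with h1
      · exact ih _ (hP _ h (h1 ▸ ih x hx))
      · exact ih x hx
    · exact ih x hx

theorem rep_eq_of {f : ℕ → ℕ} (hf : ∀ x, F x → f x = f (P x)) (j x : ℕ) :
    f (rep F P j x) = f x :=
  rep_induction (p := fun y => f y = f x) (fun y hy h => by rw [← hf y hy, h]) j x rfl

theorem rep_fixed (hP : ∀ x, F x → P x < x) {j x : ℕ} (h1 : 1 ≤ rep F P j x)
    (h2 : rep F P j x ≤ j) : ¬ F (rep F P j x) := by
  induction j generalizing x with
  | zero => omega
  | succ j ih =>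
    rw [rep] at *
    by_cases h : F (j + 1)
    · rw [if_pos h] at *
      unfold redirect at *
      split_ifs at * with h3
      · have := rep_le hP j (P (j + 1))
        have := hP _ h
        exact ih h1 (by omega)
      · exact ih h1 (by omega)
    · rw [if_neg h] at *
      by_cases h3 : rep F P j x = j + 1
      · rwa [h3]
      · exact ih h1 (by omega)

theorem rep_idem {j x : ℕ} (hx : ¬ F x ∨ j < x) : rep F P j x = x := by
  rcases hx with hx | hx
  · induction j with
    | zero => rfl
    | succ j ih =>
      rw [rep, ih]
      split_ifs with h
      · exact if_neg (by rintro rfl; exact hx h)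
      · rfl
  · exact rep_of_lt hx

theorem rep_rep (hP : ∀ x, F x → P x < x) (hF : ¬ F 0) (j x : ℕ) :
    rep F P j (rep F P j x) = rep F P j x := by
  apply rep_idem
  by_cases h0 : rep F P j x = 0
  · rw [h0]; exact Or.inl hF
  · by_cases h1 : rep F P j x ≤ j
    · exact Or.inl (rep_fixed hP (by omega) h1)
    · exact Or.inr (by omega)

/-- Contracting vertices of degree at most two to parents of degree at most two does not change the
cost of an optimal drawing. -/
theorem opt_rep (k : Bool) {S : Finset ℕ} {U V : ℕ → ℕ} (hP : ∀ x, F x → P x < x) (hF : ¬ F 0)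
    (hedge : ∀ x, F x → ∃ e ∈ S, U e = x ∧ V e = P x)
    {L : ℕ → Prop} (hL : ∀ x, F x → L x ∧ L (P x)) (hdeg : ∀ x, L x → edgeDegree S U V x ≤ 2)
    (j : ℕ) :
    opt k S (fun i => rep F P j (U i)) (fun i => rep F P j (V i)) = opt k S U V ∧
    ∀ x, L x → rep F P j x = x →
      edgeDegree S (fun i => rep F P j (U i)) (fun i => rep F P j (V i)) x ≤ 2 := by
  induction j with
  | zero => exact ⟨rfl, fun x hx _ => hdeg x hx⟩
  | succ j ih =>
    simp only [rep]
    by_cases h : F (j + 1)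
    · simp only [if_pos h]
      obtain ⟨e, he, hU, hV⟩ := hedge _ h
      have hlt := hP _ h
      have hrz : rep F P j (j + 1) = j + 1 := rep_of_lt (by omega)
      have hru := rep_le hP j (P (j + 1))
      have hz := ih.2 _ (hL _ h).1 hrz
      -- The parent may have been contracted already. Its representative still satisfies `L`,
      -- because `F` only leads to vertices of `L`, so the degree bound applies to it.
      have hu := ih.2 _ (rep_induction (fun x hx _ => (hL x hx).2) j _ (hL _ h).2)
        (rep_rep hP hF j (P (j + 1)))
      have hzu : j + 1 ≠ rep F P j (P (j + 1)) := by omega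
      have hend : rep F P j (U e) = j + 1 ∧ rep F P j (V e) = rep F P j (P (j + 1)) ∨
          rep F P j (U e) = rep F P j (P (j + 1)) ∧ rep F P j (V e) = j + 1 := by
        left; rw [hU, hV, hrz]; exact ⟨rfl, rfl⟩
      refine ⟨(opt_redirect k (U := fun i => rep F P j (U i)) (V := fun i => rep F P j (V i)) he hzu
        hend hz hu).trans ih.1, fun x hx hrx => ?_⟩
      by_cases hxu : x = rep F P j (P (j + 1))
      · rw [hxu]
        exact edgeDegree_redirect (U := fun i => rep F P j (U i)) (V := fun i => rep F P j (V i)) he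
          hzu hend hz hu
      · refine (edgeDegree_redirect_le (U := fun i => rep F P j (U i))
          (V := fun i => rep F P j (V i)) hxu).trans (ih.2 x hx ?_)
        unfold redirect at hrx
        split_ifs at hrx with h1
        · exact absurd hrx.symm hxu
        · exact hrx
    · simp only [if_neg h]
      exact ih

end

end OnePage

namespace OnePage

open Finset

/-! ### All drawings are enumerated -/

theorem insertPos_injOn {d : ℕ → ℕ} {i : ℕ} : Set.InjOn (insertPos d i) (Set.Iio i) := by
  induction i with
  | zero => intro x hx; simp at hx
  | succ i ih =>
    intro x hx y hy hxy
    simp only [Set.mem_Iio] at hx hy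
    rw [insertPos, insertPos] at hxy
    by_cases h1 : x = i <;> by_cases h2 : y = i
    · omega
    · rw [if_pos h1, if_neg h2] at hxy
      split_ifs at hxy <;> omega
    · rw [if_neg h1, if_pos h2] at hxy
      split_ifs at hxy <;> omega
    · rw [if_neg h1, if_neg h2] at hxy
      refine ih (show x < i by omega) (show y < i by omega) ?_
      split_ifs at hxy <;> omega

/-- The rank of `p j` among `p 0, …, p (i - 1)`. -/
def rank (p : ℕ → ℕ) (i j : ℕ) : ℕ := #{l ∈ range i | p l < p j}

theorem rank_le (p : ℕ → ℕ) (i j : ℕ) : rank p i j ≤ i :=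
  (card_filter_le _ _).trans (by simp)

theorem rank_lt_rank {p : ℕ → ℕ} {i a b : ℕ} (ha : a < i) (h : p a < p b) :
    rank p i a < rank p i b := by
  apply card_lt_card
  refine ⟨fun l hl => ?_, fun hs => ?_⟩
  · simp only [mem_filter] at hl ⊢
    exact ⟨hl.1, hl.2.trans h⟩
  · have : a ∈ {l ∈ range i | p l < p a} := hs (by simp [ha, h])
    simp at this

/-- Inserting `i` at its own rank raises the rank of exactly those earlier elements that lie behind
it, which is how `insertPos` shifts positions. -/
theorem insertPos_rank {p : ℕ → ℕ} (hp : Function.Injective p) {i j : ℕ} (hj : j < i) :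
    insertPos (fun l => rank p l l) i j = rank p i j := by
  have hsucc : ∀ i j, rank p (i + 1) j = rank p i j + if p i < p j then 1 else 0 := by
    intro i j
    rw [rank, range_add_one, filter_insert]
    split_ifs with h
    · rw [card_insert_of_notMem (by simp)]; rfl
    · rfl
  induction i with
  | zero => omega
  | succ i ih =>
    rw [insertPos, hsucc]
    split_ifs with h1 h2 h2 h3 h3
    · subst h1; omega
    · subst h1; omega
    · rw [ih (by omega)] at h2
      rw [ih (by omega)]
      rcases lt_trichotomy (p j) (p i) with h | h | h
      · omega
      · exact absurd (hp h) h1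
      · have : rank p i i ≤ rank p i j := card_le_card fun l hl => by
          simp only [mem_filter] at hl ⊢
          exact ⟨hl.1, hl.2.trans h⟩
        omega
    · rw [ih (by omega)]
    · rw [ih (by omega)]
    · rw [ih (by omega)] at h2
      have := rank_lt_rank (p := p) (i := i) (a := j) (b := i) (by omega) (by
        rcases lt_trichotomy (p j) (p i) with h | h | h
        · exact h
        · exact absurd (hp h) h1
        · exact absurd h h3)
      omega

/-- A multiple of `N!` does not influence the digits below `N`. -/
theorem exists_digits {d : ℕ → ℕ} (hd : ∀ j, d j ≤ j) (N : ℕ) :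
    ∃ x < N.factorial, ∀ j < N, digit x j = d j := by
  induction N with
  | zero => exact ⟨0, by simp, by omega⟩
  | succ N ih =>
    obtain ⟨x, hx, hxd⟩ := ih
    refine ⟨x + d N * N.factorial, ?_, fun j hj => ?_⟩
    · rw [Nat.factorial_succ]
      have := Nat.mul_le_mul_right N.factorial (hd N)
      have : (N + 1) * N.factorial = N * N.factorial + N.factorial := by ring
      omega
    · rcases Nat.lt_succ_iff_lt_or_eq.1 hj with h | rfl
      · rw [← hxd j h]
        obtain ⟨q, hq⟩ : (j + 1).factorial ∣ N.factorial := Nat.factorial_dvd_factorial h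
        rw [digit, digit, hq, Nat.factorial_succ, show x + d N * ((j + 1) * j.factorial * q) =
          x + j.factorial * ((j + 1) * (q * d N)) by ring,
          Nat.add_mul_div_left _ _ (Nat.factorial_pos j), Nat.add_mul_mod_self_left]
      · rw [digit, Nat.add_mul_div_right _ _ (Nat.factorial_pos j), Nat.div_eq_of_lt hx, zero_add,
          Nat.mod_eq_of_lt (Nat.lt_succ_of_le (hd j))]

/-- Every order of `0, …, N - 1` is enumerated. -/
theorem exists_insertPos {p : ℕ → ℕ} (hp : Function.Injective p) (N : ℕ) :
    ∃ x < N.factorial, ∃ f : ℕ → ℕ, StrictMonoOn f (p '' Set.Iio N) ∧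
      ∀ j < N, insertPos (digit x) N j = f (p j) := by
  obtain ⟨x, hx, hxd⟩ := exists_digits (fun j => rank_le p j j) N
  refine ⟨x, hx, fun y => #{l ∈ range N | p l < y}, ?_, fun j hj => ?_⟩
  · rintro _ ⟨a, ha, rfl⟩ _ ⟨b, hb, rfl⟩ h
    exact rank_lt_rank ha h
  · rw [insertPos_congr hxd, insertPos_rank hp hj]
    rfl

/-- Every order of the indices is tried up to a monotone change of positions, which `Alt` does not
see. The start value `c` cannot undercut the optimum, since it is at least the cost of any drawing.
-/
theorem IsBest.eq_opt {k : Bool} {c N b : ℕ} {S : Finset ℕ} {A D : ℕ → ℕ}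
    (h : IsBest c (fun x => cost k S (fun i => insertPos (digit x) N (A i))
      (fun i => insertPos (digit x) N (D i))) N.factorial b)
    (hc : #S * #S ≤ c) (hA : ∀ i ∈ S, A i < N) (hD : ∀ i ∈ S, D i < N) : b = opt k S A D := by
  have hv : ∀ x ∈ verts S A D, x < N := by
    intro x hx
    simp only [verts, mem_union, mem_image] at hx
    rcases hx with ⟨i, hi, rfl⟩ | ⟨i, hi, rfl⟩
    · exact hA i hi
    · exact hD i hi
  have hge : ∀ x, opt k S A D ≤ cost k S (fun i => insertPos (digit x) N (A i))
      (fun i => insertPos (digit x) N (D i)) :=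
    fun x => opt_le k fun a ha b hb hab => insertPos_injOn (hv a ha) (hv b hb) hab
  apply le_antisymm
  · obtain ⟨p, hp, hopt⟩ := exists_opt k S A D
    obtain ⟨x, hx, f, hf, hfp⟩ := exists_insertPos hp N
    refine (h.le_of_lt x hx).trans_eq ?_
    rw [hopt]
    refine cost_eq_of_alt k fun i hi j hj => alt_congr hf ⟨_, hA i hi, rfl⟩ ⟨_, hD i hi, rfl⟩
      ⟨_, hA j hj, rfl⟩ ⟨_, hD j hj, rfl⟩ (hfp _ (hA i hi)) (hfp _ (hD i hi)) (hfp _ (hA j hj))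
      (hfp _ (hD j hj))
  · rcases h.eq with h1 | ⟨x, -, h1⟩
    · rw [h1]
      exact (hge 0).trans ((cost_le_sq k S _ _).trans hc)
    · rw [h1]
      exact hge x

/-! ### Drawings of graphs -/

section

variable {n : ℕ} {G : SimpleGraph (Fin n)} {es : List (Fin n × Fin n)}

/-- The positions in a drawing. -/
def position {n : ℕ} (σ : Fin n ≃ Fin n) (x : ℕ) : ℕ := if h : x < n then σ ⟨x, h⟩ else x

theorem position_coe (σ : Fin n ≃ Fin n) (v : Fin n) : position σ v = σ v := by
  simp [position]

theorem position_fst (σ : Fin n ≃ Fin n) {i : ℕ} (hi : i < es.length) :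
    position σ (fstEnd es i) = σ es[i].1 := by
  rw [fstEnd_eq hi, position_coe]

theorem position_snd (σ : Fin n ≃ Fin n) {i : ℕ} (hi : i < es.length) :
    position σ (sndEnd es i) = σ es[i].2 := by
  rw [sndEnd_eq hi, position_coe]

theorem crossesFrom_iff (σ : Fin n ≃ Fin n) {a b c d : Fin n} :
    CrossesFrom σ s(a, b) s(c, d) ↔ cross (σ a) (σ b) (σ c) (σ d) = 1 := by
  rw [cross_eq]
  simp only [ite_eq_left_iff, zero_ne_one, imp_false, not_not, Fin.val_fin_lt]
  constructor
  · rintro ⟨a', b', c', d', h1, h2, h⟩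
    rw [Sym2.eq_iff] at h1 h2
    rcases h1 with ⟨rfl, rfl⟩ | ⟨rfl, rfl⟩ <;> rcases h2 with ⟨rfl, rfl⟩ | ⟨rfl, rfl⟩ <;> tauto
  · rintro (h | h | h | h)
    · exact ⟨a, b, c, d, rfl, rfl, h⟩
    · exact ⟨a, b, d, c, rfl, Sym2.eq_swap, h⟩
    · exact ⟨b, a, c, d, Sym2.eq_swap, rfl, h⟩
    · exact ⟨b, a, d, c, Sym2.eq_swap, Sym2.eq_swap, h⟩

theorem alt_iff_cross {a b c d : ℕ} : Alt a b c d ↔ cross a b c d = 1 ∨ cross c d a b = 1 := by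
  have h := cross_add_cross a b c d
  have := cross_le a b c d
  have := cross_le c d a b
  split_ifs at h with h1
  · simp only [h1, true_iff]; omega
  · simp only [h1, false_iff]; omega

theorem IsEdgeList.exists_index (hes : IsEdgeList G es) {e : Sym2 (Fin n)} (he : e ∈ G.edgeSet) :
    ∃ i, ∃ hi : i < es.length, e = s(es[i].1, es[i].2) := by
  induction e with
  | _ u v =>
    have := (hes.2 u v).2 he
    obtain ⟨p, hp, hpe⟩ := List.mem_map.1 this
    obtain ⟨i, hi, rfl⟩ := List.mem_iff_getElem.1 hp
    exact ⟨i, hi, hpe.symm⟩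

/-- The `i`-th edge of a list, as an unordered pair. -/
def edgeAt (es : List (Fin n × Fin n)) (i : Fin es.length) : Sym2 (Fin n) := s(es[i].1, es[i].2)

theorem IsEdgeList.edgeAt_injective (hes : IsEdgeList G es) : Function.Injective (edgeAt es) :=
  fun i j h => Fin.ext (hes.inj i.2 j.2 h)

theorem IsEdgeList.mem_edgeSet (hes : IsEdgeList G es) {e : Sym2 (Fin n)} :
    e ∈ G.edgeSet ↔ ∃ i, edgeAt es i = e := by
  constructor
  · intro he
    obtain ⟨i, hi, h⟩ := hes.exists_index he
    exact ⟨⟨i, hi⟩, h.symm⟩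
  · rintro ⟨i, rfl⟩
    exact hes.adj i.2

theorem crossesFrom_edgeAt (σ : Fin n ≃ Fin n) (i j : Fin es.length) :
    CrossesFrom σ (edgeAt es i) (edgeAt es j) ↔
      cross (position σ (fstEnd es i)) (position σ (sndEnd es i)) (position σ (fstEnd es j))
        (position σ (sndEnd es j)) = 1 := by
  rw [edgeAt, edgeAt, crossesFrom_iff, position_fst σ i.2, position_snd σ i.2, position_fst σ j.2,
    position_snd σ j.2]
  rfl

theorem IsEdgeList.crossings_eq (hes : IsEdgeList G es) (σ : Fin n ≃ Fin n) :
    crossings G σ = cost false (range es.length) (fun i => position σ (fstEnd es i))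
      (fun i => position σ (sndEnd es i)) := by
  have h1 : {x : Sym2 (Fin n) × Sym2 (Fin n) |
      x.1 ∈ G.edgeSet ∧ x.2 ∈ G.edgeSet ∧ CrossesFrom σ x.1 x.2} =
      Prod.map (edgeAt es) (edgeAt es) '' {x | CrossesFrom σ (edgeAt es x.1) (edgeAt es x.2)} := by
    ext ⟨e, f⟩
    simp only [Set.mem_ofPred_eq, Set.mem_image, Prod.exists, Prod.map_apply, Prod.mk.injEq,
      hes.mem_edgeSet]
    constructor
    · rintro ⟨⟨i, rfl⟩, ⟨j, rfl⟩, h⟩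
      exact ⟨i, j, h, rfl, rfl⟩
    · rintro ⟨i, j, h, rfl, rfl⟩
      exact ⟨⟨i, rfl⟩, ⟨j, rfl⟩, h⟩
  rw [crossings, h1, Set.ncard_image_of_injective _
    (hes.edgeAt_injective.prodMap hes.edgeAt_injective)]
  simp only [crossesFrom_edgeAt]
  rw [Set.ncard_eq_toFinset_card', Set.toFinset_ofPred, card_filter, ← univ_product_univ,
    sum_product]
  rw [cost, sum_range]
  refine sum_congr rfl fun i _ => ?_
  simp only [edgeCost, sum_range, Bool.false_eq_true, if_false]
  refine sum_congr rfl fun j _ => ?_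
  have := cross_le (position σ (fstEnd es i)) (position σ (sndEnd es i)) (position σ (fstEnd es j))
    (position σ (sndEnd es j))
  simp only [pairCost, Bool.false_eq_true, if_false]
  split_ifs <;> omega

theorem IsEdgeList.crossedEdges_eq (hes : IsEdgeList G es) (σ : Fin n ≃ Fin n) :
    crossedEdges G σ = cost true (range es.length) (fun i => position σ (fstEnd es i))
      (fun i => position σ (sndEnd es i)) := by
  have h1 : {e : Sym2 (Fin n) |
      e ∈ G.edgeSet ∧ ∃ f ∈ G.edgeSet, CrossesFrom σ e f ∨ CrossesFrom σ f e} =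
      edgeAt es '' {i | ∃ j, CrossesFrom σ (edgeAt es i) (edgeAt es j) ∨
        CrossesFrom σ (edgeAt es j) (edgeAt es i)} := by
    ext e
    simp only [Set.mem_ofPred_eq, Set.mem_image, hes.mem_edgeSet]
    constructor
    · rintro ⟨⟨i, rfl⟩, _, ⟨j, rfl⟩, h⟩
      exact ⟨i, ⟨j, h⟩, rfl⟩
    · rintro ⟨i, ⟨j, h⟩, rfl⟩
      exact ⟨⟨i, rfl⟩, _, ⟨j, rfl⟩, h⟩
  rw [crossedEdges, h1, Set.ncard_image_of_injective _ hes.edgeAt_injective]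
  simp only [crossesFrom_edgeAt]
  rw [Set.ncard_eq_toFinset_card', Set.toFinset_ofPred, card_filter, cost_true, card_filter,
    sum_range]
  refine sum_congr rfl fun i _ => if_congr ?_ rfl rfl
  simp only [alt_iff_cross, mem_range]
  exact ⟨fun ⟨j, h⟩ => ⟨j, j.2, h⟩, fun ⟨j, hj, h⟩ => ⟨⟨j, hj⟩, h⟩⟩

/-- Optimal drawings can be given by permutations. -/
theorem iInf_cost_eq_opt (k : Bool) (es : List (Fin n × Fin n)) :
    ⨅ σ : Fin n ≃ Fin n, cost k (range es.length) (fun i => position σ (fstEnd es i))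
      (fun i => position σ (sndEnd es i)) = opt k (range es.length) (fstEnd es) (sndEnd es) := by
  have hb : ∀ i ∈ range es.length, fstEnd es i < n ∧ sndEnd es i < n := by
    intro i hi
    have hi := mem_range.1 hi
    rw [fstEnd_eq hi, sndEnd_eq hi]
    exact ⟨es[i].1.2, es[i].2.2⟩
  apply le_antisymm
  · obtain ⟨p, hp, hopt⟩ := exists_opt k (range es.length) (fstEnd es) (sndEnd es)
    obtain ⟨x, -, f, hf, hfp⟩ := exists_insertPos hp n
    have hlt : ∀ v : Fin n, insertPos (digit x) n v < n :=
      fun v => insertPos_lt (fun j _ => digit_le x j) v.2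
    have hinj : Function.Injective fun v : Fin n => (⟨insertPos (digit x) n v, hlt v⟩ : Fin n) :=
      fun u v h => Fin.ext (insertPos_injOn u.2 v.2 (Fin.mk.inj_iff.1 h))
    let σ : Fin n ≃ Fin n := Equiv.ofBijective _ (Finite.injective_iff_bijective.1 hinj)
    have hσ : ∀ y < n, position σ y = f (p y) := fun y hy => by
      rw [position, dif_pos hy, ← hfp y hy]
      rfl
    refine (ciInf_le (OrderBot.bddBelow _) σ).trans_eq ?_
    rw [hopt]
    refine cost_eq_of_alt k fun i hi j hj => alt_congr hf ⟨_, (hb i hi).1, rfl⟩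
      ⟨_, (hb i hi).2, rfl⟩ ⟨_, (hb j hj).1, rfl⟩ ⟨_, (hb j hj).2, rfl⟩ (hσ _ (hb i hi).1)
      (hσ _ (hb i hi).2) (hσ _ (hb j hj).1) (hσ _ (hb j hj).2)
  · refine le_ciInf fun σ => opt_le k fun a ha c hc h => ?_
    have hv : ∀ x ∈ verts (range es.length) (fstEnd es) (sndEnd es), x < n := by
      intro x hx
      simp only [verts, mem_union, mem_image] at hx
      rcases hx with ⟨i, hi, rfl⟩ | ⟨i, hi, rfl⟩
      · exact (hb i hi).1
      · exact (hb i hi).2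
    have ha := hv a ha
    have hc := hv c hc
    rw [position, position, dif_pos ha, dif_pos hc] at h
    simpa using σ.injective (Fin.ext h)

theorem IsEdgeList.pageCrossingNumber_eq (hes : IsEdgeList G es) :
    pageCrossingNumber G = opt false (range es.length) (fstEnd es) (sndEnd es) := by
  rw [← iInf_cost_eq_opt, pageCrossingNumber]
  exact iInf_congr hes.crossings_eq

theorem IsEdgeList.pageCrossedNumber_eq (hes : IsEdgeList G es) :
    pageCrossedNumber G = opt true (range es.length) (fstEnd es) (sndEnd es) := by
  rw [← iInf_cost_eq_opt, pageCrossedNumber]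
  exact iInf_congr hes.crossedEdges_eq

end

end OnePage

namespace OnePage

open Finset

/-! ### Decomposition into blocks -/

/-- The edges of the block with top vertex `t`. -/
def blockEdges (m : ℕ) (U cls : ℕ → ℕ) (t : ℕ) : Finset ℕ := {i ∈ range m | cls (U i) = t}

namespace DfsForest

variable {n m : ℕ} {U V P : ℕ → ℕ}

theorem parent_le (h : DfsForest n m U V P) {x : ℕ} (hx : x ≤ n) : P x ≤ x := by
  rcases Nat.eq_zero_or_pos x with rfl | h0
  · rw [h.parent_zero]
  · exact (h.parent_lt x h0 hx).le

theorem iterate_le (h : DfsForest n m U V P) {x : ℕ} (hx : x ≤ n) (k : ℕ) : P^[k] x ≤ x := by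
  induction k with
  | zero => exact le_rfl
  | succ k ih =>
    rw [Function.iterate_succ_apply']
    exact (h.parent_le (ih.trans hx)).trans ih

end DfsForest

namespace BlockForest

variable {n m : ℕ} {U V P cls : ℕ → ℕ}

/-- The edge `i` itself covers every forest edge on its path that lies above `U i` and stops short
of the last one, so the class does not change along the path. -/
theorem cls_of_path (h : BlockForest n m U V P cls) {i : ℕ} (hi : i < m) (k : ℕ)
    (hk : V i < P^[k] (U i)) : cls (P^[k] (U i)) = cls (U i) := by
  have hUn := h.upper_le i hi
  induction k with
  | zero => rfl
  | succ k ih =>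
    have hle := h.iterate_le hUn k
    rw [Function.iterate_succ_apply'] at hk ⊢
    have hy := h.parent_le (hle.trans hUn)
    have hpos : 1 ≤ P^[k] (U i) := by omega
    rw [← ih (by omega), h.cls_eq _ hpos (hle.trans hUn), if_pos ⟨i, hi, ⟨k, rfl⟩, hk⟩]

/-- The last vertex before `V i` on the path from `U i`: whether it is the top of its class decides
where `V i` belongs. -/
theorem exists_child (h : BlockForest n m U V P cls) {i : ℕ} (hi : i < m) :
    ∃ y, V i < y ∧ y ≤ n ∧ P y = V i ∧ (∃ k, P^[k] (U i) = y) ∧ cls y = cls (U i) := by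
  classical
  have hex := h.comparable i hi
  obtain ⟨k, hk⟩ : ∃ k, Nat.find hex = k := ⟨_, rfl⟩
  have hkV : P^[k] (U i) = V i := hk ▸ Nat.find_spec hex
  have hlt := h.lower_lt i hi
  have hUn := h.upper_le i hi
  have hV := h.lower_pos i hi
  rcases k with _ | k
  · simp at hkV; omega
  · have hle := h.iterate_le hUn k
    have hmin : P^[k] (U i) ≠ V i := Nat.find_min hex (by omega)
    rw [Function.iterate_succ_apply'] at hkV
    have hy := h.parent_le (hle.trans hUn)
    exact ⟨P^[k] (U i), by omega, by omega, hkV, ⟨k, rfl⟩, h.cls_of_path hi k (by omega)⟩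

theorem cls_lower (h : BlockForest n m U V P cls) {i : ℕ} (hi : i < m) :
    cls (V i) = cls (U i) ∨ V i = P (cls (U i)) := by
  obtain ⟨y, hVy, hyn, hPy, -, hc⟩ := h.exists_child hi
  by_cases hyc : cls y = y
  · right; rw [← hc, hyc, hPy]
  · left; rw [← hc, (h.cls_parent (by omega) hyn hyc).1, hPy]

theorem cls_cls (h : BlockForest n m U V P cls) {x : ℕ} (h1 : 1 ≤ x) (h2 : x ≤ n) :
    cls (cls x) = cls x := by
  induction x using Nat.strong_induction_on with
  | _ x ih =>
    by_cases hx : cls x = x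
    · rw [hx, hx]
    · obtain ⟨e1, e2, e3⟩ := h.cls_parent h1 h2 hx
      rw [e1]
      exact ih (P x) e3 e2 (by omega)

theorem mem_verts (h : BlockForest n m U V P cls) {t x : ℕ}
    (hx : x ∈ verts (blockEdges m U cls t) U V) :
    1 ≤ x ∧ x ≤ n ∧ (cls x = t ∨ x = P t ∧ 1 ≤ t ∧ t ≤ n) := by
  simp only [verts, mem_union, mem_image, blockEdges, mem_filter, mem_range] at hx
  rcases hx with ⟨i, ⟨hi, rfl⟩, rfl⟩ | ⟨i, ⟨hi, rfl⟩, rfl⟩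
  · have := h.lower_lt i hi
    exact ⟨by omega, h.upper_le i hi, Or.inl rfl⟩
  · have := h.lower_lt i hi
    have h1 := h.upper_le i hi
    have := h.cls_bounds (x := U i) (by omega) h1
    exact ⟨h.lower_pos i hi, by omega, (h.cls_lower hi).imp id fun h' => ⟨h', by omega, by omega⟩⟩

/-- Blocks are added in the order of their top vertices. A vertex of an earlier block has a class at
most `t` or is the parent of an earlier top, so the next block meets the union only in the parent of
its own top. -/
theorem opt_blocks_le (h : BlockForest n m U V P cls) (k : Bool) (t : ℕ) :
    opt k {i ∈ range m | cls (U i) ≤ t} U V = ∑ s ∈ range t, opt k (blockEdges m U cls (s + 1)) U V := by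
  have hpos : ∀ i < m, 1 ≤ cls (U i) := fun i hi =>
    (h.cls_bounds (by have := h.lower_lt i hi; omega) (h.upper_le i hi)).1
  induction t with
  | zero =>
    have : {i ∈ range m | cls (U i) ≤ 0} = ∅ := by
      rw [filter_eq_empty_iff]
      intro i hi
      have := hpos i (mem_range.1 hi)
      omega
    rw [this, sum_range_zero]
    obtain ⟨p, -, hp⟩ := exists_opt k ∅ U V
    rw [hp, cost, sum_empty]
  | succ t ih =>
    have hsplit : {i ∈ range m | cls (U i) ≤ t + 1} =
        {i ∈ range m | cls (U i) ≤ t} ∪ blockEdges m U cls (t + 1) := by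
      ext i
      simp only [mem_filter, mem_union, blockEdges]
      rw [← and_or_left]
      refine and_congr_right fun _ => ?_
      omega
    rw [hsplit, opt_union k (v := P (t + 1)), ih, sum_range_succ]
    · refine disjoint_filter.2 fun i _ h1 h2 => ?_
      omega
    · intro x hx hx'
      obtain ⟨h1, h2, h3⟩ := h.mem_verts hx'
      rcases h3 with h3 | h3
      -- Since `cls x ≤ x`, both alternatives are incompatible with `cls x = t + 1`.
      · have hxle : cls x ≤ t ∨ x < t := by
          simp only [verts, mem_union, mem_image, mem_filter, mem_range] at hx
          rcases hx with ⟨i, ⟨hi, hc⟩, rfl⟩ | ⟨i, ⟨hi, hc⟩, rfl⟩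
          · exact Or.inl hc
          · rcases h.cls_lower hi with h4 | h4
            · left; omega
            · right
              have := h.parent_lt (cls (U i)) (hpos i hi) (by
                have := h.cls_bounds (x := U i) (by have := h.lower_lt i hi; omega) (h.upper_le i hi)
                have := h.upper_le i hi
                omega)
              omega
        have := h.cls_bounds h1 h2
        omega
      · exact h3.1

theorem opt_blocks (h : BlockForest n m U V P cls) (k : Bool) :
    opt k (range m) U V = ∑ s ∈ range n, opt k (blockEdges m U cls (s + 1)) U V := by
  rw [← h.opt_blocks_le k n]
  congr 1
  symm
  rw [filter_eq_self]
  intro i hi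
  have hi := mem_range.1 hi
  have h1 := h.upper_le i hi
  have := h.cls_bounds (x := U i) (by have := h.lower_lt i hi; omega) h1
  omega

theorem edgeDegree_le (x t : ℕ) (hx : cls x = t) :
    edgeDegree (blockEdges m U cls t) U V x ≤ classDegree m U V cls x := by
  rw [edgeDegree, blockEdges, filter_filter, card_filter, classDegree]
  refine sum_le_sum fun i _ => ?_
  split_ifs with h1 h2 h3 h3 <;> try omega
  exfalso
  rcases h1.2.2 with h4 | h4
  · exact h2 h4
  · exact h3 ⟨h4, by rw [h4, hx, h1.1]⟩

/-- The contractions performed by the index program are the successive ones of `rep`. Afterwards the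
indices relabel the representatives injectively, and the contracted edges are loops. -/
theorem opt_block (h : BlockForest n m U V P cls) {idx : ℕ → ℕ}
    (hN : Numbering n m U V P cls idx) (k : Bool) (t : ℕ) :
    opt k (blockEdges m U cls t) U V =
      opt k (classEdges U V cls idx m t) (fun i => idx (U i)) (lowerIndex U V cls idx) := by
  classical
  obtain ⟨F, hF⟩ : ∃ F : ℕ → Prop, ∀ x, F x ↔ (1 ≤ x ∧ x ≤ n) ∧ cls x = t ∧
    Contracted cls (classDegree m U V cls) P x := ⟨_, fun _ => Iff.rfl⟩
  obtain ⟨r, hr⟩ : ∃ r, r = rep F P n := ⟨_, rfl⟩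
  have hP : ∀ x, F x → P x < x := fun x hx =>
    h.parent_lt x ((hF x).1 hx).1.1 ((hF x).1 hx).1.2
  have hFcls : ∀ x, F x → cls x = cls (P x) ∧ 1 ≤ P x := fun x hx => by
    obtain ⟨⟨h1, h2⟩, h3, h4⟩ := (hF x).1 hx
    have := h.cls_parent h1 h2 h4.1
    exact ⟨this.1, this.2.1⟩
  have hF0 : ¬ F 0 := fun h0 => by
    have := ((hF 0).1 h0).1
    omega
  have hc1 := (opt_rep k (S := blockEdges m U cls t) (U := U) (V := V) (F := F) (P := P)
    (L := fun x => cls x = t ∧ classDegree m U V cls x < 3) hP hF0 (fun x hx => by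
      obtain ⟨⟨h1, h2⟩, h3, h4⟩ := (hF x).1 hx
      obtain ⟨e, he, hU, hV⟩ := h.tree x h1 h2 (by have := (hFcls x hx).2; omega)
      exact ⟨e, mem_filter.2 ⟨mem_range.2 he, by rw [hU, h3]⟩, hU, hV⟩)
    (fun x hx => by
      obtain ⟨⟨h1, h2⟩, h3, h4⟩ := (hF x).1 hx
      exact ⟨⟨h3, h4.2.1⟩, by rw [← (hFcls x hx).1, h3], h4.2.2⟩)
    (fun x hx => by
      have := edgeDegree_le (m := m) (U := U) (V := V) x t hx.1
      omega) n).1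
  rw [← hr] at hc1
  rw [← hc1]
  -- The only vertex of the block outside the class is the parent of `t`, which receives the free
  -- label `0`. As `g` is constant along contractions, it can be evaluated before or after them.
  obtain ⟨g, hg⟩ : ∃ g : ℕ → ℕ, ∀ x, g x = if cls x = t then idx x else 0 := ⟨_, fun _ => rfl⟩
  have hgr : ∀ x, g (r x) = g x := fun x => by
    rw [hr]
    refine rep_eq_of (fun x hx => ?_) n x
    rw [hg, hg, ← (hFcls x hx).1, ← hN.contracted x ((hF x).1 hx).1.1 ((hF x).1 hx).1.2
      ((hF x).1 hx).2.2]
  have hclsr : ∀ x, cls (r x) = cls x := fun x => by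
    rw [hr]
    exact rep_eq_of (fun x hx => (hFcls x hx).1) n x
  have hinj : Set.InjOn g (verts (blockEdges m U cls t) (fun i => r (U i)) fun i => r (V i)) := by
    have himg : verts (blockEdges m U cls t) (fun i => r (U i)) (fun i => r (V i)) =
        (verts (blockEdges m U cls t) U V).image r := by
      simp only [verts, image_union, image_image]; rfl
    rw [himg]
    have key : ∀ a ∈ verts (blockEdges m U cls t) U V, cls a = t →
        1 ≤ r a ∧ r a ≤ n ∧ 1 ≤ idx (r a) ∧
        idx (r a) = #(remaining cls (classDegree m U V cls) P (r a) t) ∧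
        r a ∈ remaining cls (classDegree m U V cls) P (r a) t := by
      intro a ha hat
      obtain ⟨h1, h2, -⟩ := h.mem_verts ha
      have h3 : 1 ≤ r a := by
        rw [hr]
        exact rep_induction (p := fun x => 1 ≤ x) (fun x hx _ => (hFcls x hx).2) n a h1
      have h4 : r a ≤ n := by
        rw [hr]; exact (rep_le hP n a).trans h2
      have h5 : ¬ Contracted cls (classDegree m U V cls) P (r a) := fun hc => by
        have : ¬ F (r a) := by rw [hr] at *; exact rep_fixed hP h3 h4
        exact this ((hF _).2 ⟨⟨h3, h4⟩, by rw [hclsr, hat], hc⟩)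
      refine ⟨h3, h4, (hN.bounds h h3 h4).1, ?_, ?_⟩
      · rw [hN.kept _ h3 h4 h5, hclsr, hat]
      · rw [remaining, mem_filter, mem_Icc]
        exact ⟨⟨h3, le_rfl⟩, h5, by rw [hclsr, hat]⟩
    have hmono : ∀ a ∈ verts (blockEdges m U cls t) U V, cls a = t →
        ∀ b ∈ verts (blockEdges m U cls t) U V, cls b = t → r a < r b → idx (r a) < idx (r b) := by
      intro a ha hat b hb hbt hlt
      rw [(key a ha hat).2.2.2.1, (key b hb hbt).2.2.2.1]
      refine card_lt_card ⟨remaining_mono hlt.le, fun hs => ?_⟩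
      have := hs (key b hb hbt).2.2.2.2
      rw [remaining, mem_filter, mem_Icc] at this
      omega
    intro x hx y hy hxy
    obtain ⟨a, ha, rfl⟩ := mem_image.1 (mem_coe.1 hx)
    obtain ⟨b, hb, rfl⟩ := mem_image.1 (mem_coe.1 hy)
    rw [hg, hg, hclsr, hclsr] at hxy
    by_cases hat : cls a = t <;> by_cases hbt : cls b = t
    · rw [if_pos hat, if_pos hbt] at hxy
      rcases lt_trichotomy (r a) (r b) with hlt | hlt | hlt
      · have := hmono a ha hat b hb hbt hlt; omega
      · exact hlt
      · have := hmono b hb hbt a ha hat hlt; omega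
    · rw [if_pos hat, if_neg hbt] at hxy
      have := (key a ha hat).2.2.1
      omega
    · rw [if_neg hat, if_pos hbt] at hxy
      have := (key b hb hbt).2.2.1
      omega
    · have h1 := ((h.mem_verts ha).2.2.resolve_left hat).1
      have h2 := ((h.mem_verts hb).2.2.resolve_left hbt).1
      rw [h1, h2]
  rw [← opt_relabel k hinj]
  have hE : classEdges U V cls idx m t =
      {i ∈ blockEdges m U cls t | idx (U i) ≠ lowerIndex U V cls idx i} := by
    rw [classEdges, blockEdges, filter_filter]
  rw [hE, opt_filter_ne k (blockEdges m U cls t) (fun i => idx (U i)) (lowerIndex U V cls idx)]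
  refine opt_swap k fun i hi => Or.inl ?_
  have hi' := (mem_filter.1 hi).2
  constructor
  · rw [hgr, hg, if_pos hi']
  · rw [hgr, hg, lowerIndex, hi']

theorem label_lt (h : BlockForest n m U V P cls) {idx : ℕ → ℕ}
    (hN : Numbering n m U V P cls idx) {t i : ℕ} (hi : i ∈ classEdges U V cls idx m t) :
    idx (U i) < blockOrder n m U V P cls t ∧
      lowerIndex U V cls idx i < blockOrder n m U V P cls t := by
  rw [classEdges, mem_filter, mem_range] at hi
  obtain ⟨hi, rfl, -⟩ := hi
  have h1 := h.lower_pos i hi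
  have h2 := h.lower_lt i hi
  have h3 := h.upper_le i hi
  have h4 := (hN.bounds h (x := U i) (by omega) h3).2
  have h5 := (hN.bounds h (x := V i) h1 (by omega)).2
  rw [blockOrder]
  refine ⟨by omega, ?_⟩
  unfold lowerIndex
  split_ifs with h6
  · rw [← h6]; omega
  · omega

theorem sum_best (h : BlockForest n m U V P cls) {idx best : ℕ → ℕ}
    (hN : Numbering n m U V P cls idx) {k : Bool}
    (hbest : ∀ t, 1 ≤ t → t ≤ n →
      IsBest (m * m) (fun x => cost k (classEdges U V cls idx m t)
          (fun i => insertPos (digit x) (blockOrder n m U V P cls t) (idx (U i)))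
          (fun i => insertPos (digit x) (blockOrder n m U V P cls t)
            (lowerIndex U V cls idx i)))
          (blockOrder n m U V P cls t).factorial (best t)) :
    ∑ t ∈ range n, best (t + 1) = opt k (range m) U V := by
  rw [h.opt_blocks]
  refine sum_congr rfl fun t ht => ?_
  rw [h.opt_block hN]
  refine (hbest (t + 1) (by omega) (mem_range.1 ht)).eq_opt ?_ (fun i hi => (h.label_lt hN hi).1)
    fun i hi => (h.label_lt hN hi).2
  have : #(classEdges U V cls idx m (t + 1)) ≤ m := (card_filter_le _ _).trans (by simp)
  exact Nat.mul_le_mul this this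

end BlockForest

theorem opt_num {n m : ℕ} {a b num U V : ℕ → ℕ} (k : Bool) (ha : ∀ i < m, a i < n)
    (hb : ∀ i < m, b i < n) (hnum : Set.InjOn num (Set.Icc 1 n))
    (hU : ∀ i < m, U i = max (num (a i + 1)) (num (b i + 1)))
    (hV : ∀ i < m, V i = min (num (a i + 1)) (num (b i + 1))) :
    opt k (range m) U V = opt k (range m) a b := by
  have hinj : Set.InjOn (fun x => num (x + 1)) (verts (range m) a b) := by
    have hv : ∀ x ∈ verts (range m) a b, x < n := by
      intro x hx
      simp only [verts, mem_union, mem_image, mem_range] at hx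
      rcases hx with ⟨i, hi, rfl⟩ | ⟨i, hi, rfl⟩
      · exact ha i hi
      · exact hb i hi
    intro x hx y hy hxy
    have h1 := hv x hx
    have h2 := hv y hy
    have := hnum (Set.mem_Icc.2 ⟨by omega, by omega⟩) (Set.mem_Icc.2 ⟨by omega, by omega⟩) hxy
    omega
  rw [← opt_relabel k hinj]
  refine opt_swap k fun i hi => ?_
  rw [hU i (mem_range.1 hi), hV i (mem_range.1 hi)]
  omega

end OnePage

namespace OnePage

open Finset

/-! ### The size of contracted blocks -/

/-- The vertices of the block with top vertex `t`, except for the parent of `t`. -/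
def blockVerts (n : ℕ) (cls : ℕ → ℕ) (t : ℕ) : Finset ℕ := {x ∈ Icc 1 n | cls x = t}

/-- The edges of a block that are not edges of the search forest. -/
def backEdges (m : ℕ) (U V P cls : ℕ → ℕ) (t : ℕ) : Finset ℕ :=
  {i ∈ range m | cls (U i) = t ∧ V i ≠ P (U i)}

theorem mem_blockVerts {n : ℕ} {cls : ℕ → ℕ} {t x : ℕ} :
    x ∈ blockVerts n cls t ↔ (1 ≤ x ∧ x ≤ n) ∧ cls x = t := by
  rw [blockVerts, mem_filter, mem_Icc]

theorem mem_backEdges {m : ℕ} {U V P cls : ℕ → ℕ} {t i : ℕ} :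
    i ∈ backEdges m U V P cls t ↔ i < m ∧ cls (U i) = t ∧ V i ≠ P (U i) := by
  rw [backEdges, mem_filter, mem_range]

theorem mem_blockEdges {m : ℕ} {U cls : ℕ → ℕ} {t i : ℕ} :
    i ∈ blockEdges m U cls t ↔ i < m ∧ cls (U i) = t := by
  rw [blockEdges, mem_filter, mem_range]

namespace BlockForest

variable {n m : ℕ} {U V P cls : ℕ → ℕ} {t : ℕ}

theorem upper_pos (h : BlockForest n m U V P cls) {i : ℕ} (hi : i < m) : 1 ≤ U i := by
  have := h.lower_lt i hi
  omega

/-- The path from `U i` visits `V i`, so one step from a vertex above `V i` cannot jump past it. -/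
theorem lower_le_parent (h : BlockForest n m U V P cls) {i : ℕ} (hi : i < m) {k : ℕ}
    (hk : V i < P^[k] (U i)) : V i ≤ P (P^[k] (U i)) := by
  obtain ⟨j, hj⟩ := h.comparable i hi
  have hUn := h.upper_le i hi
  rcases Nat.lt_or_ge k j with hkj | hkj
  · obtain ⟨l, rfl⟩ := Nat.exists_eq_add_of_lt hkj
    rw [← hj, show k + l + 1 = l + (k + 1) by ring, Function.iterate_add_apply,
      Function.iterate_succ_apply' P k]
    rw [← Function.iterate_succ_apply' P k]
    exact h.iterate_le ((h.iterate_le hUn _).trans hUn) l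
  · obtain ⟨l, rfl⟩ := Nat.exists_eq_add_of_le hkj
    rw [show j + l = l + j by ring, Function.iterate_add_apply, hj] at hk
    have := h.iterate_le (x := V i) (by have := h.lower_lt i hi; omega) l
    omega

/-- A vertex joins the class of its parent only when some edge jumps over that parent. Such an edge
lies in the same class by `cls_of_path`, and it is not a forest edge. -/
theorem exists_back_of_covered (h : BlockForest n m U V P cls) {x : ℕ} (hx : x ∈ blockVerts n cls t)
    (hxt : x ≠ t) : ∃ i ∈ backEdges m U V P cls t, ∃ k, P^[k] (U i) = x ∧ V i < P x := by
  obtain ⟨⟨h1, h2⟩, hc⟩ := mem_blockVerts.1 hx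
  have hcov : Covered m U V P x := by
    by_contra hn
    have := h.cls_eq x h1 h2
    rw [if_neg hn] at this
    omega
  obtain ⟨i, hi, ⟨k, hk⟩, hlt⟩ := hcov
  have hP := h.parent_lt x h1 h2
  have hUn := h.upper_le i hi
  refine ⟨i, mem_backEdges.2 ⟨hi, ?_, ?_⟩, k, hk, hlt⟩
  · rw [← h.cls_of_path hi k (by omega), hk, hc]
  · rintro hV
    rcases k with _ | k
    · simp only [Function.iterate_zero, id] at hk
      rw [hk] at hV
      omega
    · rw [Function.iterate_succ_apply, ← hV] at hk
      have := h.iterate_le (x := V i) (by have := h.lower_lt i hi; omega) k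
      omega

theorem parent_mem (h : BlockForest n m U V P cls) {x : ℕ} (hx : x ∈ blockVerts n cls t)
    (hxt : x ≠ t) : P x ∈ blockVerts n cls t ∧ P x < x := by
  obtain ⟨⟨h1, h2⟩, hc⟩ := mem_blockVerts.1 hx
  obtain ⟨e1, e2, e3⟩ := h.cls_parent h1 h2 (by omega)
  exact ⟨mem_blockVerts.2 ⟨⟨e2, by omega⟩, by omega⟩, e3⟩

theorem le_of_mem (h : BlockForest n m U V P cls) {x : ℕ} (hx : x ∈ blockVerts n cls t) : t ≤ x := by
  obtain ⟨⟨h1, h2⟩, hc⟩ := mem_blockVerts.1 hx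
  have := h.cls_bounds h1 h2
  omega

/-- A back edge cannot start at `t`, since it would cover `t`. So the class has another vertex, and
the least such vertex has parent `t`. -/
theorem exists_child_top (h : BlockForest n m U V P cls) (ht : t ∈ blockVerts n cls t)
    (hK : (backEdges m U V P cls t).Nonempty) :
    ∃ y ∈ blockVerts n cls t, y ≠ t ∧ P y = t := by
  have hex : ∃ x, x ∈ blockVerts n cls t ∧ x ≠ t := by
    obtain ⟨i, hi⟩ := hK
    obtain ⟨hi, hc, hV⟩ := mem_backEdges.1 hi
    refine ⟨U i, mem_blockVerts.2 ⟨⟨h.upper_pos hi, h.upper_le i hi⟩, hc⟩, fun hU => ?_⟩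
    have hle := h.lower_le_parent hi (k := 0) (h.lower_lt i hi)
    simp only [Function.iterate_zero, id] at hle
    have hcov : Covered m U V P t := ⟨i, hi, ⟨0, hU⟩, by rw [← hU]; omega⟩
    obtain ⟨⟨h1, h2⟩, hct⟩ := mem_blockVerts.1 ht
    have h3 := h.cls_eq t h1 h2
    rw [if_pos hcov] at h3
    have h4 := h.parent_lt t h1 h2
    have h5 : 1 ≤ P t := by
      have := h.lower_pos i hi
      rw [← hU]; omega
    have := h.cls_bounds h5 (by omega)
    omega
  classical
  obtain ⟨h1, h2⟩ := Nat.find_spec hex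
  refine ⟨Nat.find hex, h1, h2, ?_⟩
  obtain ⟨h3, h4⟩ := h.parent_mem h1 h2
  by_contra hne
  exact Nat.find_min hex h4 ⟨h3, hne⟩

/-- The edge that covers a child of `t` jumps over `t` and must end at `P t`. With the forest edge
of `t` it gives the root degree at least two, which saves the constant in `size`. -/
theorem exists_root_edge (h : BlockForest n m U V P cls) (ht : t ∈ blockVerts n cls t)
    (hK : (backEdges m U V P cls t).Nonempty) :
    1 ≤ P t ∧ ∃ i ∈ blockEdges m U cls t, V i = P t ∧ U i ≠ t := by
  obtain ⟨y, hy, hyt, hPy⟩ := h.exists_child_top ht hK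
  obtain ⟨i, hi, k, hk, hlt⟩ := h.exists_back_of_covered hy hyt
  obtain ⟨hi, hc, -⟩ := mem_backEdges.1 hi
  have hyt' := h.le_of_mem hy
  have hV := h.lower_pos i hi
  have hVt : V i = P t := by
    rcases h.cls_lower hi with h1 | h1
    · have := h.cls_bounds hV (by have := h.lower_lt i hi; have := h.upper_le i hi; omega)
      omega
    · rw [h1, hc]
  refine ⟨by omega, i, mem_blockEdges.2 ⟨hi, hc⟩, hVt, fun hU => ?_⟩
  have := h.iterate_le (h.upper_le i hi) k
  omega

theorem exists_child_or_back (h : BlockForest n m U V P cls) (ht : t ∈ blockVerts n cls t)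
    (hK : (backEdges m U V P cls t).Nonempty) {x : ℕ} (hx : x ∈ blockVerts n cls t) :
    (∃ y ∈ blockVerts n cls t, y ≠ t ∧ P y = x) ∨ ∃ i ∈ backEdges m U V P cls t, U i = x := by
  by_cases hxt : x = t
  · subst hxt
    exact Or.inl (h.exists_child_top ht hK)
  · obtain ⟨i, hi, k, hk, hlt⟩ := h.exists_back_of_covered hx hxt
    obtain ⟨hi', hc, -⟩ := mem_backEdges.1 hi
    have htx := h.le_of_mem hx
    obtain ⟨hPx, hPlt⟩ := h.parent_mem hx hxt
    rcases k with _ | k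
    · exact Or.inr ⟨i, hi, hk⟩
    · left
      have hle := h.iterate_le (h.upper_le i hi') k
      rw [Function.iterate_succ_apply'] at hk
      have hyn : P^[k] (U i) ≤ n := hle.trans (h.upper_le i hi')
      have hyx : x ≤ P^[k] (U i) := hk ▸ h.parent_le hyn
      have hlt' : P (P^[k] (U i)) < P^[k] (U i) := h.parent_lt _ (by omega) hyn
      exact ⟨P^[k] (U i), mem_blockVerts.2 ⟨⟨by omega, hyn⟩, by
        rw [h.cls_of_path hi' k (by omega), hc]⟩, by omega, hk⟩

/-- One edge leads to the parent; the other leads to a child in the class or is a back edge that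
starts here. -/
theorem two_le_classDegree (h : BlockForest n m U V P cls) (ht : t ∈ blockVerts n cls t)
    (hK : (backEdges m U V P cls t).Nonempty) {x : ℕ} (hx : x ∈ blockVerts n cls t) :
    2 ≤ classDegree m U V cls x := by
  obtain ⟨⟨h1, h2⟩, hc⟩ := mem_blockVerts.1 hx
  have hP : P x ≠ 0 := by
    by_cases hxt : x = t
    · have := (h.exists_root_edge ht hK).1
      rw [hxt]; omega
    · have := (mem_blockVerts.1 (h.parent_mem hx hxt).1).1
      omega
  obtain ⟨e, he, hU, hV⟩ := h.tree x h1 h2 hP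
  have key : ∃ e' < m, e' ≠ e ∧ (U e' = x ∨ (V e' = x ∧ cls (V e') = cls (U e'))) := by
    rcases h.exists_child_or_back ht hK hx with ⟨y, hy, hyt, hPy⟩ | ⟨i, hi, hi'⟩
    · obtain ⟨⟨h3, h4⟩, hcy⟩ := mem_blockVerts.1 hy
      obtain ⟨e', he', hU', hV'⟩ := h.tree y h3 h4 (by omega)
      refine ⟨e', he', ?_, Or.inr ⟨by omega, ?_⟩⟩
      · rintro rfl
        have := (h.parent_mem hy hyt).2
        omega
      · rw [hU', hV', hPy]; omega
    · obtain ⟨h3, -, h4⟩ := mem_backEdges.1 hi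
      refine ⟨i, h3, ?_, Or.inl hi'⟩
      rintro rfl
      exact h4 (by rw [hV, hU])
  obtain ⟨e', he', hne, hor⟩ := key
  have hsub : ({e', e} : Finset ℕ) ⊆ range m := by
    intro i hi
    simp only [mem_insert, mem_singleton] at hi
    rw [mem_range]
    omega
  refine le_trans ?_ (sum_le_sum_of_subset hsub)
  rw [sum_pair hne, if_pos hU]
  have : 1 ≤ (if U e' = x then 1 else 0) + (if V e' = x ∧ cls (V e') = cls (U e') then 1 else 0) := by
    rcases hor with hor | hor
    · rw [if_pos hor]; omega
    · rw [if_pos hor]; omega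
  omega

theorem card_treeEdges (h : BlockForest n m U V P cls) :
    #{i ∈ blockEdges m U cls t | V i = P (U i)} = #{x ∈ blockVerts n cls t | P x ≠ 0} := by
  apply card_bij (fun i _ => U i)
  · intro i hi
    obtain ⟨hi, hV⟩ := mem_filter.1 hi
    obtain ⟨hi, hc⟩ := mem_blockEdges.1 hi
    have := h.lower_pos i hi
    exact mem_filter.2 ⟨mem_blockVerts.2 ⟨⟨h.upper_pos hi, h.upper_le i hi⟩, hc⟩, by omega⟩
  · intro i hi j hj hij
    obtain ⟨hi, hV⟩ := mem_filter.1 hi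
    obtain ⟨hj, hV'⟩ := mem_filter.1 hj
    exact h.inj i (mem_blockEdges.1 hi).1 j (mem_blockEdges.1 hj).1 hij (by rw [hV, hV', hij])
  · intro x hx
    obtain ⟨hx, hP⟩ := mem_filter.1 hx
    obtain ⟨⟨h1, h2⟩, hc⟩ := mem_blockVerts.1 hx
    obtain ⟨e, he, hU, hV⟩ := h.tree x h1 h2 hP
    exact ⟨e, mem_filter.2 ⟨mem_blockEdges.2 ⟨he, by rw [hU, hc]⟩, by rw [hU, hV]⟩, hU⟩

theorem card_blockEdges (h : BlockForest n m U V P cls) :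
    #(blockEdges m U cls t) = #{x ∈ blockVerts n cls t | P x ≠ 0} + #(backEdges m U V P cls t) := by
  rw [← h.card_treeEdges, ← card_filter_add_card_filter_not (fun i => V i = P (U i))]
  congr 2
  rw [blockEdges, filter_filter, backEdges]

/-- Handshake lemma for a block whose root is left out: edges at the root are counted only once and
are made up for by the second summand. -/
theorem sum_classDegree (h : BlockForest n m U V P cls) :
    ∑ x ∈ blockVerts n cls t, classDegree m U V cls x + #{i ∈ blockEdges m U cls t | cls (V i) ≠ t} =
      2 * #(blockEdges m U cls t) := by
  have h1 : ∑ x ∈ blockVerts n cls t, classDegree m U V cls x =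
      ∑ i ∈ blockEdges m U cls t, (1 + if cls (V i) = t then 1 else 0) := by
    simp only [classDegree]
    rw [sum_comm, blockEdges, sum_filter]
    refine sum_congr rfl fun i hi => ?_
    have hi := mem_range.1 hi
    have hUm : U i ∈ blockVerts n cls t ↔ cls (U i) = t := by
      rw [mem_blockVerts]
      exact and_iff_right ⟨h.upper_pos hi, h.upper_le i hi⟩
    have hVm : V i ∈ blockVerts n cls t ↔ cls (V i) = t := by
      rw [mem_blockVerts]
      exact and_iff_right ⟨h.lower_pos i hi, (h.lower_lt i hi).le.trans (h.upper_le i hi)⟩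
    rw [sum_add_distrib, sum_ite_eq]
    have h2 : ∑ x ∈ blockVerts n cls t, (if V i = x ∧ cls (V i) = cls (U i) then 1 else 0) =
        if V i ∈ blockVerts n cls t ∧ cls (V i) = cls (U i) then 1 else 0 := by
      by_cases hc : cls (V i) = cls (U i)
      · simp [hc]
      · simp [hc]
    rw [h2]
    simp only [hUm, hVm]
    split_ifs <;> omega
  have h2 := card_filter_add_card_filter_not (s := blockEdges m U cls t) (fun i => cls (V i) = t)
  rw [h1, sum_add_distrib, ← card_filter, sum_const, smul_eq_mul, mul_one]
  simp only [ne_eq]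
  omega

/-- With `K` back edges, `A` the vertices of degree at least three and `C` their children other than
`t`, one has `#A ≤ 2 * K - 2` and `#C ≤ #A + K - 1`. What remains lies in `{t} ∪ A ∪ C`, hence has
at most `2 * #A + K ≤ 5 * K - 4` elements, and the root adds one. The edges that survive are back
edges or forest edges above remaining vertices. -/
theorem size (h : BlockForest n m U V P cls) {idx : ℕ → ℕ} (hN : Numbering n m U V P cls idx)
    (ht : cls t = t) (h1 : 1 ≤ t) (h2 : t ≤ n) (hK : (backEdges m U V P cls t).Nonempty) :
    blockOrder n m U V P cls t + 3 ≤ 5 * #(backEdges m U V P cls t) ∧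
      #(classEdges U V cls idx m t) ≤ 6 * #(backEdges m U V P cls t) := by
  classical
  have htm : t ∈ blockVerts n cls t := mem_blockVerts.2 ⟨⟨h1, h2⟩, ht⟩
  obtain ⟨A, hA⟩ : ∃ A, A = {x ∈ blockVerts n cls t | 3 ≤ classDegree m U V cls x} := ⟨_, rfl⟩
  -- Every vertex of the class has degree at least two, and there are at most `#(blockVerts n cls t)
  -- + K` edges, at least two of them at the root.
  have hAcard : #A + 2 ≤ 2 * #(backEdges m U V P cls t) := by
    have e1 := h.sum_classDegree (t := t)
    have e2 := h.card_blockEdges (t := t)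
    have e3 : #{x ∈ blockVerts n cls t | P x ≠ 0} ≤ #(blockVerts n cls t) := card_filter_le _ _
    have e4 : 2 ≤ #{i ∈ blockEdges m U cls t | cls (V i) ≠ t} := by
      obtain ⟨hP, i, hi, hV, hU⟩ := h.exists_root_edge htm hK
      obtain ⟨e, he, hU', hV'⟩ := h.tree t h1 h2 (by omega)
      have hPt := h.parent_lt t h1 h2
      have hcP := (h.cls_bounds hP (by omega)).2
      have hsub : ({i, e} : Finset ℕ) ⊆ {i ∈ blockEdges m U cls t | cls (V i) ≠ t} := by
        intro j hj
        simp only [mem_insert, mem_singleton] at hj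
        rw [mem_filter]
        rcases hj with rfl | rfl
        · exact ⟨hi, by rw [hV]; omega⟩
        · exact ⟨mem_blockEdges.2 ⟨he, by rw [hU', ht]⟩, by rw [hV']; omega⟩
      have := card_le_card hsub
      rwa [card_pair (by rintro rfl; exact hU hU')] at this
    have e5 : 2 * #(blockVerts n cls t) + #A ≤ ∑ x ∈ blockVerts n cls t, classDegree m U V cls x := by
      rw [hA, card_filter, card_eq_sum_ones, mul_sum, ← sum_add_distrib]
      refine sum_le_sum fun x hx => ?_
      have := h.two_le_classDegree htm hK hx
      split_ifs <;> omega
    omega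
  obtain ⟨C, hC⟩ : ∃ C, C = {y ∈ (blockVerts n cls t).erase t | P y ∈ A} := ⟨_, rfl⟩
  -- Each vertex outside `A` has a child or starts a back edge. So all but `K` of them use up a
  -- child whose parent is not in `A`, which limits the children left for `A`.
  have hCcard : #C + 1 ≤ #A + #(backEdges m U V P cls t) := by
    have e1 : #C + #{y ∈ (blockVerts n cls t).erase t | ¬ P y ∈ A} + 1 = #(blockVerts n cls t) := by
      rw [hC, card_filter_add_card_filter_not, card_erase_add_one htm]
    have e2 : blockVerts n cls t \ A ⊆
        ({y ∈ (blockVerts n cls t).erase t | ¬ P y ∈ A}).image P ∪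
          (backEdges m U V P cls t).image U := by
      intro x hx
      obtain ⟨hx, hxA⟩ := mem_sdiff.1 hx
      rw [mem_union, mem_image, mem_image]
      rcases h.exists_child_or_back htm hK hx with ⟨y, hy, hyt, hPy⟩ | h3
      · exact Or.inl ⟨y, mem_filter.2 ⟨mem_erase.2 ⟨hyt, hy⟩, by rwa [hPy]⟩, hPy⟩
      · exact Or.inr h3
    have e3 := (card_le_card e2).trans ((card_union_le _ _).trans
      (add_le_add card_image_le card_image_le))
    have e4 := le_card_sdiff A (blockVerts n cls t)
    omega
  have hrem : remaining cls (classDegree m U V cls) P n t ⊆ insert t (A ∪ C) := by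
    intro x hx
    obtain ⟨hxI, hnc, hc⟩ := mem_filter.1 hx
    have hxm : x ∈ blockVerts n cls t := mem_blockVerts.2 ⟨mem_Icc.1 hxI, hc⟩
    rw [mem_insert, mem_union]
    by_cases hxt : x = t
    · exact Or.inl hxt
    right
    unfold Contracted at hnc
    by_cases hd : classDegree m U V cls x < 3
    · right
      rw [hC, mem_filter, mem_erase, hA, mem_filter]
      refine ⟨⟨hxt, hxm⟩, (h.parent_mem hxm hxt).1, ?_⟩
      by_contra h3
      exact hnc ⟨by omega, hd, by omega⟩
    · left
      rw [hA, mem_filter]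
      exact ⟨hxm, by omega⟩
  have hremcard := (card_le_card hrem).trans ((card_insert_le _ _).trans
    (Nat.add_le_add_right (card_union_le A C) 1))
  have hedges : #(classEdges U V cls idx m t) ≤
      #(remaining cls (classDegree m U V cls) P n t) + #(backEdges m U V P cls t) := by
    have hsub : classEdges U V cls idx m t ⊆
        {i ∈ classEdges U V cls idx m t | V i = P (U i)} ∪ backEdges m U V P cls t := by
      intro i hi
      rw [mem_union, mem_filter, mem_backEdges]
      by_cases hV : V i = P (U i)
      · exact Or.inl ⟨hi, hV⟩
      · obtain ⟨h3, h4, -⟩ := mem_filter.1 hi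
        exact Or.inr ⟨mem_range.1 h3, h4, hV⟩
    refine (card_le_card hsub).trans ((card_union_le _ _).trans (Nat.add_le_add_right ?_ _))
    -- A forest edge is determined by its upper end, and if that end were contracted the edge would
    -- be a loop.
    refine card_le_card_of_injOn U ?_ ?_
    · intro i hi
      obtain ⟨hi, hV⟩ := mem_filter.1 (mem_coe.1 hi)
      obtain ⟨hi, hc, hne⟩ := mem_filter.1 hi
      have hi := mem_range.1 hi
      refine mem_coe.2 (mem_filter.2 ⟨mem_Icc.2 ⟨h.upper_pos hi, h.upper_le i hi⟩, fun hcon => hne ?_,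
        hc⟩)
      have := (h.cls_parent (h.upper_pos hi) (h.upper_le i hi) hcon.1).1
      rw [lowerIndex, hV, if_pos this.symm]
      exact hN.contracted _ (h.upper_pos hi) (h.upper_le i hi) hcon
    · intro i hi j hj hij
      obtain ⟨hi, hV⟩ := mem_filter.1 (mem_coe.1 hi)
      obtain ⟨hj, hV'⟩ := mem_filter.1 (mem_coe.1 hj)
      exact h.inj i (mem_range.1 (mem_filter.1 hi).1) j (mem_range.1 (mem_filter.1 hj).1) hij
        (by rw [hV, hV', hij])
  rw [blockOrder]
  omega

/-- A second vertex in the class would require a back edge, so the block is at most one edge. -/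
theorem size_of_no_back (h : BlockForest n m U V P cls) {idx : ℕ → ℕ}
    (hK : backEdges m U V P cls t = ∅) :
    blockOrder n m U V P cls t ≤ 2 ∧ #(classEdges U V cls idx m t) ≤ 1 := by
  have hsub : blockVerts n cls t ⊆ {t} := by
    intro x hx
    rw [mem_singleton]
    by_contra hxt
    obtain ⟨i, hi, -⟩ := h.exists_back_of_covered hx hxt
    rw [hK] at hi
    simp at hi
  have hcard := card_le_card hsub
  rw [card_singleton] at hcard
  classical
  constructor
  · have : remaining cls (classDegree m U V cls) P n t ⊆ blockVerts n cls t := by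
      intro x hx
      obtain ⟨h1, -, h2⟩ := mem_filter.1 hx
      exact mem_blockVerts.2 ⟨mem_Icc.1 h1, h2⟩
    have := card_le_card this
    rw [blockOrder]
    omega
  · have e1 : classEdges U V cls idx m t ⊆ blockEdges m U cls t := by
      intro i hi
      obtain ⟨h1, h2, -⟩ := mem_filter.1 hi
      exact mem_filter.2 ⟨h1, h2⟩
    have e2 := h.card_blockEdges (t := t)
    rw [hK, card_empty] at e2
    have e3 : #{x ∈ blockVerts n cls t | P x ≠ 0} ≤ #(blockVerts n cls t) := card_filter_le _ _
    have := card_le_card e1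
    omega

end BlockForest

end OnePage

namespace OnePage

open Finset

/-! ### Cyclomatic numbers -/

theorem exists_isMaximalForest {W : Type*} (G : SimpleGraph W) : ∃ F, IsMaximalForest G F := by
  obtain ⟨F, -, hF⟩ := SimpleGraph.exists_maximal_isAcyclic_of_le_isAcyclic (bot_le (a := G))
    SimpleGraph.isAcyclic_bot
  exact ⟨F, hF⟩

/-- Extend `F` to a spanning tree `T` of the complete graph. Then `H'` together with `T \ F` is
connected, so it has at least as many edges as `T`. -/
theorem ncard_edgeSet_le_of_reachable {W : Type*} [Finite W] {H H' F : SimpleGraph W} (hF : F ≤ H)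
    (hFa : F.IsAcyclic) (hr : ∀ u v, H.Adj u v → H'.Reachable u v) :
    F.edgeSet.ncard ≤ H'.edgeSet.ncard := by
  rcases isEmpty_or_nonempty W with hW | hW
  · rw [show F.edgeSet = ∅ from Set.eq_empty_of_isEmpty _]
    simp
  classical
  obtain ⟨T, hFT, -, hT⟩ :=
    SimpleGraph.connected_top.exists_isTree_le_of_le_of_isAcyclic (le_top (a := F)) hFa
  have hTcard : T.edgeSet.ncard + 1 = Nat.card W := by
    have := (SimpleGraph.isTree_iff_connected_and_card.1 hT).2
    rwa [Nat.card_coe_set_eq] at this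
  have hconn : (H' ⊔ T \ F).Connected := by
    have : Nonempty W := hW
    refine ⟨fun u v => ?_⟩
    obtain ⟨p⟩ := hT.1.preconnected u v
    induction p with
    | nil => rfl
    | cons h p ih =>
      refine SimpleGraph.Reachable.trans ?_ ih
      rename_i a b c
      by_cases hab : F.Adj a b
      · exact (hr a b (hF hab)).mono le_sup_left
      · exact SimpleGraph.Adj.reachable (Or.inr ⟨h, hab⟩)
  have h1 := hconn.card_vert_le_card_edgeSet_add_one
  rw [Nat.card_coe_set_eq, SimpleGraph.edgeSet_sup, SimpleGraph.edgeSet_sdiff] at h1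
  have h2 := Set.ncard_union_le H'.edgeSet (T.edgeSet \ F.edgeSet)
  have h3 := Set.ncard_sdiff_add_ncard_of_subset (SimpleGraph.edgeSet_mono hFT)
  omega

/-- Edges that can be deleted without changing the connected components. -/
theorem ncard_le_cyclomaticNumber {W : Type*} [Finite W] {H : SimpleGraph W} {B : Set (Sym2 W)}
    (hB : B ⊆ H.edgeSet) (hr : ∀ u v, s(u, v) ∈ B → (H.deleteEdges B).Reachable u v) :
    B.ncard ≤ cyclomaticNumber H := by
  have hne : {k | ∃ F : SimpleGraph W, IsMaximalForest H F ∧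
      H.edgeSet.ncard = F.edgeSet.ncard + k}.Nonempty := by
    obtain ⟨F, hF⟩ := exists_isMaximalForest H
    have := Set.ncard_le_ncard (SimpleGraph.edgeSet_mono hF.prop.1)
    exact ⟨H.edgeSet.ncard - F.edgeSet.ncard, F, hF, by omega⟩
  obtain ⟨F, hF, hcard⟩ := Nat.sInf_mem hne
  change _ = _ + cyclomaticNumber H at hcard
  have h1 := ncard_edgeSet_le_of_reachable (H' := H.deleteEdges B) hF.prop.1 hF.prop.2
    fun u v huv => by
      by_cases h : s(u, v) ∈ B
      · exact hr u v h
      · exact SimpleGraph.Adj.reachable (SimpleGraph.deleteEdges_adj.2 ⟨huv, h⟩)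
  rw [SimpleGraph.edgeSet_deleteEdges] at h1
  have h2 := Set.ncard_sdiff_add_ncard_of_subset hB
  omega

/-- The search forest describes the graph `G`; the vertex with number `x` is `φ x`. -/
structure Represents {n : ℕ} (G : SimpleGraph (Fin n)) (m : ℕ) (U V : ℕ → ℕ) (φ : ℕ → Fin n) :
    Prop where
  injOn : Set.InjOn φ (Set.Icc 1 n)
  adj : ∀ i < m, G.Adj (φ (U i)) (φ (V i))

namespace BlockForest

variable {n m : ℕ} {U V P cls : ℕ → ℕ} {t : ℕ} {G : SimpleGraph (Fin n)} {φ : ℕ → Fin n}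

theorem edge_inj (h : BlockForest n m U V P cls) (hφ : Represents G m U V φ) {i j : ℕ} (hi : i < m)
    (hj : j < m) (he : s(φ (U i), φ (V i)) = s(φ (U j), φ (V j))) : i = j := by
  have h1 := h.lower_lt i hi
  have h2 := h.lower_lt j hj
  have mU : ∀ i < m, U i ∈ Set.Icc 1 n := fun i hi => ⟨h.upper_pos hi, h.upper_le i hi⟩
  have mV : ∀ i < m, V i ∈ Set.Icc 1 n := fun i hi =>
    ⟨h.lower_pos i hi, (h.lower_lt i hi).le.trans (h.upper_le i hi)⟩
  rw [Sym2.eq_iff] at he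
  rcases he with ⟨e1, e2⟩ | ⟨e1, e2⟩
  · exact h.inj i hi j hj (hφ.injOn (mU i hi) (mU j hj) e1) (hφ.injOn (mV i hi) (mV j hj) e2)
  · have := hφ.injOn (mU i hi) (mV j hj) e1
    have := hφ.injOn (mV i hi) (mU j hj) e2
    omega

/-- Each edge of `S` can be deleted without loss, since the forest path between its ends survives.
The map `ι` allows `H` to be the whole graph as well as a biconnected component on its own vertex
type. -/
theorem card_le_cyclomaticNumber (h : BlockForest n m U V P cls) (hφ : Represents G m U V φ)
    {W : Type*} [Finite W] {H : SimpleGraph W} {ι : W → Fin n} (hι : Function.Injective ι)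
    {S : Finset ℕ} (hS : ∀ i ∈ S, i < m ∧ V i ≠ P (U i))
    (hback : ∀ i ∈ S, ∃ a b, ι a = φ (U i) ∧ ι b = φ (V i) ∧ H.Adj a b)
    (htree : ∀ i ∈ S, ∀ k, V i < P^[k] (U i) →
      ∃ a b, ι a = φ (P^[k] (U i)) ∧ ι b = φ (P (P^[k] (U i))) ∧ H.Adj a b) :
    #S ≤ cyclomaticNumber H := by
  obtain ⟨E, hE⟩ : ∃ E : ℕ → Sym2 (Fin n), ∀ i, E i = s(φ (U i), φ (V i)) := ⟨_, fun _ => rfl⟩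
  obtain ⟨B, hB⟩ : ∃ B : Set (Sym2 W), ∀ e, e ∈ B ↔ ∃ i ∈ S, E i = e.map ι :=
    ⟨{e | ∃ i ∈ S, E i = e.map ι}, fun _ => Iff.rfl⟩
  have hcard : B.ncard = #S := by
    rw [← Set.ncard_image_of_injective B (Sym2.map.injective hι)]
    have : Sym2.map ι '' B = E '' S := by
      ext e
      simp only [Set.mem_image, mem_coe]
      constructor
      · rintro ⟨e, he, rfl⟩
        exact (hB e).1 he
      · rintro ⟨i, hi, rfl⟩
        obtain ⟨a, b, ha, hb, -⟩ := hback i hi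
        refine ⟨s(a, b), (hB _).2 ⟨i, hi, ?_⟩, ?_⟩ <;> rw [Sym2.map_mk, hE, ha, hb]
    rw [this, Set.InjOn.ncard_image, Set.ncard_coe_finset]
    intro i hi j hj hij
    rw [hE, hE] at hij
    exact h.edge_inj hφ (hS i hi).1 (hS j hj).1 hij
  rw [← hcard]
  have hBH : ∀ u v, s(u, v) ∈ B → ∃ i ∈ S, H.Adj u v ∧
      ((ι u = φ (U i) ∧ ι v = φ (V i)) ∨ (ι v = φ (U i) ∧ ι u = φ (V i))) := by
    intro u v huv
    obtain ⟨i, hi, he⟩ := (hB _).1 huv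
    obtain ⟨a, b, ha, hb, hab⟩ := hback i hi
    rw [hE, Sym2.map_mk, Sym2.eq_iff] at he
    rcases he with ⟨e1, e2⟩ | ⟨e1, e2⟩
    · obtain rfl := hι (ha.trans e1)
      obtain rfl := hι (hb.trans e2)
      exact ⟨i, hi, hab, Or.inl ⟨ha, hb⟩⟩
    · obtain rfl := hι (ha.trans e1)
      obtain rfl := hι (hb.trans e2)
      exact ⟨i, hi, hab.symm, Or.inr ⟨ha, hb⟩⟩
  have hpath : ∀ i ∈ S, ∀ a, ι a = φ (U i) → ∀ k, V i ≤ P^[k] (U i) →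
      ∃ b, ι b = φ (P^[k] (U i)) ∧ (H.deleteEdges B).Reachable a b := by
    intro i hi a ha k
    have him := (hS i hi).1
    have hV := h.lower_pos i him
    have hUn := h.upper_le i him
    induction k with
    | zero => exact fun _ => ⟨a, ha, SimpleGraph.Reachable.refl _⟩
    | succ k ih =>
      intro hk
      rw [Function.iterate_succ_apply'] at hk ⊢
      have hle := h.iterate_le hUn k
      have hpos : 1 ≤ P^[k] (U i) := by
        by_contra h0
        rw [show P^[k] (U i) = 0 by omega, h.parent_zero] at hk
        omega
      have hlt := h.parent_lt _ hpos (hle.trans hUn)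
      obtain ⟨b, hb, hab⟩ := ih (by omega)
      obtain ⟨b', c, hb', hc, hbc⟩ := htree i hi k (by omega)
      obtain rfl := hι (hb.trans hb'.symm)
      refine ⟨c, hc, hab.trans (SimpleGraph.Adj.reachable
        (SimpleGraph.deleteEdges_adj.2 ⟨hbc, fun hmem => ?_⟩))⟩
      -- A forest edge is never deleted: by uniqueness of edges it would belong to `S`, which
      -- contains only edges outside the forest.
      obtain ⟨j, hj, he⟩ := (hB _).1 hmem
      obtain ⟨e, hem, hU, hVe⟩ := h.tree _ hpos (hle.trans hUn) (by omega)
      rw [hE, Sym2.map_mk, hb, hc, ← hVe, ← hU] at he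
      have := h.edge_inj hφ (hS j hj).1 hem he
      subst this
      exact (hS j hj).2 (by rw [hVe, hU])
  apply ncard_le_cyclomaticNumber
  · intro e
    induction e with
    | _ u v =>
      intro huv
      obtain ⟨i, -, hadj, -⟩ := hBH u v huv
      exact hadj
  · intro u v huv
    have key : ∀ i ∈ S, ∀ u v, ι u = φ (U i) → ι v = φ (V i) → (H.deleteEdges B).Reachable u v := by
      intro i hi u v hu hv
      obtain ⟨k, hk⟩ := h.comparable i (hS i hi).1
      obtain ⟨b, hb, hr⟩ := hpath i hi u hu k (by rw [hk])
      rw [hk, ← hv] at hb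
      rwa [← hι hb]
    obtain ⟨i, hi, -, ⟨h1, h2⟩ | ⟨h1, h2⟩⟩ := hBH u v huv
    · exact key i hi u v h1 h2
    · exact (key i hi v u h1 h2).symm

theorem parent_adj (h : BlockForest n m U V P cls) (hφ : Represents G m U V φ) {x : ℕ} (h1 : 1 ≤ x)
    (h2 : x ≤ n) (hP : P x ≠ 0) : G.Adj (φ x) (φ (P x)) := by
  obtain ⟨e, he, hU, hV⟩ := h.tree x h1 h2 hP
  have := hφ.adj e he
  rwa [hU, hV] at this

theorem sum_back (h : BlockForest n m U V P cls) :
    ∑ s ∈ range n, #(backEdges m U V P cls (s + 1)) = #{i ∈ range m | V i ≠ P (U i)} := by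
  rw [card_eq_sum_card_fiberwise (f := fun i => cls (U i)) (t := (range n).image (· + 1)),
    sum_image (fun a _ b _ hab => by omega)]
  · refine sum_congr rfl fun s _ => ?_
    rw [filter_filter, backEdges]
    congr 1
    ext i
    simp only [mem_filter]
    tauto
  · intro i hi
    have hi := mem_range.1 (mem_filter.1 (mem_coe.1 hi)).1
    have h1 := h.cls_bounds (h.upper_pos hi) (h.upper_le i hi)
    have h2 := h.upper_le i hi
    exact mem_coe.2 (mem_image.2 ⟨cls (U i) - 1, mem_range.2 (by omega), Nat.sub_add_cancel h1.1⟩)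

theorem sum_back_le (h : BlockForest n m U V P cls) (hφ : Represents G m U V φ) :
    ∑ s ∈ range n, #(backEdges m U V P cls (s + 1)) ≤ cyclomaticNumber G := by
  rw [h.sum_back]
  refine h.card_le_cyclomaticNumber hφ (ι := id) Function.injective_id ?_ ?_ ?_
  · intro i hi
    exact ⟨mem_range.1 (mem_filter.1 hi).1, (mem_filter.1 hi).2⟩
  · intro i hi
    exact ⟨_, _, rfl, rfl, hφ.adj i (mem_range.1 (mem_filter.1 hi).1)⟩
  · intro i hi k hk
    have hi := mem_range.1 (mem_filter.1 hi).1
    have hle := h.lower_le_parent hi hk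
    have := h.lower_pos i hi
    exact ⟨_, _, rfl, rfl, h.parent_adj hφ (by omega)
      ((h.iterate_le (h.upper_le i hi) k).trans (h.upper_le i hi)) (by omega)⟩

/-- Forest edges have distinct upper ends, so there are at most `n` of them. This bounds `m` in the
linear part of the running time. -/
theorem card_le_add_sum_back (h : BlockForest n m U V P cls) :
    m ≤ n + ∑ s ∈ range n, #(backEdges m U V P cls (s + 1)) := by
  rw [h.sum_back]
  have h1 := card_filter_add_card_filter_not (s := range m) (fun i => V i = P (U i))
  rw [card_range] at h1
  have h2 : #{i ∈ range m | V i = P (U i)} ≤ #(Icc 1 n) := by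
    apply card_le_card_of_injOn U
    · intro i hi
      have hi := mem_range.1 (mem_filter.1 (mem_coe.1 hi)).1
      exact mem_coe.2 (mem_Icc.2 ⟨h.upper_pos hi, h.upper_le i hi⟩)
    · intro i hi j hj hij
      obtain ⟨hi, hV⟩ := mem_filter.1 (mem_coe.1 hi)
      obtain ⟨hj, hV'⟩ := mem_filter.1 (mem_coe.1 hj)
      exact h.inj i (mem_range.1 hi) j (mem_range.1 hj) hij (by rw [hV, hV', hij])
  rw [Nat.card_Icc] at h2
  simp only [ne_eq]
  omega

/-! ### Blocks are biconnected -/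

/-- The block with top vertex `t` stays connected if a vertex `z` is deleted. -/
theorem block_linked (h : BlockForest n m U V P cls) (ht : t ∈ blockVerts n cls t) {z : ℕ}
    (hP : P t ≠ 0) (hz : z ≠ P t) {Q : ℕ → ℕ → Prop} (hsymm : ∀ x y, Q x y → Q y x)
    (htrans : ∀ x y w, Q x y → Q y w → Q x w)
    (hQ : ∀ i ∈ blockEdges m U cls t, U i ≠ z → V i ≠ z → Q (U i) (V i)) {x : ℕ}
    (hx : x ∈ blockVerts n cls t) (hxz : x ≠ z) : Q x (P t) := by
  have hpar : ∀ y ∈ blockVerts n cls t, y ≠ z → P y ≠ 0 → P y ≠ z → Q y (P y) := by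
    intro y hy hyz hPy hPz
    obtain ⟨⟨h1, h2⟩, hc⟩ := mem_blockVerts.1 hy
    obtain ⟨e, he, hU, hV⟩ := h.tree y h1 h2 hPy
    have := hQ e (mem_blockEdges.2 ⟨he, by rw [hU, hc]⟩) (by rwa [hU]) (by rwa [hV])
    rwa [hU, hV] at this
  induction x using Nat.strong_induction_on with
  | _ x ih =>
    by_cases hxt : x = t
    · subst hxt
      exact hpar x hx hxz hP hz.symm
    · obtain ⟨hPx, hPlt⟩ := h.parent_mem hx hxt
      by_cases hPz : P x = z
      -- The way to the parent is blocked. Descend instead to the start of an edge that jumps over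
      -- `z`; its other end is smaller than `x`, so induction applies unless it is already `P t`.
      · obtain ⟨i, hi, k, hk, hlt⟩ := h.exists_back_of_covered hx hxt
        obtain ⟨hi', hc, -⟩ := mem_backEdges.1 hi
        have hUn := h.upper_le i hi'
        have hVp := h.lower_pos i hi'
        have hup : ∀ l ≤ k, Q x x → Q (P^[l] (U i)) x := by
          intro l hl hxx
          induction hd : k - l generalizing l with
          | zero =>
            rw [show l = k by omega, hk]
            exact hxx
          | succ d ihd =>
            have h1 := ihd (l + 1) (by omega) (by omega)
            rw [Function.iterate_succ_apply'] at h1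
            have hle := h.iterate_le hUn l
            have hge : x ≤ P^[l + 1] (U i) := by
              have : P^[k - (l + 1)] (P^[l + 1] (U i)) = x := by
                rw [← Function.iterate_add_apply, show k - (l + 1) + (l + 1) = k by omega, hk]
              rw [← this]
              exact h.iterate_le ((h.iterate_le hUn _).trans hUn) _
            rw [Function.iterate_succ_apply'] at hge
            have hge' := h.parent_le (hle.trans hUn)
            have hpl := h.parent_lt (P^[l] (U i)) (by omega) (hle.trans hUn)
            refine htrans _ _ _ (hpar _ (mem_blockVerts.2 ⟨⟨by omega, hle.trans hUn⟩, ?_⟩)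
              (by omega) (by omega) (by omega)) h1
            rw [h.cls_of_path hi' l (by omega), hc]
        have hUx : x ≤ U i := by
          rw [← hk]; exact h.iterate_le hUn k
        have hedge := hQ i (mem_blockEdges.2 ⟨hi', hc⟩) (by omega) (by omega)
        have hVQ : Q (V i) (P t) := by
          rcases h.cls_lower hi' with h1 | h1
          · exact ih (V i) (by omega) (mem_blockVerts.2 ⟨⟨hVp, by omega⟩, by rw [h1, hc]⟩)
              (by omega)
          · rw [hc] at h1
            rw [← h1]
            exact htrans _ _ _ (hsymm _ _ hedge) hedge
        have hUQ := htrans _ _ _ hedge hVQ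
        rcases Nat.eq_zero_or_pos k with rfl | hk0
        · rwa [← hk]
        -- `Q` is not assumed reflexive, because being linked includes membership in the subgraph;
        -- reflexivity comes from going along an edge and back.
        · have hxx : Q x x := by
            obtain ⟨k, rfl⟩ : ∃ k', k = k' + 1 := ⟨k - 1, by omega⟩
            rw [Function.iterate_succ_apply'] at hk
            have hle := h.iterate_le hUn k
            have hge' := h.parent_le (hle.trans hUn)
            have hpl := h.parent_lt (P^[k] (U i)) (by omega) (hle.trans hUn)
            have := hpar (P^[k] (U i)) (mem_blockVerts.2 ⟨⟨by omega, hle.trans hUn⟩, by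
              rw [h.cls_of_path hi' k (by omega), hc]⟩) (by omega) (by omega) (by omega)
            rw [hk] at this
            exact htrans _ _ _ (hsymm _ _ this) this
          exact htrans _ _ _ (hsymm _ _ (hup 0 (by omega) hxx)) hUQ
      · have h0 : P x ≠ 0 := by
          have := (mem_blockVerts.1 hPx).1
          omega
        exact htrans _ _ _ (hpar x hx hxz h0 hPz) (ih (P x) hPlt hPx hPz)

/-- The block with top vertex `t` stays connected if the parent of `t` is deleted. -/
theorem block_linked_top (h : BlockForest n m U V P cls) {Q : ℕ → ℕ → Prop}
    (htrans : ∀ x y w, Q x y → Q y w → Q x w)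
    (hQ : ∀ i ∈ blockEdges m U cls t, V i ∈ blockVerts n cls t → Q (U i) (V i)) {x : ℕ}
    (hx : x ∈ blockVerts n cls t) (hxt : x ≠ t) : Q x t := by
  induction x using Nat.strong_induction_on with
  | _ x ih =>
    obtain ⟨hPx, hPlt⟩ := h.parent_mem hx hxt
    obtain ⟨⟨h1, h2⟩, hc⟩ := mem_blockVerts.1 hx
    have h0 := (mem_blockVerts.1 hPx).1
    obtain ⟨e, he, hU, hV⟩ := h.tree x h1 h2 (by omega)
    have h3 := hQ e (mem_blockEdges.2 ⟨he, by rw [hU, hc]⟩) (by rwa [hV])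
    rw [hU, hV] at h3
    by_cases hPt : P x = t
    · rwa [hPt] at h3
    · exact htrans _ _ _ h3 (ih (P x) hPlt hPx hPt)

end BlockForest

/-- `u` and `v` are connected within a subgraph. -/
def Linked {W : Type*} {G : SimpleGraph W} (H : G.Subgraph) (u v : W) : Prop :=
  ∃ (hu : u ∈ H.verts) (hv : v ∈ H.verts), H.coe.Reachable ⟨u, hu⟩ ⟨v, hv⟩

theorem Linked.symm {W : Type*} {G : SimpleGraph W} {H : G.Subgraph} {u v : W}
    (h : Linked H u v) : Linked H v u := by
  obtain ⟨hu, hv, h⟩ := h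
  exact ⟨hv, hu, h.symm⟩

theorem Linked.trans {W : Type*} {G : SimpleGraph W} {H : G.Subgraph} {u v w : W}
    (h : Linked H u v) (h' : Linked H v w) : Linked H u w := by
  obtain ⟨hu, hv, h⟩ := h
  obtain ⟨_, hw, h'⟩ := h'
  exact ⟨hu, hw, h.trans h'⟩

theorem linked_of_adj {W : Type*} {G : SimpleGraph W} {H : G.Subgraph} {u v : W} (h : H.Adj u v) :
    Linked H u v :=
  ⟨H.edge_vert h, H.edge_vert h.symm, SimpleGraph.Adj.reachable h⟩

theorem preconnected_of_linked {W : Type*} {G : SimpleGraph W} {H : G.Subgraph} (w : W)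
    (h : ∀ u ∈ H.verts, u = w ∨ Linked H u w) : H.Preconnected := by
  rw [SimpleGraph.Subgraph.preconnected_iff]
  rintro ⟨u, hu⟩ ⟨v, hv⟩
  rcases h u hu with rfl | h1 <;> rcases h v hv with rfl | h2
  · rfl
  · obtain ⟨_, _, h2⟩ := h2.symm; exact h2
  · obtain ⟨_, _, h1⟩ := h1; exact h1
  · obtain ⟨_, _, h3⟩ := h1.trans h2.symm; exact h3

/-! ### Blocks as biconnected subgraphs -/

namespace BlockForest

variable {n m : ℕ} {U V P cls : ℕ → ℕ} {t : ℕ} {G : SimpleGraph (Fin n)} {φ : ℕ → Fin n}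

/-- The block with top vertex `t`, as a subgraph. -/
def blockSubgraph (h : BlockForest n m U V P cls) (hφ : Represents G m U V φ) (t : ℕ) :
    G.Subgraph where
  verts := {v | v = φ (P t) ∨ ∃ x ∈ blockVerts n cls t, v = φ x}
  Adj u v := ∃ i ∈ blockEdges m U cls t, s(u, v) = s(φ (U i), φ (V i))
  adj_sub := by
    rintro u v ⟨i, hi, he⟩
    have := hφ.adj i (mem_blockEdges.1 hi).1
    rw [← SimpleGraph.mem_edgeSet] at this ⊢
    rwa [he]
  edge_vert := by
    rintro u v ⟨i, hi, he⟩
    obtain ⟨hi, hc⟩ := mem_blockEdges.1 hi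
    have hU : U i ∈ blockVerts n cls t := mem_blockVerts.2 ⟨⟨h.upper_pos hi, h.upper_le i hi⟩, hc⟩
    rw [Sym2.eq_iff] at he
    rcases he with ⟨rfl, -⟩ | ⟨rfl, -⟩
    · exact Or.inr ⟨_, hU, rfl⟩
    · rcases h.cls_lower hi with h1 | h1
      · exact Or.inr ⟨_, mem_blockVerts.2 ⟨⟨h.lower_pos i hi,
          (h.lower_lt i hi).le.trans (h.upper_le i hi)⟩, by rw [h1, hc]⟩, rfl⟩
      · left; rw [h1, hc]
  symm := by
    constructor
    rintro u v ⟨i, hi, he⟩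
    exact ⟨i, hi, by rw [← he, Sym2.eq_swap]⟩

theorem blockSubgraph_isBiconnected (h : BlockForest n m U V P cls) (hφ : Represents G m U V φ)
    (ht : t ∈ blockVerts n cls t) (hP : P t ≠ 0) : IsBiconnected (h.blockSubgraph hφ t) := by
  obtain ⟨⟨h1, h2⟩, hct⟩ := mem_blockVerts.1 ht
  have hPt := h.parent_lt t h1 h2
  have hPm : P t ∉ blockVerts n cls t := fun hm => by
    have := h.le_of_mem hm
    omega
  have hadj : ∀ i ∈ blockEdges m U cls t, (h.blockSubgraph hφ t).Adj (φ (U i)) (φ (V i)) :=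
    fun i hi => ⟨i, hi, rfl⟩
  have hUm : ∀ i ∈ blockEdges m U cls t, U i ∈ blockVerts n cls t := fun i hi => by
    obtain ⟨hi, hc⟩ := mem_blockEdges.1 hi
    exact mem_blockVerts.2 ⟨⟨h.upper_pos hi, h.upper_le i hi⟩, hc⟩
  have hVm : ∀ i ∈ blockEdges m U cls t, V i ∈ Set.Icc 1 n := fun i hi => by
    obtain ⟨hi, hc⟩ := mem_blockEdges.1 hi
    exact ⟨h.lower_pos i hi, (h.lower_lt i hi).le.trans (h.upper_le i hi)⟩
  have hbI : ∀ x ∈ blockVerts n cls t, x ∈ Set.Icc 1 n := fun x hx => (mem_blockVerts.1 hx).1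
  constructor
  · rw [SimpleGraph.Subgraph.connected_iff]
    refine ⟨preconnected_of_linked (φ (P t)) ?_, ⟨_, Or.inl rfl⟩⟩
    rintro _ (rfl | ⟨x, hx, rfl⟩)
    · exact Or.inl rfl
    · right
      have h0 := (hbI x hx).1
      -- No vertex has the number `0`, so `z = 0` means that nothing is deleted.
      exact h.block_linked ht (z := 0) hP hP.symm
        (Q := fun x y => Linked (h.blockSubgraph hφ t) (φ x) (φ y)) (fun _ _ h => h.symm)
        (fun _ _ _ h h' => h.trans h') (fun i hi _ _ => linked_of_adj (hadj i hi)) hx (by omega)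
  · intro v hv
    have hdel : ∀ i ∈ blockEdges m U cls t, φ (U i) ≠ v → φ (V i) ≠ v →
        Linked ((h.blockSubgraph hφ t).deleteVerts {v}) (φ (U i)) (φ (V i)) := by
      intro i hi hu hv
      apply linked_of_adj
      rw [SimpleGraph.Subgraph.deleteVerts_adj]
      have := hadj i hi
      exact ⟨(h.blockSubgraph hφ t).edge_vert this, by simpa using hu,
        (h.blockSubgraph hφ t).edge_vert this.symm, by simpa using hv, this⟩
    rcases hv with rfl | ⟨z, hz, rfl⟩
    · apply preconnected_of_linked (φ t)
      rintro _ ⟨rfl | ⟨x, hx, rfl⟩, hne⟩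
      · exact absurd rfl hne
      · by_cases hxt : x = t
        · left; rw [hxt]
        · right
          refine h.block_linked_top (Q := fun x y =>
            Linked ((h.blockSubgraph hφ t).deleteVerts {φ (P t)}) (φ x) (φ y))
            (fun _ _ _ h h' => h.trans h') (fun i hi hV => hdel i hi ?_ ?_) hx hxt
          · intro he
            have := hφ.injOn (hbI _ (hUm i hi)) ⟨by omega, by omega⟩ he
            exact hPm (this ▸ hUm i hi)
          · intro he
            have := hφ.injOn (hbI _ hV) ⟨by omega, by omega⟩ he
            exact hPm (this ▸ hV)
    · have hzP : z ≠ P t := fun he => hPm (he ▸ hz)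
      apply preconnected_of_linked (φ (P t))
      rintro _ ⟨rfl | ⟨x, hx, rfl⟩, hne⟩
      · exact Or.inl rfl
      · right
        have hxz : x ≠ z := fun he => hne (by rw [he]; rfl)
        refine h.block_linked ht (z := z) hP hzP
          (Q := fun x y => Linked ((h.blockSubgraph hφ t).deleteVerts {φ z}) (φ x) (φ y))
          (fun _ _ h => h.symm) (fun _ _ _ h h' => h.trans h')
          (fun i hi hU hV => hdel i hi ?_ ?_) hx hxz
        · exact fun he => hU (hφ.injOn (hbI _ (hUm i hi)) (hbI _ hz) he)
        · exact fun he => hV (hφ.injOn (hVm i hi) (hbI _ hz) he)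

/-- It suffices that the block lies in some biconnected component; that it is one itself is not
needed, because its edges and forest paths persist in the larger subgraph. -/
theorem card_back_le (h : BlockForest n m U V P cls) (hφ : Represents G m U V φ) {k : ℕ}
    (hG : IsAlmostTree k G) (ht : t ∈ blockVerts n cls t) : #(backEdges m U V P cls t) ≤ k := by
  rcases (backEdges m U V P cls t).eq_empty_or_nonempty with h0 | hne
  · rw [h0]; simp
  have hP := (h.exists_root_edge ht hne).1
  have hbi := h.blockSubgraph_isBiconnected hφ ht (by omega)
  obtain ⟨H, hle, hH⟩ := (Set.toFinite {K : G.Subgraph | IsBiconnected K}).exists_le_maximal hbi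
  refine le_trans ?_ (hG H hH)
  have hadj : ∀ i ∈ blockEdges m U cls t, ∃ a b : H.verts, (a : Fin n) = φ (U i) ∧
      (b : Fin n) = φ (V i) ∧ H.coe.Adj a b := by
    intro i hi
    have : H.Adj (φ (U i)) (φ (V i)) := hle.2 ⟨i, hi, rfl⟩
    exact ⟨⟨_, H.edge_vert this⟩, ⟨_, H.edge_vert this.symm⟩, rfl, rfl, this⟩
  refine h.card_le_cyclomaticNumber hφ (ι := Subtype.val) Subtype.val_injective ?_ ?_ ?_
  · intro i hi
    obtain ⟨h1, -, h2⟩ := mem_backEdges.1 hi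
    exact ⟨h1, h2⟩
  · intro i hi
    obtain ⟨h1, h2, -⟩ := mem_backEdges.1 hi
    exact hadj i (mem_blockEdges.2 ⟨h1, h2⟩)
  · intro i hi k hk
    obtain ⟨h1, h2, -⟩ := mem_backEdges.1 hi
    have hle := h.lower_le_parent h1 hk
    have := h.lower_pos i h1
    obtain ⟨e, he, hU, hV⟩ := h.tree (P^[k] (U i)) (by omega)
      ((h.iterate_le (h.upper_le i h1) k).trans (h.upper_le i h1)) (by omega)
    rw [← hV, ← hU]
    refine hadj e (mem_blockEdges.2 ⟨he, ?_⟩)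
    rw [hU, h.cls_of_path h1 k hk, h2]

end BlockForest

end OnePage

namespace OnePage

open Finset WordRAM

/-! ### Running times -/

/-- `φ` inverts the numbering; `0 < n` provides a value for arguments outside `1, …, n`. -/
theorem exists_represents {n : ℕ} {G : SimpleGraph (Fin n)} {es : List (Fin n × Fin n)}
    (hes : IsEdgeList G es) (hn : 0 < n) {num U V : ℕ → ℕ}
    (hnum : ∀ v, 1 ≤ v → v ≤ n → 1 ≤ num v ∧ num v ≤ n) (hinj : Set.InjOn num (Set.Icc 1 n))
    (hU : ∀ i < es.length, U i = max (num (fstEnd es i + 1)) (num (sndEnd es i + 1)))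
    (hV : ∀ i < es.length, V i = min (num (fstEnd es i + 1)) (num (sndEnd es i + 1))) :
    ∃ φ, Represents G es.length U V φ := by
  have hI : ∀ v : Fin n, (v : ℕ) + 1 ∈ Set.Icc 1 n := fun v => ⟨by omega, v.2⟩
  have hsurj : Set.SurjOn num (Icc 1 n) (Icc 1 n) := by
    refine surjOn_of_injOn_of_card_le num (fun v hv => ?_) (by simpa using hinj) le_rfl
    simp only [coe_Icc, Set.mem_Icc] at hv ⊢
    exact hnum v hv.1 hv.2
  have hex : ∀ x, ∃ v : Fin n, x ∈ Set.Icc 1 n → num (v + 1) = x := by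
    intro x
    by_cases hx : x ∈ Set.Icc 1 n
    · obtain ⟨v, hv, he⟩ := hsurj (by simpa using hx)
      simp only [coe_Icc, Set.mem_Icc] at hv
      refine ⟨⟨v - 1, by omega⟩, fun _ => ?_⟩
      rw [← he]
      congr 1
      simp only
      omega
    · exact ⟨⟨0, hn⟩, fun h => absurd h hx⟩
  choose φ hφ using hex
  have hφnum : ∀ v : Fin n, φ (num (v + 1)) = v := by
    intro v
    have h1 := hφ (num (v + 1)) (hnum _ (hI v).1 (hI v).2)
    have := hinj (hI _) (hI v) h1
    exact Fin.ext (by omega)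
  refine ⟨φ, fun x hx y hy hxy => ?_, fun i hi => ?_⟩
  · rw [← hφ x hx, ← hφ y hy, hxy]
  · rw [hU i hi, hV i hi, fstEnd_eq hi, sndEnd_eq hi]
    have hadj := hes.adj hi
    rcases le_total (num (es[i].1 + 1)) (num (es[i].2 + 1)) with h | h
    · rw [max_eq_right h, min_eq_left h, hφnum, hφnum]
      exact hadj.symm
    · rw [max_eq_left h, min_eq_right h, hφnum, hφnum]
      exact hadj

/-- The time that is spent on the drawings of a block of order `N` with `M` edges. -/
def blockTime (N M : ℕ) : ℕ := N.factorial * (1100 * (N + M + 1) * (N + M + 1))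

/-- The three factors of `(5 * K)!` beyond `(5 * K - 3)!` are at least `5 * K`, `4 * K` and `1`,
which absorbs the quadratic cost of an order: `1100 * 11 ^ 2 = 6655 * 20`. -/
theorem blockTime_le {N M K : ℕ} (hN : N + 3 ≤ 5 * K) (hM : M ≤ 6 * K) :
    blockTime N M ≤ 7000 * (5 * K).factorial := by
  obtain ⟨a, ha⟩ : ∃ a, 5 * K = a + 3 := ⟨5 * K - 3, by omega⟩
  have h1 : N.factorial ≤ a.factorial := Nat.factorial_le (by omega)
  have h2 : 1100 * (N + M + 1) * (N + M + 1) ≤ 1100 * (11 * K) * (11 * K) :=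
    Nat.mul_le_mul (Nat.mul_le_mul le_rfl (by omega)) (by omega)
  have h3 : (5 * K).factorial = ((a + 3) * (a + 2) * (a + 1)) * a.factorial := by
    rw [ha, Nat.factorial_succ, Nat.factorial_succ, Nat.factorial_succ]
    ring
  have h4 : (5 * K) * (4 * K) * 1 ≤ (a + 3) * (a + 2) * (a + 1) :=
    Nat.mul_le_mul (Nat.mul_le_mul (by omega) (by omega)) (by omega)
  calc blockTime N M ≤ a.factorial * (1100 * (11 * K) * (11 * K)) := Nat.mul_le_mul h1 h2
    _ = 6655 * ((5 * K) * (4 * K) * 1 * a.factorial) := by ring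
    _ ≤ 6655 * (5 * K).factorial := by
      rw [h3]
      exact Nat.mul_le_mul_left _ (Nat.mul_le_mul_right _ h4)
    _ ≤ 7000 * (5 * K).factorial := Nat.mul_le_mul_right _ (by norm_num)

theorem blockTime_le_const {N M : ℕ} (hN : N ≤ 2) (hM : M ≤ 1) : blockTime N M ≤ 35200 := by
  have h1 : N.factorial ≤ Nat.factorial 2 := Nat.factorial_le hN
  have h2 : 1100 * (N + M + 1) * (N + M + 1) ≤ 1100 * 4 * 4 :=
    Nat.mul_le_mul (Nat.mul_le_mul le_rfl (by omega)) (by omega)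
  exact Nat.mul_le_mul h1 h2

/-- The value `0` replaces `0! = 1`, so that the possibly many blocks without back edges do not
contribute. For positive arguments the sum of two factorials is at most their product, which divides
the factorial of the sum. -/
theorem sum_factorial_le {ι : Type*} (S : Finset ι) (K : ι → ℕ) :
    ∑ i ∈ S, (if K i = 0 then 0 else (5 * K i).factorial) ≤
      if ∑ i ∈ S, K i = 0 then 0 else (5 * ∑ i ∈ S, K i).factorial := by
  classical
  induction S using Finset.induction_on with
  | empty => simp
  | insert a S ha ih =>
    rw [sum_insert ha, sum_insert ha]
    refine (Nat.add_le_add_left ih _).trans ?_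
    generalize K a = x
    generalize ∑ i ∈ S, K i = y
    rcases Nat.eq_zero_or_pos x with rfl | hx
    · simp
    rcases Nat.eq_zero_or_pos y with rfl | hy
    · simp
    rw [if_neg (by omega), if_neg (by omega), if_neg (by omega), mul_add]
    have h1 := Nat.le_of_dvd (Nat.factorial_pos _)
      (Nat.factorial_mul_factorial_dvd_factorial_add (5 * x) (5 * y))
    have h2 : 2 ≤ (5 * x).factorial := (show 2 ≤ 5 * x by omega).trans (Nat.self_le_factorial _)
    have h3 : 2 ≤ (5 * y).factorial := (show 2 ≤ 5 * y by omega).trans (Nat.self_le_factorial _)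
    refine le_trans ?_ h1
    nlinarith

theorem _root_.WordRAM.Ends.exists_run {w : ℕ} {p : Prog} {s : State} {Q : ℕ → State → Prop} (h : Ends w p s Q) :
    ∃ t s', Run w p s t s' ∧ Q t s' := by
  rwa [Ends] at h

/-- The correctness of the program, with its running time in terms of the blocks. -/
theorem mainProg_correct (k : Bool) {n w : ℕ} {G : SimpleGraph (Fin n)}
    {es : List (Fin n × Fin n)} (hes : IsEdgeList G es) (hw : (n + es.length + 2) ^ 4 ≤ 2 ^ w) :
    ∃ t s', Run w (mainProg k) (inputState n es) t s' ∧
      s'.reg 0 = opt k (range es.length) (fstEnd es) (sndEnd es) ∧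
      ∃ U V P cls : ℕ → ℕ, BlockForest n es.length U V P cls ∧
        (0 < n → ∃ φ, Represents G es.length U V φ) ∧ ∃ T : ℕ → ℕ,
        t ≤ 1300 * (n + es.length + 1) + ∑ j ∈ range n, T j ∧
        ∀ j < n, (backEdges es.length U V P cls (j + 1) = ∅ ∧ T j ≤ 35200) ∨
          ((backEdges es.length U V P cls (j + 1)).Nonempty ∧ cls (j + 1) = j + 1 ∧
            T j ≤ 7000 * (5 * #(backEdges es.length U V P cls (j + 1))).factorial) := by
  obtain ⟨t, s', hrun, num, U, V, P, cls, idx, best, ht, hnum, hinj, hU, hV, h, hN, h0, hbest⟩ :=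
    (mainProg_spec k hes hw).exists_run
  have hb : ∀ i < es.length, fstEnd es i < n ∧ sndEnd es i < n := fun i hi => by
    rw [fstEnd_eq hi, sndEnd_eq hi]
    exact ⟨es[i].1.2, es[i].2.2⟩
  refine ⟨t, s', hrun, ?_, U, V, P, cls, h,
    fun hn => exists_represents hes hn hnum hinj hU hV, _, ht, fun j hj => ?_⟩
  · rw [h0, h.sum_best hN hbest]
    exact opt_num k (fun i hi => (hb i hi).1) (fun i hi => (hb i hi).2) hinj hU hV
  · rcases (backEdges es.length U V P cls (j + 1)).eq_empty_or_nonempty with hK | hK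
    · left
      obtain ⟨h1, h2⟩ := h.size_of_no_back (idx := idx) hK
      exact ⟨hK, blockTime_le_const h1 h2⟩
    · right
      have hcls : cls (j + 1) = j + 1 := by
        obtain ⟨i, hi⟩ := hK
        obtain ⟨hi, hc, -⟩ := mem_backEdges.1 hi
        rw [← hc]
        exact h.cls_cls (h.upper_pos hi) (h.upper_le i hi)
      obtain ⟨h1, h2⟩ := h.size hN hcls (by omega) hj hK
      exact ⟨hK, hcls, blockTime_le h1 h2⟩

/-- Blocks without back edges cost a constant each, hence `O(n)` in total; the others together cost
a constant times one factorial. -/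
theorem mainProg_cyclomatic (k : Bool) {n : ℕ} {G : SimpleGraph (Fin n)} {r : ℕ}
    (hr : ∀ es, IsEdgeList G es → r = opt k (range es.length) (fstEnd es) (sndEnd es)) :
    ComputesWithin (mainProg k) 4 G r
      (50000 * (Nat.factorial (5 * cyclomaticNumber G) + n)) := by
  intro es hes w hw
  obtain ⟨t, s', hrun, hres, U, V, P, cls, h, hφ, T, ht, hT⟩ := mainProg_correct k hes hw
  refine ⟨t, ?_, s', hrun, by rw [hres, hr es hes]⟩
  have hpos := Nat.factorial_pos (5 * cyclomaticNumber G)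
  rcases Nat.eq_zero_or_pos n with hn | hn
  · subst hn
    have : es.length = 0 := by
      rcases es with _ | ⟨e, es⟩
      · rfl
      · exact e.1.elim0
    rw [sum_range_zero] at ht
    omega
  · obtain ⟨φ, hφ⟩ := hφ hn
    have hK := h.sum_back_le hφ
    have hm := h.card_le_add_sum_back
    have hself := Nat.self_le_factorial (5 * cyclomaticNumber G)
    have hsum : ∑ j ∈ range n, T j ≤ 35200 * n + 7000 * ∑ j ∈ range n,
        (if #(backEdges es.length U V P cls (j + 1)) = 0 then 0 else
          (5 * #(backEdges es.length U V P cls (j + 1))).factorial) := by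
      rw [show 35200 * n = ∑ j ∈ range n, 35200 by simp [mul_comm], mul_sum, ← sum_add_distrib]
      refine sum_le_sum fun j hj => ?_
      rcases hT j (mem_range.1 hj) with ⟨-, h2⟩ | ⟨h1, -, h2⟩
      · omega
      · rw [if_neg (card_pos.2 h1).ne']
        omega
    have hfac := sum_factorial_le (range n) fun j => #(backEdges es.length U V P cls (j + 1))
    have hle : (if ∑ j ∈ range n, #(backEdges es.length U V P cls (j + 1)) = 0 then 0 else
        (5 * ∑ j ∈ range n, #(backEdges es.length U V P cls (j + 1))).factorial) ≤
        Nat.factorial (5 * cyclomaticNumber G) := by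
      split_ifs
      · exact Nat.zero_le _
      · exact Nat.factorial_le (by omega)
    omega

/-- Each number `j < n` is charged for its block and for the edges that exceed `n`, so `35200 +
1300` times the factorial suffices per number. -/
theorem mainProg_almostTree (k : Bool) {n c : ℕ} {G : SimpleGraph (Fin n)} {r : ℕ} (hn : 0 < n)
    (hG : IsAlmostTree c G)
    (hr : ∀ es, IsEdgeList G es → r = opt k (range es.length) (fstEnd es) (sndEnd es)) :
    ComputesWithin (mainProg k) 4 G r (50000 * (Nat.factorial (5 * c) * n)) := by
  intro es hes w hw
  obtain ⟨t, s', hrun, hres, U, V, P, cls, h, hφ, T, ht, hT⟩ := mainProg_correct k hes hw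
  refine ⟨t, ?_, s', hrun, by rw [hres, hr es hes]⟩
  obtain ⟨φ, hφ⟩ := hφ hn
  have hm := h.card_le_add_sum_back
  have hpos := Nat.factorial_pos (5 * c)
  have hself := Nat.self_le_factorial (5 * c)
  have hK : ∀ j < n, (backEdges es.length U V P cls (j + 1)).Nonempty → cls (j + 1) = j + 1 →
      #(backEdges es.length U V P cls (j + 1)) ≤ c := fun j hj _ hc =>
    h.card_back_le hφ hG (mem_blockVerts.2 ⟨⟨by omega, hj⟩, hc⟩)
  have hsum : ∑ j ∈ range n, (T j + 1300 * #(backEdges es.length U V P cls (j + 1))) ≤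
      n * (36500 * Nat.factorial (5 * c)) := by
    refine (sum_le_card_nsmul _ _ (36500 * Nat.factorial (5 * c)) fun j hj => ?_).trans
      (by simp)
    rcases hT j (mem_range.1 hj) with ⟨h1, h2⟩ | ⟨h1, h2, h3⟩
    · rw [h1, card_empty]
      omega
    · have h4 := hK j (mem_range.1 hj) h1 h2
      have h5 : (5 * #(backEdges es.length U V P cls (j + 1))).factorial ≤ Nat.factorial (5 * c) :=
        Nat.factorial_le (by omega)
      omega
  rw [sum_add_distrib, ← mul_sum] at hsum
  have h1 : n * 1 ≤ n * Nat.factorial (5 * c) := Nat.mul_le_mul_left _ hpos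
  rw [show n * (36500 * Nat.factorial (5 * c)) = 36500 * (n * Nat.factorial (5 * c)) by ring] at hsum
  rw [mul_comm (Nat.factorial (5 * c)) n]
  omega

end OnePage

theorem theorem1 :
    -- graphs with cyclomatic number `k`: time `O((5k)! + n)`
    (∃ (P : WordRAM.Prog) (C c : ℕ), ∀ (n k : ℕ) (G : SimpleGraph (Fin n)),
      OnePage.cyclomaticNumber G = k →
        OnePage.ComputesWithin P c G (OnePage.pageCrossingNumber G)
          (C * (Nat.factorial (5 * k) + n))) ∧
    (∃ (P : WordRAM.Prog) (C c : ℕ), ∀ (n k : ℕ) (G : SimpleGraph (Fin n)),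
      OnePage.cyclomaticNumber G = k →
        OnePage.ComputesWithin P c G (OnePage.pageCrossedNumber G)
          (C * (Nat.factorial (5 * k) + n))) ∧
    -- `k`-almost-trees: time `O((5k)! n)`
    (∃ (P : WordRAM.Prog) (C c : ℕ), ∀ (n k : ℕ) (G : SimpleGraph (Fin n)),
      0 < n → OnePage.IsAlmostTree k G →
        OnePage.ComputesWithin P c G (OnePage.pageCrossingNumber G)
          (C * (Nat.factorial (5 * k) * n))) ∧
    (∃ (P : WordRAM.Prog) (C c : ℕ), ∀ (n k : ℕ) (G : SimpleGraph (Fin n)),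
      0 < n → OnePage.IsAlmostTree k G →
        OnePage.ComputesWithin P c G (OnePage.pageCrossedNumber G)
          (C * (Nat.factorial (5 * k) * n))) := by
  refine ⟨⟨OnePage.mainProg false, 50000, 4, ?_⟩, ⟨OnePage.mainProg true, 50000, 4, ?_⟩,
    ⟨OnePage.mainProg false, 50000, 4, ?_⟩, ⟨OnePage.mainProg true, 50000, 4, ?_⟩⟩
  · rintro n _ G rfl
    exact OnePage.mainProg_cyclomatic false fun es hes => hes.pageCrossingNumber_eq
  · rintro n _ G rfl
    exact OnePage.mainProg_cyclomatic true fun es hes => hes.pageCrossedNumber_eq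
  · intro n k G hn hG
    exact OnePage.mainProg_almostTree false hn hG fun es hes => hes.pageCrossingNumber_eq
  · intro n k G hn hG
    exact OnePage.mainProg_almostTree true hn hG fun es hes => hes.pageCrossedNumber_eq
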